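/- **Theorem (full abstraction).** Let $\mathcal{X}$ be an infinite set of names. *The calculus.* Processes are $P,Q ::= 0 \mid x?(y_1,\dots,y_n)\Rightarrow P \mid x!(z_1,\dots,z_n) \mid (\mathsf{new}\,x)P \mid P|Q$, with $n\ge 0$, names from $\mathcal{X}$, and $y_1,\dots,y_n$ pairwise distinct; an input binds $y_1,\dots,y_n$ in its body, $(\mathsf{new}\,x)$ binds $x$, and $FN(P)$ is the set of free names. Structural congruence $\equiv$ is the least congruence that contains $\alpha$-equivalence, makes $(|,0)$ a commutative monoid, and satisfies $(\mathsf{new}\,x)(\mathsf{new}\,x)P\equiv(\mathsf{new}\,x)P$, $(\mathsf{new}\,x)(\mathsf{new}\,y)P\equiv(\mathsf{new}\,y)(\mathsf{new}\,x)P$, and $((\mathsf{new}\,x)P)|Q\equiv(\mathsf{new}\,x)(P|Q)$ for $x\notin FN(Q)$. Reduction $\to$ is the least relation with $(x?(\vec y)\Rightarrow P)\,|\,x!(\vec z)\to P\{\vec z/\vec y\}$ whenever $|\vec y|=|\vec z|$ (capture-avoiding substitution), closed under $-|Q$, under $(\mathsf{new}\,x)$, and under $\equiv$ on both sides. Observation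 $\downarrow$ is the least relation such that $x!(\vec z)\downarrow x$; if $P\downarrow x$ or $Q\downarrow x$ then $P|Q\downarrow x$; and if $P\downarrow x$ and $x\ne u$ then $(\mathsf{new}\,u)P\downarrow x$. A barbed bisimulation is a symmetric relation $S$ on processes such that $P\,S\,Q$ implies: every $P\to P'$ is matched by some $Q\to Q'$ with $P'\,S\,Q'$; and $P\downarrow x$ implies $Q\downarrow x$. $P$ and $Q$ are barbed bisimilar if some barbed bisimulation relates them. *The 2-category.* Let $\mathcal{T}$ be the free symmetric monoidal closed 2-category (strict 2-category, unit $I$, internal hom $\multimap$) on objects $\mathcal{N},\mathcal{P}$; 1-morphisms $\Delta:\mathcal{N}\to\mathcal{N}\otimes\mathcal{N}$, $\delta:\mathcal{N}\to I$, $|:\mathcal{P}\otimes\mathcal{P}\to\mathcal{P}$, $0:I\to\mathcal{P}$, $?_n:\mathcal{N}\otimes(\mathcal{N}^{\otimes n}\multimap\mathcal{P})\to\mathcal{P}$ and $!_n:\mathcal{N}\otimes\mathcal{N}^{\otimes n}\to\mathcal{P}$ for $n\ge0$, $fresh:I\to\mathcal{N}$, $COMM:I\to\mathcal{P}$, and $[\![x]\!]:I\to\mathcal{N}$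 for each $x\in\mathcal{X}$; equations making $(\mathcal{P},|,0)$ a commutative monoid and $(\mathcal{N},\Delta,\delta)$ a cocommutative comonoid; and for each $n\ge0$ a 2-morphism $comm_n$ between 1-morphisms $\mathcal{N}\otimes\mathcal{N}^{\otimes n}\otimes(\mathcal{N}^{\otimes n}\multimap\mathcal{P})\to\mathcal{P}$ which, writing $x,\vec z,k$ for the inputs, is $$comm_n:\ (!_n(x,\vec z)\,|\,?_n(x,k))\,|\,COMM\ \Rightarrow\ ev(\vec z,k)\,|\,COMM ,$$ where $x$ is duplicated by $\Delta$ in the source and deleted by $\delta$ in the target. *The interpretation.* For a list $\Gamma$ of names containing $FN(P)$ there is a 1-morphism $[\![P]\!]_\Gamma:\mathcal{N}^{\otimes\Gamma}\to\mathcal{P}$, where names are projections from $\mathcal{N}^{\otimes\Gamma}$ (a bound name shadowing earlier ones) and inputs are distributed by $\Delta$ and $\delta$: $[\![0]\!]_\Gamma$ is $0$; $[\![x?(\vec y)\Rightarrow Q]\!]_\Gamma$ is $?_n$ applied to $x$ and to the currying of $[\![Q]\!]_{\vec y,\Gamma}$ in its first $n$ inputs; $[\![x!(\vec z)]\!]_\Gamma$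 is $!_n$ applied to $x$ and $\vec z$; $[\![(\mathsf{new}\,x)Q]\!]_\Gamma$ is $[\![Q]\!]_{x,\Gamma}$ with $fresh$ as first input; $[\![Q|Q']\!]_\Gamma$ is $|$ applied to $[\![Q]\!]_\Gamma$ and $[\![Q']\!]_\Gamma$. Let $[\![P]\!]:I\to\mathcal{P}$ be $[\![P]\!]_{FN(P)}$ composed with $\bigotimes_{x\in FN(P)}[\![x]\!]$, and let $[\![P]\!]_{top}=[\![P]\!]\,|\,COMM$. *Semantic bisimilarity.* Write $[\![P]\!]\Rightarrow^{comm}[\![P']\!]$ if, up to tensoring with scalars, there is a 2-morphism from $[\![P]\!]_{top}$ to $[\![P']\!]_{top}$ generated by exactly one top-level occurrence of some $comm_n$; that is, for some scalars $s,t:I\to I$ there is a 2-morphism $s\otimes[\![P]\!]_{top}\Rightarrow t\otimes[\![P']\!]_{top}$ obtained from one $comm_n$ by vertical composition, horizontal composition and tensoring with identity 2-morphisms only. Let $\Downarrow$ be the least relation between 1-morphisms $I\to\mathcal{P}$ and 1-morphisms $I\to\mathcal{N}$ such that $[\![x!(\vec z)]\!]\Downarrow[\![x]\!]$; if $[\![P]\!]\Downarrow[\![x]\!]$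 or $[\![Q]\!]\Downarrow[\![x]\!]$ then $[\![P|Q]\!]\Downarrow[\![x]\!]$; and if $[\![P]\!]\Downarrow[\![x]\!]$ and $x\neq u$ then $[\![(\mathsf{new}\,u)P]\!]\Downarrow[\![x]\!]$. A semantic bisimulation is a symmetric relation $S$ on 1-morphisms $I\to\mathcal{P}$ such that for all processes $P,Q$ with $[\![P]\!]\,S\,[\![Q]\!]$: whenever $[\![P]\!]\Rightarrow^{comm}[\![P']\!]$ for a process $P'$, there is a process $Q'$ with $[\![Q]\!]\Rightarrow^{comm}[\![Q']\!]$ and $[\![P']\!]\,S\,[\![Q']\!]$; and $[\![P]\!]\Downarrow[\![x]\!]$ implies $[\![Q]\!]\Downarrow[\![x]\!]$. Two 1-morphisms are semantically bisimilar if some semantic bisimulation relates them. *Claim.* For all processes $P,Q$: $P$ and $Q$ are barbed bisimilar if and only if $[\![P]\!]$ and $[\![Q]\!]$ are semantically bisimilar. -/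

import Mathlib

universe u

open CategoryTheory MonoidalCategory

/-! ## The finite polyadic π-calculus -/

namespace PiCalc

/-- Terms of the finite polyadic π-calculus over a set `𝒩` of names:
`0`, `x?(y₁, …, yₙ) ⇒ P` (with pairwise distinct parameters), `x!(z₁, …, zₙ)`,
`(new x) P` and `P | Q`. -/
inductive Proc (𝒩 : Type u) : Type u
  | nil : Proc 𝒩
  | inp (x : 𝒩) (ys : List 𝒩) (hys : ys.Nodup) (P : Proc 𝒩) : Proc 𝒩
  | out (x : 𝒩) (zs : List 𝒩) : Proc 𝒩
  | new (x : 𝒩) (P : Proc 𝒩) : Proc 𝒩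
  | par (P Q : Proc 𝒩) : Proc 𝒩

variable {𝒩 : Type u} [DecidableEq 𝒩]

/-- Free names. -/
def Proc.fn : Proc 𝒩 → Finset 𝒩
  | .nil => ∅
  | .inp x ys _ P => insert x (P.fn \ ys.toFinset)
  | .out x zs => insert x zs.toFinset
  | .new x P => P.fn \ {x}
  | .par P Q => P.fn ∪ Q.fn

/-- The map on names sending `ys` to `zs` pointwise and agreeing with `σ` elsewhere. -/
def assign : List 𝒩 → List 𝒩 → (𝒩 → 𝒩) → 𝒩 → 𝒩
  | y :: ys, z :: zs, σ => Function.update (assign ys zs σ) y z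
  | _, _, σ => σ

theorem exists_freshNames [Infinite 𝒩] (n : ℕ) (S : Finset 𝒩) :
    ∃ l : List 𝒩, l.length = n ∧ l.Nodup ∧ ∀ v ∈ l, v ∉ S := by
  induction n with
  | zero => exact ⟨[], rfl, List.nodup_nil, by simp⟩
  | succ n ih =>
    obtain ⟨l, h1, h2, h3⟩ := ih
    obtain ⟨v, hv⟩ := Infinite.exists_notMem_finset (S ∪ l.toFinset)
    simp only [Finset.mem_union, List.mem_toFinset, not_or] at hv
    refine ⟨v :: l, by simp [h1], List.nodup_cons.2 ⟨hv.2, h2⟩, ?_⟩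
    intro w hw
    rcases List.mem_cons.1 hw with rfl | hw
    · exact hv.1
    · exact h3 w hw

/-- A list of `n` pairwise distinct names outside the finite set `S`. -/
noncomputable def freshNames [Infinite 𝒩] (n : ℕ) (S : Finset 𝒩) : List 𝒩 :=
  (exists_freshNames n S).choose

theorem freshNames_nodup [Infinite 𝒩] (n : ℕ) (S : Finset 𝒩) : (freshNames n S).Nodup :=
  (exists_freshNames n S).choose_spec.2.1

/-- A name outside the finite set `S`. -/
noncomputable def freshName [Infinite 𝒩] (S : Finset 𝒩) : 𝒩 :=
  (Infinite.exists_notMem_finset S).choose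

/-- Capture-avoiding simultaneous renaming of the free names along `σ`: binders are always
replaced by names that differ from the image of every other free name of the body. -/
noncomputable def Proc.rename [Infinite 𝒩] : Proc 𝒩 → (𝒩 → 𝒩) → Proc 𝒩
  | .nil, _ => .nil
  | .inp x ys _ P, σ =>
      let ws := freshNames ys.length ((P.fn \ ys.toFinset).image σ)
      .inp (σ x) ws (freshNames_nodup _ _) (P.rename (assign ys ws σ))
  | .out x zs, σ => .out (σ x) (zs.map σ)
  | .new u P, σ =>
      let w := freshName ((P.fn \ {u}).image σ)
      .new w (P.rename (Function.update σ u w))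
  | .par P Q, σ => .par (P.rename σ) (Q.rename σ)

/-- The substitution `P{zs/ys}`. -/
noncomputable def Proc.subst [Infinite 𝒩] (P : Proc 𝒩) (zs ys : List 𝒩) : Proc 𝒩 :=
  P.rename (assign ys zs id)

/-- Structural congruence: the least congruence containing α-conversion, making `|`, `0` a
commutative monoid, and satisfying the three laws for `new`. -/
inductive StructCong [Infinite 𝒩] : Proc 𝒩 → Proc 𝒩 → Prop
  | refl (P) : StructCong P P
  | symm {P Q} : StructCong P Q → StructCong Q P
  | trans {P Q R} : StructCong P Q → StructCong Q R → StructCong P R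
  | inp (x ys hys) {P Q} : StructCong P Q → StructCong (.inp x ys hys P) (.inp x ys hys Q)
  | new (x) {P Q} : StructCong P Q → StructCong (.new x P) (.new x Q)
  | par {P P' Q Q'} : StructCong P P' → StructCong Q Q' → StructCong (.par P Q) (.par P' Q')
  | alpha_inp (x ys hys ys' hys' P) : ys.length = ys'.length →
      (∀ v ∈ ys', v ∉ P.fn \ ys.toFinset) →
      StructCong (.inp x ys hys P) (.inp x ys' hys' (P.subst ys' ys))
  | alpha_new (u v P) : v ∉ P.fn \ {u} → StructCong (.new u P) (.new v (P.subst [v] [u]))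
  | par_nil (P) : StructCong (.par P .nil) P
  | par_comm (P Q) : StructCong (.par P Q) (.par Q P)
  | par_assoc (P Q R) : StructCong (.par (.par P Q) R) (.par P (.par Q R))
  | new_idem (x P) : StructCong (.new x (.new x P)) (.new x P)
  | new_swap (x y P) : StructCong (.new x (.new y P)) (.new y (.new x P))
  | scope (x P Q) : x ∉ Q.fn → StructCong (.par (.new x P) Q) (.new x (.par P Q))

/-- The reduction relation `P → P'`. -/
inductive Red [Infinite 𝒩] : Proc 𝒩 → Proc 𝒩 → Prop
  | comm (x ys hys P zs) : ys.length = zs.length →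
      Red (.par (.inp x ys hys P) (.out x zs)) (P.subst zs ys)
  | par {P P'} (Q) : Red P P' → Red (.par P Q) (.par P' Q)
  | new (x) {P P'} : Red P P' → Red (.new x P) (.new x P')
  | equiv {P P' Q' Q} : StructCong P P' → Red P' Q' → StructCong Q' Q → Red P Q

/-- The observation relation `P ↓ x`. -/
inductive Barb : Proc 𝒩 → 𝒩 → Prop
  | out (x ys) : Barb (.out x ys) x
  | par_left {P x} (Q) : Barb P x → Barb (.par P Q) x
  | par_right (P) {Q x} : Barb Q x → Barb (.par P Q) x
  | new (u) {P x} : Barb P x → x ≠ u → Barb (.new u P) x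

/-- Barbed bisimulations. -/
def IsBarbedBisimulation [Infinite 𝒩] (S : Proc 𝒩 → Proc 𝒩 → Prop) : Prop :=
  (∀ P Q, S P Q → S Q P) ∧
  ∀ P Q, S P Q →
    (∀ P', Red P P' → ∃ Q', Red Q Q' ∧ S P' Q') ∧
    (∀ x, Barb P x → Barb Q x)

/-- Barbed bisimilarity. -/
def BarbedBisimilar [Infinite 𝒩] (P Q : Proc 𝒩) : Prop :=
  ∃ S, IsBarbedBisimulation S ∧ S P Q

end PiCalc

/-! ## The free symmetric monoidal closed 2-category -/

namespace PiTheory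

/-- Objects: generated by `N` (names) and `P` (processes) under unit, tensor, internal hom. -/
inductive Ob (𝒩 : Type u) : Type
  | unit : Ob 𝒩
  | N : Ob 𝒩
  | P : Ob 𝒩
  | tensor (X Y : Ob 𝒩) : Ob 𝒩
  | hom (X Y : Ob 𝒩) : Ob 𝒩

/-- The tensor power `N^{⊗ n}`. -/
def Ob.pow (𝒩 : Type u) : ℕ → Ob 𝒩
  | 0 => .unit
  | n + 1 => .tensor .N (Ob.pow 𝒩 n)

/-- Formal 1-morphisms: structural symmetric monoidal closed operations and generators.
Each name `x` has a generator `name x` picking it out of `N`. -/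
inductive Tm (𝒩 : Type u) : Ob 𝒩 → Ob 𝒩 → Type u
  | id (X) : Tm 𝒩 X X
  | comp {X Y Z} : Tm 𝒩 X Y → Tm 𝒩 Y Z → Tm 𝒩 X Z
  | tensor {X Y X' Y'} : Tm 𝒩 X Y → Tm 𝒩 X' Y' → Tm 𝒩 (.tensor X X') (.tensor Y Y')
  | assocHom (X Y Z) : Tm 𝒩 (.tensor (.tensor X Y) Z) (.tensor X (.tensor Y Z))
  | assocInv (X Y Z) : Tm 𝒩 (.tensor X (.tensor Y Z)) (.tensor (.tensor X Y) Z)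
  | lunitHom (X) : Tm 𝒩 (.tensor .unit X) X
  | lunitInv (X) : Tm 𝒩 X (.tensor .unit X)
  | runitHom (X) : Tm 𝒩 (.tensor X .unit) X
  | runitInv (X) : Tm 𝒩 X (.tensor X .unit)
  | braid (X Y) : Tm 𝒩 (.tensor X Y) (.tensor Y X)
  | curry {A Y X} : Tm 𝒩 (.tensor A Y) X → Tm 𝒩 Y (.hom A X)
  | ev (A X) : Tm 𝒩 (.tensor A (.hom A X)) X
  | dup : Tm 𝒩 .N (.tensor .N .N)
  | del : Tm 𝒩 .N .unit
  | bar : Tm 𝒩 (.tensor .P .P) .P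
  | zero : Tm 𝒩 .unit .P
  | recv (n : ℕ) : Tm 𝒩 (.tensor .N (.hom (Ob.pow 𝒩 n) .P)) .P
  | send (n : ℕ) : Tm 𝒩 (.tensor .N (Ob.pow 𝒩 n)) .P
  | fresh : Tm 𝒩 .unit .N
  | COMM : Tm 𝒩 .unit .P
  | name (x : 𝒩) : Tm 𝒩 .unit .N

/-- Equality of 1-morphisms: the congruence generated by the axioms of symmetric monoidal closed
categories, the commutative monoid axioms for `(P, |, 0)` and the cocommutative comonoid
axioms for `(N, Δ, δ)`. -/
inductive TmEq {𝒩 : Type u} : {X Y : Ob 𝒩} → Tm 𝒩 X Y → Tm 𝒩 X Y → Prop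
  -- congruence
  | refl {X Y} (f : Tm 𝒩 X Y) : TmEq f f
  | symm {X Y} {f g : Tm 𝒩 X Y} : TmEq f g → TmEq g f
  | trans {X Y} {f g h : Tm 𝒩 X Y} : TmEq f g → TmEq g h → TmEq f h
  | comp_congr {X Y Z} {f f' : Tm 𝒩 X Y} {g g' : Tm 𝒩 Y Z} :
      TmEq f f' → TmEq g g' → TmEq (f.comp g) (f'.comp g')
  | tensor_congr {X Y X' Y'} {f f' : Tm 𝒩 X Y} {g g' : Tm 𝒩 X' Y'} :
      TmEq f f' → TmEq g g' → TmEq (f.tensor g) (f'.tensor g')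
  | curry_congr {A Y X} {f f' : Tm 𝒩 (.tensor A Y) X} : TmEq f f' → TmEq f.curry f'.curry
  -- category
  | id_comp {X Y} (f : Tm 𝒩 X Y) : TmEq ((Tm.id X).comp f) f
  | comp_id {X Y} (f : Tm 𝒩 X Y) : TmEq (f.comp (Tm.id Y)) f
  | comp_assoc {W X Y Z} (f : Tm 𝒩 W X) (g : Tm 𝒩 X Y) (h : Tm 𝒩 Y Z) :
      TmEq ((f.comp g).comp h) (f.comp (g.comp h))
  -- monoidal category
  | tensor_id (X Y) : TmEq ((Tm.id X).tensor (Tm.id Y)) (Tm.id (.tensor X Y))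
  | tensor_comp {X Y Z X' Y' Z'} (f : Tm 𝒩 X Y) (g : Tm 𝒩 Y Z) (f' : Tm 𝒩 X' Y')
      (g' : Tm 𝒩 Y' Z') :
      TmEq ((f.tensor f').comp (g.tensor g')) ((f.comp g).tensor (f'.comp g'))
  | assoc_hom_inv (X Y Z) : TmEq ((Tm.assocHom X Y Z).comp (Tm.assocInv X Y Z)) (Tm.id _)
  | assoc_inv_hom (X Y Z) : TmEq ((Tm.assocInv X Y Z).comp (Tm.assocHom X Y Z)) (Tm.id _)
  | lunit_hom_inv (X) : TmEq ((Tm.lunitHom X).comp (Tm.lunitInv X)) (Tm.id _)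
  | lunit_inv_hom (X) : TmEq ((Tm.lunitInv X).comp (Tm.lunitHom X)) (Tm.id _)
  | runit_hom_inv (X) : TmEq ((Tm.runitHom X).comp (Tm.runitInv X)) (Tm.id _)
  | runit_inv_hom (X) : TmEq ((Tm.runitInv X).comp (Tm.runitHom X)) (Tm.id _)
  | assoc_nat {X X' Y Y' Z Z'} (f : Tm 𝒩 X X') (g : Tm 𝒩 Y Y') (h : Tm 𝒩 Z Z') :
      TmEq (((f.tensor g).tensor h).comp (Tm.assocHom X' Y' Z'))
        ((Tm.assocHom X Y Z).comp (f.tensor (g.tensor h)))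
  | lunit_nat {X Y} (f : Tm 𝒩 X Y) :
      TmEq (((Tm.id .unit).tensor f).comp (Tm.lunitHom Y)) ((Tm.lunitHom X).comp f)
  | runit_nat {X Y} (f : Tm 𝒩 X Y) :
      TmEq ((f.tensor (Tm.id .unit)).comp (Tm.runitHom Y)) ((Tm.runitHom X).comp f)
  | pentagon (W X Y Z) :
      TmEq (((Tm.assocHom W X Y).tensor (Tm.id Z)).comp
          ((Tm.assocHom W (.tensor X Y) Z).comp ((Tm.id W).tensor (Tm.assocHom X Y Z))))
        ((Tm.assocHom (.tensor W X) Y Z).comp (Tm.assocHom W X (.tensor Y Z)))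
  | triangle (X Y) :
      TmEq ((Tm.assocHom X .unit Y).comp ((Tm.id X).tensor (Tm.lunitHom Y)))
        ((Tm.runitHom X).tensor (Tm.id Y))
  -- symmetry
  | braid_braid (X Y) : TmEq ((Tm.braid X Y).comp (Tm.braid Y X)) (Tm.id _)
  | braid_nat {X Y X' Y'} (f : Tm 𝒩 X Y) (f' : Tm 𝒩 X' Y') :
      TmEq ((f.tensor f').comp (Tm.braid Y Y')) ((Tm.braid X X').comp (f'.tensor f))
  | hexagon (X Y Z) :
      TmEq ((Tm.assocHom X Y Z).comp ((Tm.braid X (.tensor Y Z)).comp (Tm.assocHom Y Z X)))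
        (((Tm.braid X Y).tensor (Tm.id Z)).comp
          ((Tm.assocHom Y X Z).comp ((Tm.id Y).tensor (Tm.braid X Z))))
  -- closed structure
  | curry_beta {A Y X} (f : Tm 𝒩 (.tensor A Y) X) :
      TmEq (((Tm.id A).tensor f.curry).comp (Tm.ev A X)) f
  | curry_eta {A Y X} (g : Tm 𝒩 Y (.hom A X)) :
      TmEq (((Tm.id A).tensor g).comp (Tm.ev A X)).curry g
  -- `(P, |, 0)` is a commutative monoid
  | bar_zero : TmEq (((Tm.id .P).tensor .zero).comp .bar) (Tm.runitHom .P)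
  | zero_bar : TmEq ((Tm.tensor .zero (Tm.id .P)).comp .bar) (Tm.lunitHom .P)
  | bar_assoc : TmEq ((Tm.bar.tensor (Tm.id .P)).comp .bar)
      ((Tm.assocHom .P .P .P).comp (((Tm.id .P).tensor .bar).comp .bar))
  | bar_comm : TmEq ((Tm.braid .P .P).comp .bar) .bar
  -- `(N, Δ, δ)` is a cocommutative comonoid
  | dup_del : TmEq (Tm.dup.comp ((Tm.id .N).tensor .del)) (Tm.runitInv .N)
  | del_dup : TmEq (Tm.dup.comp (Tm.del.tensor (Tm.id .N))) (Tm.lunitInv .N)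
  | dup_assoc : TmEq (Tm.dup.comp ((Tm.dup.tensor (Tm.id .N)).comp (Tm.assocHom .N .N .N)))
      (Tm.dup.comp ((Tm.id .N).tensor .dup))
  | dup_comm : TmEq (Tm.dup.comp (Tm.braid .N .N)) .dup

/-- Formal 1-morphisms up to `TmEq`. -/
def tmSetoid {𝒩 : Type u} (X Y : Ob 𝒩) : Setoid (Tm 𝒩 X Y) where
  r := TmEq
  iseqv := ⟨TmEq.refl, TmEq.symm, TmEq.trans⟩

variable {𝒩 : Type u}

instance : Category.{u} (Ob 𝒩) where
  Hom X Y := Quotient (tmSetoid X Y)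
  id X := Quotient.mk _ (Tm.id X)
  comp := Quotient.map₂ Tm.comp (fun _ _ h _ _ h' => TmEq.comp_congr h h')
  id_comp := by rintro X Y ⟨f⟩; exact Quotient.sound (TmEq.id_comp f)
  comp_id := by rintro X Y ⟨f⟩; exact Quotient.sound (TmEq.comp_id f)
  assoc := by rintro W X Y Z ⟨f⟩ ⟨g⟩ ⟨h⟩; exact Quotient.sound (TmEq.comp_assoc f g h)

/-- The 1-morphism denoted by a formal 1-morphism. -/
def mk {X Y : Ob 𝒩} (f : Tm 𝒩 X Y) : X ⟶ Y := Quotient.mk (tmSetoid X Y) f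

theorem mk_eq {X Y : Ob 𝒩} {f g : Tm 𝒩 X Y} (h : TmEq f g) : mk f = mk g :=
  Quotient.sound (s := tmSetoid X Y) h

theorem mk_surj {X Y : Ob 𝒩} (f : X ⟶ Y) : ∃ t, mk t = f :=
  Quotient.exists_rep (s := tmSetoid X Y) f

/-- The tensor product of 1-morphisms. -/
def tensorMap {X Y X' Y' : Ob 𝒩} : (X ⟶ Y) → (X' ⟶ Y') → (X.tensor X' ⟶ Y.tensor Y') :=
  Quotient.map₂ Tm.tensor (fun _ _ h _ _ h' => TmEq.tensor_congr h h')

instance : MonoidalCategoryStruct (Ob 𝒩) where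
  tensorObj := Ob.tensor
  tensorUnit := Ob.unit
  tensorHom f g := tensorMap f g
  whiskerLeft X _ _ f := tensorMap (𝟙 X) f
  whiskerRight f Y := tensorMap f (𝟙 Y)
  associator X Y Z := ⟨mk (.assocHom X Y Z), mk (.assocInv X Y Z),
    mk_eq (.assoc_hom_inv X Y Z), mk_eq (.assoc_inv_hom X Y Z)⟩
  leftUnitor X := ⟨mk (.lunitHom X), mk (.lunitInv X),
    mk_eq (.lunit_hom_inv X), mk_eq (.lunit_inv_hom X)⟩
  rightUnitor X := ⟨mk (.runitHom X), mk (.runitInv X),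
    mk_eq (.runit_hom_inv X), mk_eq (.runit_inv_hom X)⟩

instance : MonoidalCategory (Ob 𝒩) :=
  MonoidalCategory.ofTensorHom
    (id_tensorHom_id := fun X Y => mk_eq (.tensor_id X Y))
    (id_tensorHom := fun _ _ _ _ => rfl)
    (tensorHom_id := fun _ _ => rfl)
    (tensorHom_comp_tensorHom := by
      rintro _ _ _ _ _ _ ⟨f⟩ ⟨f'⟩ ⟨g⟩ ⟨g'⟩; exact mk_eq (.tensor_comp f g f' g'))
    (associator_naturality := by
      rintro _ _ _ _ _ _ ⟨f⟩ ⟨g⟩ ⟨h⟩; exact mk_eq (.assoc_nat f g h))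
    (leftUnitor_naturality := by rintro _ _ ⟨f⟩; exact mk_eq (.lunit_nat f))
    (rightUnitor_naturality := by rintro _ _ ⟨f⟩; exact mk_eq (.runit_nat f))
    (pentagon := fun W X Y Z => mk_eq (.pentagon W X Y Z))
    (triangle := fun X Y => mk_eq (.triangle X Y))

/-- The symmetry isomorphism. -/
def symIso (X Y : Ob 𝒩) : X ⊗ Y ≅ Y ⊗ X :=
  ⟨mk (.braid X Y), mk (.braid Y X), mk_eq (.braid_braid X Y), mk_eq (.braid_braid Y X)⟩

theorem symIso_hexagon (X Y Z : Ob 𝒩) :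
    (α_ X Y Z).hom ≫ (symIso X (Y ⊗ Z)).hom ≫ (α_ Y Z X).hom =
      ((symIso X Y).hom ▷ Z) ≫ (α_ Y X Z).hom ≫ (Y ◁ (symIso X Z).hom) :=
  mk_eq (.hexagon X Y Z)

instance : SymmetricCategory (Ob 𝒩) where
  braiding := symIso
  braiding_naturality_right := by
    rintro X _ _ ⟨f⟩; exact mk_eq (.braid_nat (.id X) f)
  braiding_naturality_left := by
    rintro _ _ ⟨f⟩ Z; exact mk_eq (.braid_nat f (.id Z))
  hexagon_forward := symIso_hexagon
  hexagon_reverse := by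
    intro X Y Z
    have h : α_ Z X Y ≪≫ symIso Z (X ⊗ Y) ≪≫ α_ X Y Z =
        whiskerRightIso (symIso Z X) Y ≪≫ α_ X Z Y ≪≫ whiskerLeftIso X (symIso Z Y) :=
      Iso.ext (symIso_hexagon Z X Y)
    have h' := congrArg Iso.inv h
    simp only [Iso.trans_inv, Category.assoc, whiskerRightIso_inv, whiskerLeftIso_inv] at h'
    exact h'
  symmetry := fun X Y => mk_eq (.braid_braid X Y)

/-- Currying. -/
def curry {A Y X : Ob 𝒩} : (A ⊗ Y ⟶ X) → (Y ⟶ Ob.hom A X) :=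
  Quotient.map Tm.curry (fun _ _ h => TmEq.curry_congr h)

/-- Evaluation. -/
def ev (A X : Ob 𝒩) : A ⊗ Ob.hom A X ⟶ X := mk (.ev A X)

theorem curry_beta {A Y X : Ob 𝒩} (f : A ⊗ Y ⟶ X) : (𝟙 A ⊗ₘ curry f) ≫ ev A X = f := by
  obtain ⟨f⟩ := f; exact mk_eq (.curry_beta f)

theorem curry_eta {A Y X : Ob 𝒩} (g : Y ⟶ Ob.hom A X) : curry ((𝟙 A ⊗ₘ g) ≫ ev A X) = g := by
  obtain ⟨g⟩ := g; exact mk_eq (.curry_eta g)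

instance : MonoidalClosed (Ob 𝒩) where
  closed A :=
    { rightAdj :=
        { obj := fun X => Ob.hom A X
          map := fun {X _} f => curry (ev A X ≫ f)
          map_id := fun X => by
            have h := curry_eta (𝟙 (Ob.hom A X))
            rw [id_tensorHom_id] at h
            simpa using h
          map_comp := fun {X Y Z} f g => by
            rw [← curry_eta (curry (ev A X ≫ f) ≫ curry (ev A Y ≫ g))]
            congr 1
            have h : (𝟙 A ⊗ₘ curry (ev A X ≫ f) ≫ curry (ev A Y ≫ g)) =
                (𝟙 A ⊗ₘ curry (ev A X ≫ f)) ≫ (𝟙 A ⊗ₘ curry (ev A Y ≫ g)) := by simp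
            rw [h, Category.assoc, curry_beta, ← Category.assoc, ← Category.assoc, curry_beta] }
      adj := Adjunction.mkOfHomEquiv
        { homEquiv := fun Y X =>
            { toFun := curry
              invFun := fun g => (𝟙 A ⊗ₘ g) ≫ ev A X
              left_inv := curry_beta
              right_inv := curry_eta }
          homEquiv_naturality_left_symm := fun f g => by simp
          homEquiv_naturality_right := fun {Y X X'} f g => by
            change curry (f ≫ g) = curry f ≫ curry (ev A X ≫ g)
            rw [← curry_eta (curry f ≫ curry (ev A X ≫ g))]
            congr 1
            have h : (𝟙 A ⊗ₘ curry f ≫ curry (ev A X ≫ g)) =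
                (𝟙 A ⊗ₘ curry f) ≫ (𝟙 A ⊗ₘ curry (ev A X ≫ g)) := by simp
            rw [h, Category.assoc, curry_beta, ← Category.assoc, curry_beta] } }

/-! ### 1-morphisms -/

variable (𝒩) in
/-- The object `N^{⊗ n}`. -/
abbrev pow (n : ℕ) : Ob 𝒩 := Ob.pow 𝒩 n

/-- `Δ : N ⟶ N ⊗ N`. -/
def dup : (Ob.N : Ob 𝒩) ⟶ Ob.N ⊗ Ob.N := mk .dup

/-- `δ : N ⟶ I`. -/
def del : (Ob.N : Ob 𝒩) ⟶ 𝟙_ (Ob 𝒩) := mk .del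

/-- `| : P ⊗ P ⟶ P`. -/
def bar : (Ob.P : Ob 𝒩) ⊗ Ob.P ⟶ Ob.P := mk .bar

/-- `0 : I ⟶ P`. -/
def zero : 𝟙_ (Ob 𝒩) ⟶ Ob.P := mk .zero

/-- `?ₙ : N ⊗ (N^{⊗ n} ⊸ P) ⟶ P`. -/
def recv (n : ℕ) : (Ob.N : Ob 𝒩) ⊗ Ob.hom (pow 𝒩 n) Ob.P ⟶ Ob.P := mk (.recv n)

/-- `!ₙ : N ⊗ N^{⊗ n} ⟶ P`. -/
def send (n : ℕ) : (Ob.N : Ob 𝒩) ⊗ pow 𝒩 n ⟶ Ob.P := mk (.send n)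

/-- `fresh : I ⟶ N`. -/
def fresh : 𝟙_ (Ob 𝒩) ⟶ Ob.N := mk .fresh

/-- `COMM : I ⟶ P`. -/
def COMM : 𝟙_ (Ob 𝒩) ⟶ Ob.P := mk .COMM

/-- `⟦x⟧ : I ⟶ N`. -/
def name (x : 𝒩) : 𝟙_ (Ob 𝒩) ⟶ Ob.N := mk (.name x)

/-- `f ↦ f | COMM`. -/
def withComm {X : Ob 𝒩} (f : X ⟶ Ob.P) : X ⟶ Ob.P :=
  f ≫ (ρ_ Ob.P).inv ≫ (𝟙 Ob.P ⊗ₘ COMM) ≫ bar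

/-- The source of `commₙ`: the name is duplicated, one copy feeds `!ₙ` and the other `?ₙ`, and the
results are put in parallel with each other and with `COMM`. -/
def commSrc (n : ℕ) : (Ob.N : Ob 𝒩) ⊗ (pow 𝒩 n ⊗ Ob.hom (pow 𝒩 n) Ob.P) ⟶ Ob.P :=
  withComm ((dup ⊗ₘ 𝟙 _) ≫ tensorμ Ob.N Ob.N (pow 𝒩 n) (Ob.hom (pow 𝒩 n) Ob.P) ≫
    (send n ⊗ₘ recv n) ≫ bar)

/-- The target of `commₙ`: the name is deleted, the continuation is evaluated at the transmitted
names, and the result is put in parallel with `COMM`. -/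
def commTgt (n : ℕ) : (Ob.N : Ob 𝒩) ⊗ (pow 𝒩 n ⊗ Ob.hom (pow 𝒩 n) Ob.P) ⟶ Ob.P :=
  withComm ((del ⊗ₘ ev (pow 𝒩 n) Ob.P) ≫ (λ_ Ob.P).hom)

/-! ### 2-morphisms -/

/-- Formal 2-morphisms: generated by `commₙ` and identities under vertical composition, horizontal
composition, tensor and currying. As 1-morphisms are subject to equations, identities are indexed
by an equality between source and target. -/
inductive Cell {𝒩 : Type u} : {X Y : Ob 𝒩} → (X ⟶ Y) → (X ⟶ Y) → Type u
  | ofEq {X Y : Ob 𝒩} {f g : X ⟶ Y} (h : f = g) : Cell f g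
  | comm (n : ℕ) : Cell (commSrc n) (commTgt n)
  | vert {X Y : Ob 𝒩} {f g h : X ⟶ Y} : Cell f g → Cell g h → Cell f h
  | horiz {X Y Z : Ob 𝒩} {f g : X ⟶ Y} {h k : Y ⟶ Z} :
      Cell f g → Cell h k → Cell (f ≫ h) (g ≫ k)
  | tensor {X Y X' Y' : Ob 𝒩} {f g : X ⟶ Y} {f' g' : X' ⟶ Y'} :
      Cell f g → Cell f' g' → Cell (f ⊗ₘ f') (g ⊗ₘ g')
  | curry {A Y X : Ob 𝒩} {f g : A ⊗ Y ⟶ X} : Cell f g → Cell (curry f) (curry g)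

/-- The identity 2-morphism. -/
abbrev Cell.id {X Y : Ob 𝒩} (f : X ⟶ Y) : Cell f f := .ofEq rfl

/-- Equality of 2-morphisms: the congruence generated by the axioms of 2-categories, by
2-functoriality of `⊗`, 2-naturality of the structural isomorphisms, and 2-functoriality and
2-naturality of currying. Where the two sides have equal but not syntactically identical
sources and targets, both are composed with identities. -/
inductive CellEq {𝒩 : Type u} :
    {X Y : Ob 𝒩} → {f g : X ⟶ Y} → Cell f g → Cell f g → Prop
  -- congruence
  | refl {X Y : Ob 𝒩} {f g : X ⟶ Y} (a : Cell f g) : CellEq a a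
  | symm {X Y : Ob 𝒩} {f g : X ⟶ Y} {a b : Cell f g} : CellEq a b → CellEq b a
  | trans {X Y : Ob 𝒩} {f g : X ⟶ Y} {a b c : Cell f g} :
      CellEq a b → CellEq b c → CellEq a c
  | vert_congr {X Y : Ob 𝒩} {f g h : X ⟶ Y} {a a' : Cell f g} {b b' : Cell g h} :
      CellEq a a' → CellEq b b' → CellEq (a.vert b) (a'.vert b')
  | horiz_congr {X Y Z : Ob 𝒩} {f g : X ⟶ Y} {h k : Y ⟶ Z} {a a' : Cell f g}
      {b b' : Cell h k} : CellEq a a' → CellEq b b' → CellEq (a.horiz b) (a'.horiz b')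
  | tensor_congr {X Y X' Y' : Ob 𝒩} {f g : X ⟶ Y} {f' g' : X' ⟶ Y'} {a a' : Cell f g}
      {b b' : Cell f' g'} : CellEq a a' → CellEq b b' → CellEq (a.tensor b) (a'.tensor b')
  | curry_congr {A Y X : Ob 𝒩} {f g : A ⊗ Y ⟶ X} {a a' : Cell f g} :
      CellEq a a' → CellEq a.curry a'.curry
  -- vertical composition
  | id_vert {X Y : Ob 𝒩} {f g : X ⟶ Y} (a : Cell f g) : CellEq ((Cell.id f).vert a) a
  | vert_id {X Y : Ob 𝒩} {f g : X ⟶ Y} (a : Cell f g) : CellEq (a.vert (Cell.id g)) a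
  | vert_assoc {X Y : Ob 𝒩} {f g h k : X ⟶ Y} (a : Cell f g) (b : Cell g h) (c : Cell h k) :
      CellEq ((a.vert b).vert c) (a.vert (b.vert c))
  -- horizontal composition
  | horiz_id_id {X Y Z : Ob 𝒩} (f : X ⟶ Y) (g : Y ⟶ Z) :
      CellEq ((Cell.id f).horiz (Cell.id g)) (Cell.id (f ≫ g))
  | interchange {X Y Z : Ob 𝒩} {f g h : X ⟶ Y} {f' g' h' : Y ⟶ Z} (a : Cell f g)
      (b : Cell g h) (a' : Cell f' g') (b' : Cell g' h') :
      CellEq ((a.vert b).horiz (a'.vert b')) ((a.horiz a').vert (b.horiz b'))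
  | id_horiz {X Y : Ob 𝒩} {f g : X ⟶ Y} (a : Cell f g) :
      CellEq (((Cell.id (𝟙 X)).horiz a).vert (.ofEq (Category.id_comp g)))
        (Cell.vert (.ofEq (Category.id_comp f)) a)
  | horiz_id {X Y : Ob 𝒩} {f g : X ⟶ Y} (a : Cell f g) :
      CellEq ((a.horiz (Cell.id (𝟙 Y))).vert (.ofEq (Category.comp_id g)))
        (Cell.vert (.ofEq (Category.comp_id f)) a)
  | horiz_assoc {W X Y Z : Ob 𝒩} {f f' : W ⟶ X} {g g' : X ⟶ Y} {h h' : Y ⟶ Z}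
      (a : Cell f f') (b : Cell g g') (c : Cell h h') :
      CellEq (((a.horiz b).horiz c).vert (.ofEq (Category.assoc f' g' h')))
        (Cell.vert (.ofEq (Category.assoc f g h)) (a.horiz (b.horiz c)))
  -- tensor
  | tensor_id_id {X Y X' Y' : Ob 𝒩} (f : X ⟶ Y) (f' : X' ⟶ Y') :
      CellEq ((Cell.id f).tensor (Cell.id f')) (Cell.id (f ⊗ₘ f'))
  | tensor_vert {X Y X' Y' : Ob 𝒩} {f g h : X ⟶ Y} {f' g' h' : X' ⟶ Y'} (a : Cell f g)
      (b : Cell g h) (a' : Cell f' g') (b' : Cell g' h') :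
      CellEq ((a.vert b).tensor (a'.vert b')) ((a.tensor a').vert (b.tensor b'))
  | tensor_horiz {X Y Z X' Y' Z' : Ob 𝒩} {f g : X ⟶ Y} {h k : Y ⟶ Z} {f' g' : X' ⟶ Y'}
      {h' k' : Y' ⟶ Z'} (a : Cell f g) (b : Cell h k) (a' : Cell f' g') (b' : Cell h' k') :
      CellEq (((a.tensor a').horiz (b.tensor b')).vert
          (.ofEq (tensorHom_comp_tensorHom g g' k k')))
        (Cell.vert (.ofEq (tensorHom_comp_tensorHom f f' h h'))
          ((a.horiz b).tensor (a'.horiz b')))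
  | assoc_nat {X X' Y Y' Z Z' : Ob 𝒩} {f f' : X ⟶ X'} {g g' : Y ⟶ Y'} {h h' : Z ⟶ Z'}
      (a : Cell f f') (b : Cell g g') (c : Cell h h') :
      CellEq ((((a.tensor b).tensor c).horiz (Cell.id (α_ X' Y' Z').hom)).vert
          (.ofEq (associator_naturality f' g' h')))
        (Cell.vert (.ofEq (associator_naturality f g h))
          ((Cell.id (α_ X Y Z).hom).horiz (a.tensor (b.tensor c))))
  | lunit_nat {X Y : Ob 𝒩} {f g : X ⟶ Y} (a : Cell f g) :
      CellEq ((((Cell.id (𝟙 (𝟙_ (Ob 𝒩)))).tensor a).horiz (Cell.id (λ_ Y).hom)).vert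
          (.ofEq (leftUnitor_naturality g)))
        (Cell.vert (.ofEq (leftUnitor_naturality f)) ((Cell.id (λ_ X).hom).horiz a))
  | runit_nat {X Y : Ob 𝒩} {f g : X ⟶ Y} (a : Cell f g) :
      CellEq (((a.tensor (Cell.id (𝟙 (𝟙_ (Ob 𝒩))))).horiz (Cell.id (ρ_ Y).hom)).vert
          (.ofEq (rightUnitor_naturality g)))
        (Cell.vert (.ofEq (rightUnitor_naturality f)) ((Cell.id (ρ_ X).hom).horiz a))
  | braid_nat {X Y X' Y' : Ob 𝒩} {f g : X ⟶ Y} {f' g' : X' ⟶ Y'} (a : Cell f g)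
      (a' : Cell f' g') :
      CellEq (((a.tensor a').horiz (Cell.id (β_ Y Y').hom)).vert
          (.ofEq (BraidedCategory.braiding_naturality g g')))
        (Cell.vert (.ofEq (BraidedCategory.braiding_naturality f f'))
          ((Cell.id (β_ X X').hom).horiz (a'.tensor a)))
  -- currying
  | curry_id {A Y X : Ob 𝒩} (f : A ⊗ Y ⟶ X) :
      CellEq (Cell.id f).curry (Cell.id (PiTheory.curry f))
  | curry_vert {A Y X : Ob 𝒩} {f g h : A ⊗ Y ⟶ X} (a : Cell f g) (b : Cell g h) :
      CellEq (a.vert b).curry (a.curry.vert b.curry)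
  | curry_beta {A Y X : Ob 𝒩} {f g : A ⊗ Y ⟶ X} (a : Cell f g) :
      CellEq ((((Cell.id (𝟙 A)).tensor a.curry).horiz (Cell.id (ev A X))).vert
          (.ofEq (PiTheory.curry_beta g)))
        (Cell.vert (.ofEq (PiTheory.curry_beta f)) a)
  | curry_eta {A Y X : Ob 𝒩} {f g : Y ⟶ Ob.hom A X} (a : Cell f g) :
      CellEq ((((Cell.id (𝟙 A)).tensor a).horiz (Cell.id (ev A X))).curry.vert
          (.ofEq (PiTheory.curry_eta g)))
        (Cell.vert (.ofEq (PiTheory.curry_eta f)) a)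

/-- Formal 2-morphisms up to `CellEq`. -/
def cellSetoid {X Y : Ob 𝒩} (f g : X ⟶ Y) : Setoid (Cell f g) where
  r := CellEq
  iseqv := ⟨CellEq.refl, CellEq.symm, CellEq.trans⟩

/-- The hom-categories: objects are 1-morphisms, morphisms are 2-morphisms. -/
instance homCat (X Y : Ob 𝒩) : Category.{u} (X ⟶ Y) where
  Hom f g := Quotient (cellSetoid f g)
  id f := Quotient.mk _ (Cell.id f)
  comp := Quotient.map₂ Cell.vert (fun _ _ h _ _ h' => CellEq.vert_congr h h')
  id_comp := by rintro f g ⟨a⟩; exact Quotient.sound (CellEq.id_vert a)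
  comp_id := by rintro f g ⟨a⟩; exact Quotient.sound (CellEq.vert_id a)
  assoc := by rintro f g h k ⟨a⟩ ⟨b⟩ ⟨c⟩; exact Quotient.sound (CellEq.vert_assoc a b c)

/-- The 2-morphism denoted by a formal 2-morphism. -/
def mkCell {X Y : Ob 𝒩} {f g : X ⟶ Y} (a : Cell f g) : f ⟶ g :=
  Quotient.mk (cellSetoid f g) a

theorem mkCell_eq {X Y : Ob 𝒩} {f g : X ⟶ Y} {a b : Cell f g} (h : CellEq a b) :
    mkCell a = mkCell b :=
  Quotient.sound (s := cellSetoid f g) h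

theorem mkCell_ofEq {X Y : Ob 𝒩} {f g : X ⟶ Y} (h : f = g) :
    mkCell (.ofEq h) = eqToHom h := by
  subst h; rfl

/-- Horizontal composition of 2-morphisms. -/
def hcomp {X Y Z : Ob 𝒩} {f g : X ⟶ Y} {h k : Y ⟶ Z} :
    (f ⟶ g) → (h ⟶ k) → (f ≫ h ⟶ g ≫ k) :=
  Quotient.map₂ Cell.horiz (fun _ _ h _ _ h' => CellEq.horiz_congr h h')

/-- Tensor product of 2-morphisms. -/
def tensorCell {X Y X' Y' : Ob 𝒩} {f g : X ⟶ Y} {f' g' : X' ⟶ Y'} :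
    (f ⟶ g) → (f' ⟶ g') → (f ⊗ₘ f' ⟶ g ⊗ₘ g') :=
  Quotient.map₂ Cell.tensor (fun _ _ h _ _ h' => CellEq.tensor_congr h h')

/-- The 2-morphism `commₙ`. -/
def comm (n : ℕ) : (commSrc n : (Ob.N : Ob 𝒩) ⊗ _ ⟶ _) ⟶ commTgt n := mkCell (.comm n)

theorem hcomp_id_id {X Y Z : Ob 𝒩} (f : X ⟶ Y) (g : Y ⟶ Z) : hcomp (𝟙 f) (𝟙 g) = 𝟙 (f ≫ g) :=
  mkCell_eq (.horiz_id_id f g)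

theorem hcomp_interchange {X Y Z : Ob 𝒩} {f g h : X ⟶ Y} {f' g' h' : Y ⟶ Z} (a : f ⟶ g)
    (b : g ⟶ h) (a' : f' ⟶ g') (b' : g' ⟶ h') :
    hcomp (a ≫ b) (a' ≫ b') = hcomp a a' ≫ hcomp b b' := by
  obtain ⟨a⟩ := a; obtain ⟨b⟩ := b; obtain ⟨a'⟩ := a'; obtain ⟨b'⟩ := b'
  exact mkCell_eq (.interchange a b a' b')

theorem id_hcomp {X Y : Ob 𝒩} {f g : X ⟶ Y} (a : f ⟶ g) :
    hcomp (𝟙 (𝟙 X)) a = eqToHom (Category.id_comp f) ≫ a ≫ eqToHom (Category.id_comp g).symm := by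
  rw [← Category.assoc, ← comp_eqToHom_iff (Category.id_comp g), ← mkCell_ofEq, ← mkCell_ofEq]
  obtain ⟨a⟩ := a
  exact mkCell_eq (.id_horiz a)

theorem hcomp_id {X Y : Ob 𝒩} {f g : X ⟶ Y} (a : f ⟶ g) :
    hcomp a (𝟙 (𝟙 Y)) = eqToHom (Category.comp_id f) ≫ a ≫ eqToHom (Category.comp_id g).symm := by
  rw [← Category.assoc, ← comp_eqToHom_iff (Category.comp_id g), ← mkCell_ofEq, ← mkCell_ofEq]
  obtain ⟨a⟩ := a
  exact mkCell_eq (.horiz_id a)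

theorem hcomp_assoc {W X Y Z : Ob 𝒩} {f f' : W ⟶ X} {g g' : X ⟶ Y} {h h' : Y ⟶ Z}
    (a : f ⟶ f') (b : g ⟶ g') (c : h ⟶ h') :
    hcomp (hcomp a b) c = eqToHom (Category.assoc f g h) ≫ hcomp a (hcomp b c) ≫
      eqToHom (Category.assoc f' g' h').symm := by
  rw [← Category.assoc, ← comp_eqToHom_iff (Category.assoc f' g' h'), ← mkCell_ofEq, ← mkCell_ofEq]
  obtain ⟨a⟩ := a; obtain ⟨b⟩ := b; obtain ⟨c⟩ := c
  exact mkCell_eq (.horiz_assoc a b c)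

/-- The 2-category structure on the objects, 1-morphisms and 2-morphisms above. (Not registered as
an instance, so that `Category (Ob 𝒩)` is found in one way only.) -/
@[reducible] def twoCategory : Bicategory (Ob 𝒩) where
  homCategory := homCat
  whiskerLeft f _ _ a := hcomp (𝟙 f) a
  whiskerRight a h := hcomp a (𝟙 h)
  associator f g h := eqToIso (Category.assoc f g h)
  leftUnitor f := eqToIso (Category.id_comp f)
  rightUnitor f := eqToIso (Category.comp_id f)
  whiskerLeft_id f g := hcomp_id_id f g
  whiskerLeft_comp f _ _ _ a b := by rw [← hcomp_interchange, Category.comp_id]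
  id_whiskerLeft a := by simpa using id_hcomp a
  comp_whiskerLeft f g _ _ a := by rw [← hcomp_id_id]; simpa using hcomp_assoc (𝟙 f) (𝟙 g) a
  id_whiskerRight f g := hcomp_id_id f g
  comp_whiskerRight a b i := by rw [← hcomp_interchange, Category.comp_id]
  whiskerRight_id a := by simpa using hcomp_id a
  whiskerRight_comp a g h := by simp [hcomp_assoc, hcomp_id_id]
  whisker_assoc f _ _ a h := by simpa using hcomp_assoc (𝟙 f) a (𝟙 h)
  whisker_exchange a b := by simp [← hcomp_interchange]
  pentagon f g h i := by
    have e1 : ∀ {X Y Z : Ob 𝒩} {f g : X ⟶ Y} (e : f = g) (h : Y ⟶ Z),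
        hcomp (eqToHom e) (𝟙 h) = eqToHom (by rw [e]) := by
      intro X Y Z f g e h; subst e; exact hcomp_id_id f h
    have e2 : ∀ {X Y Z : Ob 𝒩} {f g : Y ⟶ Z} (e : f = g) (h : X ⟶ Y),
        hcomp (𝟙 h) (eqToHom e) = eqToHom (by rw [e]) := by
      intro X Y Z f g e h; subst e; exact hcomp_id_id h f
    simp [e1, e2]
  triangle f g := by
    have e1 : ∀ {X Y Z : Ob 𝒩} {f g : X ⟶ Y} (e : f = g) (h : Y ⟶ Z),
        hcomp (eqToHom e) (𝟙 h) = eqToHom (by rw [e]) := by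
      intro X Y Z f g e h; subst e; exact hcomp_id_id f h
    have e2 : ∀ {X Y Z : Ob 𝒩} {f g : Y ⟶ Z} (e : f = g) (h : X ⟶ Y),
        hcomp (𝟙 h) (eqToHom e) = eqToHom (by rw [e]) := by
      intro X Y Z f g e h; subst e; exact hcomp_id_id h f
    simp [e1, e2]

theorem twoCategory_strict : @Bicategory.Strict (Ob 𝒩) twoCategory :=
  @Bicategory.Strict.mk (Ob 𝒩) twoCategory
    (fun f => Category.id_comp f) (fun f => Category.comp_id f)
    (fun f g h => Category.assoc f g h) (fun _ => rfl) (fun _ => rfl) (fun _ _ _ => rfl)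

/-- 2-morphisms generated by exactly one top-level occurrence of some `commₙ`, using vertical and
horizontal composition and tensoring with identity 2-morphisms only. (Occurrences under a
currying are not top-level.) -/
inductive CommOnce {𝒩 : Type u} : {X Y : Ob 𝒩} → {f g : X ⟶ Y} → (f ⟶ g) → Prop
  | comm (n : ℕ) : CommOnce (comm n)
  | vert {X Y : Ob 𝒩} {f f' g g' : X ⟶ Y} (h : f' = f) {a : f ⟶ g} (h' : g = g') :
      CommOnce a → CommOnce (eqToHom h ≫ a ≫ eqToHom h')
  | horiz_left {X Y Z : Ob 𝒩} (h : X ⟶ Y) {f g : Y ⟶ Z} {a : f ⟶ g} :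
      CommOnce a → CommOnce (hcomp (𝟙 h) a)
  | horiz_right {X Y Z : Ob 𝒩} {f g : X ⟶ Y} {a : f ⟶ g} (h : Y ⟶ Z) :
      CommOnce a → CommOnce (hcomp a (𝟙 h))
  | tensor_left {X Y X' Y' : Ob 𝒩} (h : X ⟶ Y) {f g : X' ⟶ Y'} {a : f ⟶ g} :
      CommOnce a → CommOnce (tensorCell (𝟙 h) a)
  | tensor_right {X Y X' Y' : Ob 𝒩} {f g : X ⟶ Y} {a : f ⟶ g} (h : X' ⟶ Y') :
      CommOnce a → CommOnce (tensorCell a (𝟙 h))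

/-! ## The interpretation -/

/-- `N^{⊗ k} ⟶ N^{⊗ k} ⊗ N^{⊗ k}` duplicating every component. -/
def dupPow : (k : ℕ) → (pow 𝒩 k ⟶ pow 𝒩 k ⊗ pow 𝒩 k)
  | 0 => (λ_ (𝟙_ (Ob 𝒩))).inv
  | k + 1 => (dup ⊗ₘ dupPow k) ≫ tensorμ Ob.N Ob.N (pow 𝒩 k) (pow 𝒩 k)

/-- `N^{⊗ k} ⟶ I` deleting every component. -/
def delPow : (k : ℕ) → (pow 𝒩 k ⟶ 𝟙_ (Ob 𝒩))
  | 0 => 𝟙 _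
  | k + 1 => (del ⊗ₘ delPow k) ≫ (λ_ (𝟙_ (Ob 𝒩))).hom

/-- Concatenation of tuples `N^{⊗ ys} ⊗ N^{⊗ Γ} ⟶ N^{⊗ (ys ++ Γ)}`. -/
def join : (ys Γ : List 𝒩) → (pow 𝒩 ys.length ⊗ pow 𝒩 Γ.length ⟶ pow 𝒩 (ys ++ Γ).length)
  | [], Γ => (λ_ (pow 𝒩 Γ.length)).hom
  | _ :: ys, Γ => (α_ Ob.N (pow 𝒩 ys.length) (pow 𝒩 Γ.length)).hom ≫ (𝟙 Ob.N ⊗ₘ join ys Γ)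

/-- The name `x` as a 1-morphism `N^{⊗ Γ} ⟶ N`: the projection to the first position where `x`
occurs in the list `Γ` of names in scope, or the generator `⟦x⟧` if `x` is not in scope. -/
def wire [DecidableEq 𝒩] : (Γ : List 𝒩) → 𝒩 → (pow 𝒩 Γ.length ⟶ Ob.N)
  | [], x => name x
  | y :: Γ, x =>
      if x = y then (𝟙 Ob.N ⊗ₘ delPow Γ.length) ≫ (ρ_ Ob.N).hom
      else (del ⊗ₘ wire Γ x) ≫ (λ_ Ob.N).hom

/-- A tuple of names as a 1-morphism `N^{⊗ Γ} ⟶ N^{⊗ n}`. -/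
def wires [DecidableEq 𝒩] (Γ : List 𝒩) : (zs : List 𝒩) → (pow 𝒩 Γ.length ⟶ pow 𝒩 zs.length)
  | [] => delPow Γ.length
  | z :: zs => dupPow Γ.length ≫ (wire Γ z ⊗ₘ wires Γ zs)

/-- The interpretation `N^{⊗ Γ} ⟶ P` of a process with names in scope `Γ`. -/
def interp [DecidableEq 𝒩] : PiCalc.Proc 𝒩 → (Γ : List 𝒩) → (pow 𝒩 Γ.length ⟶ Ob.P)
  | .nil, Γ => delPow Γ.length ≫ zero
  | .inp x ys _ Q, Γ =>
      dupPow Γ.length ≫ (wire Γ x ⊗ₘ curry (join ys Γ ≫ interp Q (ys ++ Γ))) ≫ recv ys.length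
  | .out x zs, Γ => dupPow Γ.length ≫ (wire Γ x ⊗ₘ wires Γ zs) ≫ send zs.length
  | .new x Q, Γ => (λ_ (pow 𝒩 Γ.length)).inv ≫ (fresh ⊗ₘ 𝟙 (pow 𝒩 Γ.length)) ≫ interp Q (x :: Γ)
  | .par Q R, Γ => dupPow Γ.length ≫ (interp Q Γ ⊗ₘ interp R Γ) ≫ bar

/-- The tuple `I ⟶ N^{⊗ Γ}` of the generators `⟦x⟧` for `x` in `Γ`. -/
def names : (Γ : List 𝒩) → (𝟙_ (Ob 𝒩) ⟶ pow 𝒩 Γ.length)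
  | [] => 𝟙 _
  | x :: Γ => (λ_ (𝟙_ (Ob 𝒩))).inv ≫ (name x ⊗ₘ names Γ)

/-- `⟦P⟧ : I ⟶ P`: the free names of the process are supplied, each once, by the generators `⟦x⟧`
and are distributed by `Δ` and `δ`. -/
noncomputable def den [DecidableEq 𝒩] (p : PiCalc.Proc 𝒩) : 𝟙_ (Ob 𝒩) ⟶ Ob.P :=
  names p.fn.toList ≫ interp p p.fn.toList

/-- Tensoring a 1-morphism `I ⟶ X` with a scalar, that is, an endomorphism of `I`. -/
def scale {X : Ob 𝒩} (s : 𝟙_ (Ob 𝒩) ⟶ 𝟙_ (Ob 𝒩)) (f : 𝟙_ (Ob 𝒩) ⟶ X) : 𝟙_ (Ob 𝒩) ⟶ X :=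
  (λ_ (𝟙_ (Ob 𝒩))).inv ≫ (s ⊗ₘ f) ≫ (λ_ X).hom

/-- The semantic reduction `f ⇒^comm g`: up to tensoring with scalars, there is a 2-morphism
`f | COMM ⟶ g | COMM` generated by exactly one top-level occurrence of some `commₙ`. -/
def CommRed (f g : 𝟙_ (Ob 𝒩) ⟶ Ob.P) : Prop :=
  ∃ (s t : 𝟙_ (Ob 𝒩) ⟶ 𝟙_ (Ob 𝒩)) (a : scale s (withComm f) ⟶ scale t (withComm g)), CommOnce a

/-- The semantic observation relation `⟦P⟧ ⇓ ⟦x⟧`, a relation between 1-morphisms. -/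
inductive Obs [DecidableEq 𝒩] : (𝟙_ (Ob 𝒩) ⟶ Ob.P) → (𝟙_ (Ob 𝒩) ⟶ Ob.N) → Prop
  | out (x : 𝒩) (ys : List 𝒩) : Obs (den (.out x ys)) (name x)
  | par_left (p q : PiCalc.Proc 𝒩) (x : 𝒩) :
      Obs (den p) (name x) → Obs (den (.par p q)) (name x)
  | par_right (p q : PiCalc.Proc 𝒩) (x : 𝒩) :
      Obs (den q) (name x) → Obs (den (.par p q)) (name x)
  | new (u : 𝒩) (p : PiCalc.Proc 𝒩) (x : 𝒩) :
      Obs (den p) (name x) → x ≠ u → Obs (den (.new u p)) (name x)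

/-- Semantic bisimulations: relations between 1-morphisms `I ⟶ P`. -/
def IsSemBisimulation [DecidableEq 𝒩] (S : (𝟙_ (Ob 𝒩) ⟶ Ob.P) → (𝟙_ (Ob 𝒩) ⟶ Ob.P) → Prop) :
    Prop :=
  (∀ f g, S f g → S g f) ∧
  ∀ p q : PiCalc.Proc 𝒩, S (den p) (den q) →
    (∀ p', CommRed (den p) (den p') → ∃ q', CommRed (den q) (den q') ∧ S (den p') (den q')) ∧
    (∀ x, Obs (den p) (name x) → Obs (den q) (name x))

/-- Semantic bisimilarity. -/
def SemBisimilar [DecidableEq 𝒩] (f g : 𝟙_ (Ob 𝒩) ⟶ Ob.P) : Prop :=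
  ∃ S, IsSemBisimulation S ∧ S f g

end PiTheory

/-!
The interpretation is compared with the calculus through a model of the 2-category, which shows that
a 2-morphism can do no more than a reduction can.

*The model.* Objects are graphs, that is, sets with a binary relation, which form a symmetric
monoidal closed category under the box product (an edge of `X ⊗ Y` moves exactly one component; an
edge of the internal hom is a pointwise edge). `N` is a set without edges, and `P` is the set `Beh`
of process trees modulo the commutative monoid laws, in which the continuation of an input is a
function of the names received, `COMM` is a leaf `tok`, and the edges are communications next to a
token. Graph homomorphisms alone would identify too much: two restrictions have to yield different
names. Every occurrence of `fresh` therefore chooses a label, and a 1-morphism denotes the set of all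
pairs of the multiset of labels chosen and the resulting homomorphism. By `tm_eq` this respects
equality of 1-morphisms, and by `rel_of_commOnce` a 2-morphism generated by one top-level `commₙ`
is interpreted by edges and preserves the labels.

*From semantics to reductions.* The behaviours of `⟦P⟧` are described directly on processes by `Sem`.
They contain no token, so an edge out of `⟦P⟧ | COMM` uses the one token at top level, and is a
communication between two parallel components (`Beh.Step.comm_of_add_tok`). If the labels are
pairwise distinct, then the two components use the same channel name; after extruding all
restrictions to the top (`Sem.exists_flat`) the communication is a reduction of `P` (`Sem.reflect`).
Scalars only add labels, which can be chosen away from those of `P`.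

*From reductions to semantics.* The tensor powers of `N` are cocommutative comonoids, and a
comonoid morphism between contexts that acts like a renaming on the free names interprets that
renaming (`interp_rename`). Projections, permutations and tuples of names are such morphisms, so the
interpretation is invariant under α-conversion, weakening and exchange, and evaluation performs
substitution. Hence structural congruence holds up to scalars (`interp_structCong`), the law
`(new x)(new x)P ≡ (new x)P` being the one that needs them, and every reduction is realized by one
`commₙ` (`commRed_of_red`).

*Bisimilarity.* The model does not recover a process up to structural congruence, but only up to the
relation `SameBeh` of having a common behaviour. By the two parts above, `SameBeh` is a barbed
bisimulation, and it also preserves semantic observations, so that `Obs` agrees with barbs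
(`PiCalc.obs_iff`). Barbed and semantic bisimulations can then be turned into each other by working
up to `SameBeh`.
-/

/-! ### Behaviours: process trees with higher-order inputs -/

namespace PiModel

/-- Tuples of length `n`. -/
abbrev Tup (M : Type u) (n : ℕ) : Type u := {l : List M // l.length = n}

/-- Infinitely branching process trees without restriction: the continuation of an input is a
function on tuples of names. The leaf `tok` stands for `COMM`. -/
inductive Tree (M : Type u) : Type u
  | nil : Tree M
  | par (s t : Tree M) : Tree M
  | send (x : M) (zs : List M) : Tree M
  | recv (n : ℕ) (x : M) (f : Tup M n → Tree M) : Tree M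
  | tok : Tree M

/-- The congruence on trees making `par`, `nil` a commutative monoid. -/
inductive Tree.Eqv {M : Type u} : Tree M → Tree M → Prop
  | refl (t) : Eqv t t
  | symm {s t} : Eqv s t → Eqv t s
  | trans {r s t} : Eqv r s → Eqv s t → Eqv r t
  | par {s s' t t'} : Eqv s s' → Eqv t t' → Eqv (.par s t) (.par s' t')
  | recv (n x) {f g} : (∀ v, Eqv (f v) (g v)) → Eqv (.recv n x f) (.recv n x g)
  | par_nil (t) : Eqv (.par t .nil) t
  | par_comm (s t) : Eqv (.par s t) (.par t s)
  | par_assoc (r s t) : Eqv (.par (.par r s) t) (.par r (.par s t))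

/-- Trees up to `Tree.Eqv`. -/
def treeSetoid (M : Type u) : Setoid (Tree M) where
  r := Tree.Eqv
  iseqv := ⟨Tree.Eqv.refl, Tree.Eqv.symm, Tree.Eqv.trans⟩

/-- Behaviours: trees up to the commutative monoid laws, applied at any depth. -/
def Beh (M : Type u) : Type u := Quotient (treeSetoid M)

namespace Beh

variable {M : Type u}

/-- The behaviour of a tree. -/
def mk (t : Tree M) : Beh M := Quotient.mk (treeSetoid M) t

theorem mk_eq {s t : Tree M} (h : s.Eqv t) : mk s = mk t := Quotient.sound (s := treeSetoid M) h

instance : Zero (Beh M) := ⟨mk .nil⟩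

instance : Add (Beh M) := ⟨Quotient.map₂ Tree.par (fun _ _ h _ _ h' => Tree.Eqv.par h h')⟩

instance : AddCommMonoid (Beh M) where
  add_assoc := by rintro ⟨r⟩ ⟨s⟩ ⟨t⟩; exact mk_eq (.par_assoc r s t)
  zero_add := by rintro ⟨t⟩; exact mk_eq (.trans (.par_comm _ _) (.par_nil t))
  add_zero := by rintro ⟨t⟩; exact mk_eq (.par_nil t)
  add_comm := by rintro ⟨s⟩ ⟨t⟩; exact mk_eq (.par_comm s t)
  nsmul := nsmulRec

/-- An output. -/
def send (x : M) (zs : List M) : Beh M := mk (.send x zs)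

/-- The token interpreting `COMM`. -/
def tok : Beh M := mk .tok

/-- An input whose continuation is a function into behaviours. -/
noncomputable def recv (n : ℕ) (x : M) (f : Tup M n → Beh M) : Beh M :=
  mk (.recv n x fun v => Quotient.out (s := treeSetoid M) (f v))

theorem mk_recv (n : ℕ) (x : M) (f : Tup M n → Tree M) :
    mk (.recv n x f) = recv n x fun v => mk (f v) :=
  mk_eq (.recv n x fun v => .symm (Quotient.mk_out (s := treeSetoid M) (f v)))

theorem mk_par (s t : Tree M) : mk (.par s t) = mk s + mk t := rfl

end Beh

/-- The parallel components of a behaviour. -/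
inductive Thread (M : Type u) : Type u
  | send (x : M) (zs : List M) : Thread M
  | recv (n : ℕ) (x : M) (f : Tup M n → Beh M) : Thread M
  | tok : Thread M

/-- The multiset of parallel components of a tree. -/
def Tree.threads {M : Type u} : Tree M → Multiset (Thread M)
  | .nil => 0
  | .par s t => s.threads + t.threads
  | .send x zs => {.send x zs}
  | .recv n x f => {.recv n x fun v => Beh.mk (f v)}
  | .tok => {.tok}

theorem Tree.Eqv.threads_eq {M : Type u} {s t : Tree M} (h : s.Eqv t) :
    s.threads = t.threads := by
  induction h with
  | refl => rfl
  | symm _ ih => exact ih.symm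
  | trans _ _ ih ih' => exact ih.trans ih'
  | par _ _ ih ih' => simp [Tree.threads, ih, ih']
  | recv n x h _ => simp [Tree.threads, fun v => Beh.mk_eq (h v)]
  | par_nil => simp [Tree.threads]
  | par_comm => simp [Tree.threads, add_comm]
  | par_assoc => simp [Tree.threads, add_assoc]

/-- The tree contains the token, possibly below inputs. -/
def Tree.HasTok {M : Type u} : Tree M → Prop
  | .nil => False
  | .par s t => s.HasTok ∨ t.HasTok
  | .send _ _ => False
  | .recv _ _ f => ∃ v, (f v).HasTok
  | .tok => True

theorem Tree.Eqv.hasTok_iff {M : Type u} {s t : Tree M} (h : s.Eqv t) :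
    s.HasTok ↔ t.HasTok := by
  induction h with
  | refl => rfl
  | symm _ ih => exact ih.symm
  | trans _ _ ih ih' => exact ih.trans ih'
  | par _ _ ih ih' => simp [Tree.HasTok, ih, ih']
  | recv n x _ ih => simp [Tree.HasTok, ih]
  | par_nil => simp [Tree.HasTok]
  | par_comm => simp [Tree.HasTok, or_comm]
  | par_assoc => simp [Tree.HasTok, or_assoc]

/-- The behaviour consisting of a single component. -/
noncomputable def Thread.beh {M : Type u} : Thread M → Beh M
  | .send x zs => Beh.send x zs
  | .recv n x f => Beh.recv n x f
  | .tok => Beh.tok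

namespace Beh

variable {M : Type u}

/-- The multiset of parallel components of a behaviour. -/
def threads : Beh M → Multiset (Thread M) :=
  Quotient.lift Tree.threads fun _ _ h => Tree.Eqv.threads_eq h

/-- The behaviour contains the token, possibly below inputs. -/
def HasTok : Beh M → Prop :=
  Quotient.lift Tree.HasTok fun _ _ h => propext (Tree.Eqv.hasTok_iff h)

@[simp] theorem threads_zero : threads (0 : Beh M) = 0 := rfl

@[simp] theorem threads_add (p q : Beh M) : threads (p + q) = threads p + threads q := by
  obtain ⟨p⟩ := p; obtain ⟨q⟩ := q; rfl

@[simp] theorem threads_send (x : M) (zs : List M) : threads (send x zs) = {.send x zs} := rfl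

@[simp] theorem threads_tok : threads (tok : Beh M) = {.tok} := rfl

@[simp] theorem threads_recv (n : ℕ) (x : M) (f : Tup M n → Beh M) :
    threads (recv n x f) = {.recv n x f} := by
  have h : ∀ v, mk (Quotient.out (s := treeSetoid M) (f v)) = f v :=
    fun v => Quotient.out_eq (s := treeSetoid M) (f v)
  change ({.recv n x fun v => mk _} : Multiset (Thread M)) = _
  simp only [h]

@[simp] theorem not_hasTok_zero : ¬ HasTok (0 : Beh M) := id

@[simp] theorem hasTok_add (p q : Beh M) : HasTok (p + q) ↔ HasTok p ∨ HasTok q := by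
  obtain ⟨p⟩ := p; obtain ⟨q⟩ := q; rfl

@[simp] theorem not_hasTok_send (x : M) (zs : List M) : ¬ HasTok (send x zs) := id

@[simp] theorem hasTok_tok : HasTok (tok : Beh M) := trivial

@[simp] theorem hasTok_recv (n : ℕ) (x : M) (f : Tup M n → Beh M) :
    HasTok (recv n x f) ↔ ∃ v, HasTok (f v) := by
  have h : ∀ v, mk (Quotient.out (s := treeSetoid M) (f v)) = f v :=
    fun v => Quotient.out_eq (s := treeSetoid M) (f v)
  change (∃ v, HasTok (mk _)) ↔ _
  simp only [h]

/-- A behaviour is the sum of its components. -/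
theorem sum_threads (p : Beh M) : ((threads p).map Thread.beh).sum = p := by
  obtain ⟨t⟩ := p
  change ((threads (mk t)).map Thread.beh).sum = mk t
  induction t with
  | nil => rfl
  | par s t ihs iht => rw [mk_par, threads_add, Multiset.map_add, Multiset.sum_add, ihs, iht]
  | send x zs => change (Multiset.map Thread.beh {.send x zs}).sum = _; simp [Thread.beh, send]
  | recv n x f => rw [mk_recv]; simp [Thread.beh]
  | tok => change (Multiset.map Thread.beh {.tok}).sum = _; simp [Thread.beh, tok]

theorem threads_injective : Function.Injective (threads : Beh M → Multiset (Thread M)) :=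
  fun p q h => by rw [← sum_threads p, h, sum_threads]

theorem add_tok_cancel {p q : Beh M} (h : p + tok = q + tok) : p = q :=
  threads_injective (by simpa using congrArg threads h)

/-- One-step reduction of behaviours. A communication consumes no token but needs one next to
it; the reduction may take place below inputs, provided it does so for all received tuples. -/
inductive Step : Beh M → Beh M → Prop
  | comm (n : ℕ) (x : M) (zs : Tup M n) (f : Tup M n → Beh M) :
      Step (send x zs + recv n x f + tok) (f zs + tok)
  | par {p p'} (q) : Step p p' → Step (p + q) (p' + q)
  | recv (n : ℕ) (x : M) {f f' : Tup M n → Beh M} :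
      (∀ v, Step (f v) (f' v)) → Step (recv n x f) (recv n x f')

/-- Communication between two parallel components of a behaviour. -/
inductive Comm : Beh M → Beh M → Prop
  | mk (n : ℕ) (x : M) (zs : Tup M n) (f : Tup M n → Beh M) (r : Beh M) :
      Comm (send x zs + recv n x f + r) (f zs + r)

theorem Step.hasTok [Nonempty M] {p q : Beh M} (h : Step p q) : HasTok p := by
  induction h with
  | comm => simp
  | par q _ ih => simp [ih]
  | recv n x _ ih =>
    obtain ⟨a⟩ := ‹Nonempty M›
    simpa using ⟨_, _, ih ⟨List.replicate n a, by simp⟩⟩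

/-- A step either uses a token among the parallel components, or takes place inside one of them. -/
theorem Step.cases {p q : Beh M} (h : Step p q) :
    (∃ p' q', p = p' + tok ∧ q = q' + tok ∧ Comm p' q') ∨
      ∃ t ∈ threads p, ∃ q', Step (Thread.beh t) q' ∧ t ≠ .tok := by
  induction h with
  | comm n x zs f =>
    refine .inl ⟨_, _, rfl, rfl, ?_⟩
    simpa using Comm.mk n x zs f 0
  | par r _ ih =>
    rcases ih with ⟨p', q', rfl, rfl, ⟨n, x, zs, f, s⟩⟩ | ⟨t, ht, q', hq, hne⟩
    · refine .inl ⟨send x zs + Beh.recv n x f + s + r, f zs + s + r,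
        add_right_comm _ _ _, add_right_comm _ _ _, ?_⟩
      rw [add_assoc _ s r, add_assoc _ s r]
      exact Comm.mk n x zs f (s + r)
    · exact .inr ⟨t, by simp [ht], q', hq, hne⟩
  | recv n x h _ =>
    exact .inr ⟨.recv n x _, by simp, _, Step.recv n x h, by simp⟩

theorem hasTok_of_mem_threads {p : Beh M} {t : Thread M} (h : t ∈ threads p)
    (ht : HasTok t.beh) : HasTok p := by
  obtain ⟨m, hm⟩ := Multiset.exists_cons_of_mem h
  rw [← sum_threads p, hm]
  simp [ht]

/-- Next to a single token, a token-free behaviour reduces by communication between its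
components only. -/
theorem Step.comm_of_add_tok [Nonempty M] {p q : Beh M} (hp : ¬ HasTok p)
    (h : Step (p + tok) (q + tok)) : Comm p q := by
  rcases h.cases with ⟨p', q', e, e', hc⟩ | ⟨t, ht, q', hq, hne⟩
  · rwa [add_tok_cancel e, add_tok_cancel e']
  · have ht : t ∈ threads p := by simpa [hne] using ht
    exact (hp (hasTok_of_mem_threads ht hq.hasTok)).elim

end Beh

end PiModel

/-! ### The closed category of graphs and the interpretation of 1-morphisms -/

namespace PiModel

open PiTheory

/-- A type with a binary relation. -/
structure Gph : Type (u + 1) where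
  V : Type u
  R : V → V → Prop

namespace Gph

/-- Relation-preserving functions. -/
@[ext]
structure Hom (X Y : Gph.{u}) : Type u where
  toFun : X.V → Y.V
  map_rel : ∀ {a b}, X.R a b → Y.R (toFun a) (toFun b)

instance (X Y : Gph.{u}) : CoeFun (Hom X Y) fun _ => X.V → Y.V := ⟨Hom.toFun⟩

/-- A set as a graph without edges. -/
def discrete (V : Type u) : Gph.{u} := ⟨V, fun _ _ => False⟩

/-- The box product of graphs: an edge moves exactly one of the two components. -/
def prod (X Y : Gph.{u}) : Gph.{u} :=
  ⟨X.V × Y.V, fun a b => (X.R a.1 b.1 ∧ a.2 = b.2) ∨ (a.1 = b.1 ∧ Y.R a.2 b.2)⟩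

/-- The internal hom for the box product: an edge is a pointwise edge. Hence an edge between
continuations is a family of reductions, one for each received tuple. -/
def ihom (X Y : Gph.{u}) : Gph.{u} := ⟨Hom X Y, fun f g => ∀ a, Y.R (f a) (g a)⟩

end Gph

/-- Names of the model: the given names, and labels for the occurrences of `fresh`. -/
abbrev Nm (𝒩 : Type u) : Type u := 𝒩 ⊕ ℕ

variable {𝒩 : Type u}

variable (𝒩) in
/-- The graph interpreting `P`. -/
def behGph : Gph.{u} := ⟨Beh (Nm 𝒩), Beh.Step⟩

/-- The interpretation of objects. -/
def obj : Ob 𝒩 → Gph.{u}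
  | .unit => .discrete PUnit
  | .N => .discrete (Nm 𝒩)
  | .P => behGph 𝒩
  | .tensor X Y => .prod (obj X) (obj Y)
  | .hom X Y => .ihom (obj X) (obj Y)

/-- The tuple of names underlying an element of the interpretation of `N^{⊗ n}`. -/
def toList : (n : ℕ) → (obj (Ob.pow 𝒩 n)).V → List (Nm 𝒩)
  | 0, _ => []
  | n + 1, v => v.1 :: toList n v.2

theorem length_toList : (n : ℕ) → (v : (obj (Ob.pow 𝒩 n)).V) → (toList n v).length = n
  | 0, _ => rfl
  | n + 1, v => congrArg (· + 1) (length_toList n v.2)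

/-- The element of the interpretation of `N^{⊗ n}` with a given underlying tuple. -/
def ofTup : (n : ℕ) → Tup (Nm 𝒩) n → (obj (Ob.pow 𝒩 n)).V
  | 0, _ => PUnit.unit
  | n + 1, ⟨a :: l, h⟩ => (a, ofTup n ⟨l, Nat.succ.inj h⟩)

theorem ofTup_toList : (n : ℕ) → (v : (obj (Ob.pow 𝒩 n)).V) →
    ofTup n ⟨toList n v, length_toList n v⟩ = v
  | 0, _ => rfl
  | n + 1, v => Prod.ext rfl (ofTup_toList n v.2)

theorem toList_ofTup : (n : ℕ) → (v : Tup (Nm 𝒩) n) → toList n (ofTup n v) = v.1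
  | 0, ⟨[], _⟩ => rfl
  | n + 1, ⟨a :: l, h⟩ => congrArg (a :: ·) (toList_ofTup n ⟨l, Nat.succ.inj h⟩)

theorem not_rel_pow (n : ℕ) (v w : (obj (Ob.pow 𝒩 n)).V) : ¬ (obj (Ob.pow 𝒩 n)).R v w := by
  induction n with
  | zero => exact id
  | succ n ih => exact fun h => h.elim (fun h => h.1) fun h => ih _ _ h.2

namespace Gph.Hom

variable {W X Y Z X' Y' : Gph.{u}}

/-- The identity. -/
def id (X : Gph.{u}) : Hom X X := ⟨fun a => a, fun h => h⟩

/-- Composition, in diagrammatic order. -/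
def comp (f : Hom X Y) (g : Hom Y Z) : Hom X Z := ⟨fun a => g (f a), fun h => g.2 (f.2 h)⟩

/-- The functorial action of the box product. -/
def tensor (f : Hom X Y) (g : Hom X' Y') : Hom (.prod X X') (.prod Y Y') :=
  ⟨fun a => (f a.1, g a.2), fun h => h.imp (fun h => ⟨f.2 h.1, congrArg g h.2⟩)
    (fun h => ⟨congrArg f h.1, g.2 h.2⟩)⟩

/-- Currying. -/
def curry (f : Hom (.prod X Y) Z) : Hom Y (.ihom X Z) :=
  ⟨fun y => ⟨fun x => f (x, y), fun h => f.2 (.inl ⟨h, rfl⟩)⟩, fun h _ => f.2 (.inr ⟨rfl, h⟩)⟩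

/-- Evaluation. -/
def ev (X Y : Gph.{u}) : Hom (.prod X (.ihom X Y)) Y := ⟨fun a => a.2.toFun a.1, by
  rintro ⟨a, f⟩ ⟨b, g⟩ (⟨h, rfl : f = g⟩ | ⟨rfl : a = b, h⟩)
  · exact f.2 h
  · exact h a⟩

/-- The associativity isomorphism. -/
def assocHom (X Y Z : Gph.{u}) : Hom (.prod (.prod X Y) Z) (.prod X (.prod Y Z)) :=
  ⟨fun a => (a.1.1, (a.1.2, a.2)), by
    rintro ⟨⟨a, b⟩, c⟩ ⟨⟨a', b'⟩, c'⟩ (⟨h | h, e⟩ | ⟨h, h'⟩)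
    · exact .inl ⟨h.1, Prod.ext h.2 e⟩
    · exact .inr ⟨h.1, .inl ⟨h.2, e⟩⟩
    · cases h; exact .inr ⟨rfl, .inr ⟨rfl, h'⟩⟩⟩

/-- The inverse of the associativity isomorphism. -/
def assocInv (X Y Z : Gph.{u}) : Hom (.prod X (.prod Y Z)) (.prod (.prod X Y) Z) :=
  ⟨fun a => ((a.1, a.2.1), a.2.2), by
    rintro ⟨a, b, c⟩ ⟨a', b', c'⟩ (⟨h, h'⟩ | ⟨e, h | h⟩)
    · cases h'; exact .inl ⟨.inl ⟨h, rfl⟩, rfl⟩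
    · exact .inl ⟨.inr ⟨e, h.1⟩, h.2⟩
    · exact .inr ⟨Prod.ext e h.1, h.2⟩⟩

/-- The symmetry. -/
def braid (X Y : Gph.{u}) : Hom (.prod X Y) (.prod Y X) :=
  ⟨fun a => (a.2, a.1), fun h => h.symm.imp And.symm And.symm⟩

/-- The left unit isomorphism. -/
def lunitHom (X : Gph.{u}) : Hom (.prod (.discrete PUnit) X) X :=
  ⟨fun a => a.2, fun h => h.elim (fun h => h.1.elim) (fun h => h.2)⟩

/-- The inverse of the left unit isomorphism. -/
def lunitInv (X : Gph.{u}) : Hom X (.prod (.discrete PUnit) X) :=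
  ⟨fun a => (PUnit.unit, a), fun h => .inr ⟨rfl, h⟩⟩

/-- The right unit isomorphism. -/
def runitHom (X : Gph.{u}) : Hom (.prod X (.discrete PUnit)) X :=
  ⟨fun a => a.1, fun h => h.elim (fun h => h.1) (fun h => h.2.elim)⟩

/-- The inverse of the right unit isomorphism. -/
def runitInv (X : Gph.{u}) : Hom X (.prod X (.discrete PUnit)) :=
  ⟨fun a => (a, PUnit.unit), fun h => .inl ⟨h, rfl⟩⟩

/-- Functions out of a set. -/
def ofFun {V : Type u} {Y : Gph.{u}} (f : V → Y.V) : Hom (.discrete V) Y :=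
  ⟨f, fun h => h.elim⟩

variable (𝒩) in
/-- Parallel composition. -/
def add : Hom (.prod (behGph 𝒩) (behGph 𝒩)) (behGph 𝒩) := ⟨fun a => Add.add (α := Beh _) a.1 a.2, by
  rintro ⟨p, q⟩ ⟨p', q'⟩ (⟨h, rfl : q = q'⟩ | ⟨rfl : p = p', h⟩)
  · exact Beh.Step.par _ h
  · exact (congrArg₂ Beh.Step (add_comm (G := Beh (Nm 𝒩)) q p) (add_comm (G := Beh (Nm 𝒩)) q' p)).mp
      (Beh.Step.par _ h)⟩

variable (𝒩) in
/-- Input. -/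
noncomputable def recv (n : ℕ) :
    Hom (.prod (.discrete (Nm 𝒩)) (.ihom (obj (Ob.pow 𝒩 n)) (behGph 𝒩))) (behGph 𝒩) :=
  ⟨fun a => Beh.recv n a.1 fun v => a.2.toFun (ofTup n v), by
    rintro ⟨x, f⟩ ⟨y, g⟩ (h | ⟨rfl : x = y, h⟩)
    · exact h.1.elim
    · exact Beh.Step.recv n x fun v => h (ofTup n v)⟩

variable (𝒩) in
/-- Output. -/
def send (n : ℕ) : Hom (.prod (.discrete (Nm 𝒩)) (obj (Ob.pow 𝒩 n))) (behGph 𝒩) :=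
  ⟨fun a => Beh.send a.1 (toList n a.2), fun h =>
    h.elim (fun h => h.1.elim) (fun h => (not_rel_pow n _ _ h.2).elim)⟩

end Gph.Hom

/-- Labelled maps: sets of pairs of a multiset of labels and a graph homomorphism. The labels are a
multiset, and not a list, because the interchange law permutes them. -/
abbrev LHom (X Y : Gph.{u}) : Type u := Set (Multiset ℕ × Gph.Hom X Y)

namespace LHom

open Gph.Hom

variable {W X Y Z X' Y' Z' : Gph.{u}}

/-- A graph homomorphism, without labels. -/
def single (f : Gph.Hom X Y) : LHom X Y := ({(0, f)} : Set _)

/-- Composition, adding up the labels. -/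
def comp (F : LHom X Y) (G : LHom Y Z) : LHom X Z :=
  Set.image2 (fun a b => (a.1 + b.1, a.2.comp b.2)) F G

/-- Tensor product, adding up the labels. -/
def tensor (F : LHom X Y) (G : LHom X' Y') : LHom (.prod X X') (.prod Y Y') :=
  Set.image2 (fun a b => (a.1 + b.1, a.2.tensor b.2)) F G

/-- Currying. -/
def curry (F : LHom (.prod X Y) Z) : LHom Y (.ihom X Z) :=
  Set.image (fun a => (a.1, a.2.curry)) F

theorem mem_single {f : Gph.Hom X Y} {a} : a ∈ single f ↔ a = (0, f) := Iff.rfl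

theorem single_comp (f : Gph.Hom X Y) (G : LHom Y Z) :
    (single f).comp G = Set.image (fun b => (b.1, f.comp b.2)) G := by
  simp only [single, comp, Set.image2_singleton_left, zero_add]

theorem comp_single (F : LHom X Y) (g : Gph.Hom Y Z) :
    F.comp (single g) = Set.image (fun a => (a.1, a.2.comp g)) F := by
  simp only [single, comp, Set.image2_singleton_right, add_zero]

theorem single_tensor (f : Gph.Hom X Y) (G : LHom X' Y') :
    (single f).tensor G = Set.image (fun b => (b.1, f.tensor b.2)) G := by
  simp only [single, tensor, Set.image2_singleton_left, zero_add]

theorem tensor_single (F : LHom X Y) (g : Gph.Hom X' Y') :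
    F.tensor (single g) = Set.image (fun a => (a.1, a.2.tensor g)) F := by
  simp only [single, tensor, Set.image2_singleton_right, add_zero]

theorem single_comp_single (f : Gph.Hom X Y) (g : Gph.Hom Y Z) :
    (single f).comp (single g) = single (f.comp g) := by
  rw [single_comp]; exact Set.image_singleton

theorem single_tensor_single (f : Gph.Hom X Y) (g : Gph.Hom X' Y') :
    (single f).tensor (single g) = single (f.tensor g) := by
  rw [single_tensor]; exact Set.image_singleton

theorem single_id_comp (F : LHom X Y) : (single (Gph.Hom.id X)).comp F = F :=
  (single_comp _ _).trans (Set.image_id _)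

theorem comp_single_id (F : LHom X Y) : F.comp (single (Gph.Hom.id Y)) = F :=
  (comp_single _ _).trans (Set.image_id _)

theorem comp_assoc (F : LHom W X) (G : LHom X Y) (H : LHom Y Z) :
    (F.comp G).comp H = F.comp (G.comp H) :=
  Set.image2_assoc fun _ _ _ => Prod.ext (add_assoc _ _ _) rfl

theorem tensor_comp (F : LHom X Y) (G : LHom Y Z) (F' : LHom X' Y') (G' : LHom Y' Z') :
    (F.tensor F').comp (G.tensor G') = (F.comp G).tensor (F'.comp G') :=
  Set.image2_image2_image2_comm fun _ _ _ _ => Prod.ext (add_add_add_comm _ _ _ _) rfl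

theorem assoc_nat (F : LHom X X') (G : LHom Y Y') (H : LHom Z Z') :
    ((F.tensor G).tensor H).comp (single (assocHom X' Y' Z')) =
      (single (assocHom X Y Z)).comp (F.tensor (G.tensor H)) := by
  rw [comp_single, single_comp]
  simp only [tensor, Set.image_image2]
  exact Set.image2_assoc fun _ _ _ => Prod.ext (add_assoc _ _ _) rfl

theorem lunit_nat (F : LHom X Y) :
    ((single (Gph.Hom.id _)).tensor F).comp (single (lunitHom Y)) = (single (lunitHom X)).comp F := by
  rw [comp_single, single_comp, single_tensor]
  exact Set.image_image _ _ _

theorem runit_nat (F : LHom X Y) :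
    (F.tensor (single (Gph.Hom.id _))).comp (single (runitHom Y)) = (single (runitHom X)).comp F := by
  rw [comp_single, single_comp, tensor_single]
  exact Set.image_image _ _ _

theorem braid_nat (F : LHom X Y) (G : LHom X' Y') :
    (F.tensor G).comp (single (braid Y Y')) = (single (braid X X')).comp (G.tensor F) := by
  rw [comp_single, single_comp]
  simp only [tensor, Set.image_image2]
  rw [Set.image2_swap]
  exact Set.image2_congr fun _ _ _ _ => Prod.ext (add_comm _ _) rfl

theorem curry_beta (F : LHom (.prod X Y) Z) :
    ((single (Gph.Hom.id X)).tensor F.curry).comp (single (ev X Z)) = F := by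
  rw [comp_single, single_tensor]
  exact (Set.image_image _ _ _).trans ((Set.image_image _ _ _).trans (Set.image_id _))

theorem curry_eta (G : LHom Y (.ihom X Z)) :
    (((single (Gph.Hom.id X)).tensor G).comp (single (ev X Z))).curry = G := by
  rw [comp_single, single_tensor]
  exact (congrArg _ (Set.image_image _ _ _)).trans
    ((Set.image_image _ _ _).trans (Set.image_id _))

end LHom

open Gph.Hom in
/-- The interpretation of formal 1-morphisms. Every occurrence of `fresh` chooses a label; a
1-morphism is interpreted as the set of pairs of the multiset of labels chosen and the resulting
function. Occurrences of `fresh` that choose different labels can be told apart, although every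
scalar acts trivially on the underlying functions. -/
noncomputable def tm : {X Y : Ob 𝒩} → Tm 𝒩 X Y → LHom (obj X) (obj Y)
  | _, _, .id X => .single (id (obj X))
  | _, _, .comp f g => (tm f).comp (tm g)
  | _, _, .tensor f g => (tm f).tensor (tm g)
  | _, _, .assocHom X Y Z => .single (assocHom (obj X) (obj Y) (obj Z))
  | _, _, .assocInv X Y Z => .single (assocInv (obj X) (obj Y) (obj Z))
  | _, _, .lunitHom X => .single (lunitHom (obj X))
  | _, _, .lunitInv X => .single (lunitInv (obj X))
  | _, _, .runitHom X => .single (runitHom (obj X))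
  | _, _, .runitInv X => .single (runitInv (obj X))
  | _, _, .braid X Y => .single (braid (obj X) (obj Y))
  | _, _, .curry f => (tm f).curry
  | _, _, .ev A X => .single (ev (obj A) (obj X))
  | _, _, .dup => .single (ofFun fun a => (a, a))
  | _, _, .del => .single (ofFun fun _ => PUnit.unit)
  | _, _, .bar => .single (add 𝒩)
  | _, _, .zero => .single (ofFun fun _ => (0 : Beh (Nm 𝒩)))
  | _, _, .recv n => .single (recv 𝒩 n)
  | _, _, .send n => .single (send 𝒩 n)
  | _, _, .fresh => Set.range fun n => ({n}, ofFun fun _ => (.inr n : Nm 𝒩))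
  | _, _, .COMM => .single (ofFun fun _ => (Beh.tok : Beh (Nm 𝒩)))
  | _, _, .name x => .single (ofFun fun _ => (.inl x : Nm 𝒩))

open LHom in
/-- Equal 1-morphisms have the same interpretation. -/
theorem tm_eq {X Y : Ob 𝒩} {f g : Tm 𝒩 X Y} (h : TmEq f g) : tm f = tm g := by
  induction h with
  | refl => rfl
  | symm _ ih => exact ih.symm
  | trans _ _ ih ih' => exact ih.trans ih'
  | comp_congr _ _ ih ih' => exact congrArg₂ comp ih ih'
  | tensor_congr _ _ ih ih' => exact congrArg₂ tensor ih ih'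
  | curry_congr _ ih => exact congrArg (curry (X := obj _) (Y := obj _)) ih
  | id_comp f => exact single_id_comp (tm f)
  | comp_id f => exact comp_single_id (tm f)
  | comp_assoc f g h => exact comp_assoc (tm f) (tm g) (tm h)
  | tensor_comp f g f' g' => exact tensor_comp (tm f) (tm g) (tm f') (tm g')
  | assoc_nat f g h => exact assoc_nat (tm f) (tm g) (tm h)
  | lunit_nat f => exact lunit_nat (tm f)
  | runit_nat f => exact runit_nat (tm f)
  | braid_nat f f' => exact braid_nat (tm f) (tm f')
  | curry_beta f => exact curry_beta (X := obj _) (Y := obj _) (tm f)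
  | curry_eta f => exact curry_eta (X := obj _) (Y := obj _) (tm f)
  | bar_zero =>
    simp only [tm]
    erw [single_tensor_single, single_comp_single]
    exact congrArg LHom.single (Gph.Hom.ext (funext fun a => add_zero (M := Beh (Nm 𝒩)) _))
  | zero_bar =>
    simp only [tm]
    erw [single_tensor_single, single_comp_single]
    exact congrArg LHom.single (Gph.Hom.ext (funext fun a => zero_add (M := Beh (Nm 𝒩)) _))
  | bar_assoc =>
    simp only [tm]
    erw [single_tensor_single, single_tensor_single, single_comp_single, single_comp_single, single_comp_single]
    exact congrArg LHom.single (Gph.Hom.ext (funext fun a => add_assoc (G := Beh (Nm 𝒩)) _ _ _))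
  | bar_comm =>
    simp only [tm]
    erw [single_comp_single]
    exact congrArg LHom.single (Gph.Hom.ext (funext fun a => add_comm (G := Beh (Nm 𝒩)) _ _))
  | _ =>
    simp only [tm]
    repeat first | erw [single_tensor_single] | erw [single_comp_single]
    rfl

/-- The interpretation of 1-morphisms. -/
noncomputable def den {X Y : Ob 𝒩} : (X ⟶ Y) → LHom (obj X) (obj Y) :=
  Quotient.lift tm fun _ _ h => tm_eq h

/-- The form of `exists_den` for formal 1-morphisms: a choice of pairwise distinct labels outside
`S` for all occurrences of `fresh`. -/
theorem exists_tm {X Y : Ob 𝒩} (f : Tm 𝒩 X Y) (S : Finset ℕ) :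
    ∃ a ∈ tm f, a.1.Nodup ∧ ∀ n ∈ a.1, n ∉ S := by
  induction f generalizing S with
  | comp f g ihf ihg | tensor f g ihf ihg =>
    obtain ⟨a, ha, h1, h2⟩ := ihf S
    obtain ⟨b, hb, h3, h4⟩ := ihg (S ∪ a.1.toFinset)
    simp only [Finset.mem_union, not_or, Multiset.mem_toFinset] at h4
    refine ⟨_, ⟨a, ha, b, hb, rfl⟩, ?_, ?_⟩
    · exact Multiset.nodup_add.2 ⟨h1, h3,
        Multiset.disjoint_left.2 fun {n} hn hn' => (h4 n hn').2 hn⟩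
    · intro n hn
      rcases Multiset.mem_add.1 hn with hn | hn
      exacts [h2 n hn, (h4 n hn).1]
  | curry f ih =>
    obtain ⟨a, ha, h⟩ := ih S
    exact ⟨_, ⟨a, ha, rfl⟩, h⟩
  | fresh =>
    obtain ⟨n, hn⟩ := Infinite.exists_notMem_finset S
    exact ⟨_, ⟨n, rfl⟩, by simp, by simpa using hn⟩
  | _ => exact ⟨_, rfl, by simp, by simp⟩

/-- Labels can be chosen pairwise distinct and outside any finite set. -/
theorem exists_den {X Y : Ob 𝒩} (f : X ⟶ Y) (S : Finset ℕ) :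
    ∃ a ∈ den f, a.1.Nodup ∧ ∀ n ∈ a.1, n ∉ S := by
  obtain ⟨t⟩ := f; exact exists_tm t S

end PiModel

/-! ### Interpretation of processes in the model -/

namespace PiModel

open PiTheory

variable {𝒩 : Type u}

theorem den_comp {X Y Z : Ob 𝒩} (f : X ⟶ Y) (g : Y ⟶ Z) :
    den (f ≫ g) = (den f).comp (den g) := by
  obtain ⟨f⟩ := f; obtain ⟨g⟩ := g; rfl

theorem den_tensor {X Y X' Y' : Ob 𝒩} (f : X ⟶ Y) (g : X' ⟶ Y') :
    den (f ⊗ₘ g) = (den f).tensor (den g) := by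
  obtain ⟨f⟩ := f; obtain ⟨g⟩ := g; rfl

theorem den_curry {A Y X : Ob 𝒩} (f : A ⊗ Y ⟶ X) :
    den (curry f) = LHom.curry (X := obj A) (Y := obj Y) (den f) := by
  obtain ⟨f⟩ := f; rfl

theorem den_comp_single {X Y Z : Ob 𝒩} {f : X ⟶ Y} {g : Y ⟶ Z} {F G}
    (hf : den f = .single F) (hg : den g = .single G) : den (f ≫ g) = .single (F.comp G) := by
  rw [den_comp, hf, hg, LHom.single_comp_single]

theorem den_tensor_single {X Y X' Y' : Ob 𝒩} {f : X ⟶ Y} {g : X' ⟶ Y'} {F G}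
    (hf : den f = .single F) (hg : den g = .single G) : den (f ⊗ₘ g) = .single (F.tensor G) := by
  rw [den_tensor, hf, hg]; exact LHom.single_tensor_single F G

theorem den_id (X : Ob 𝒩) : den (𝟙 X) = .single (.id (obj X)) := rfl

theorem den_associator_hom (X Y Z : Ob 𝒩) : den (α_ X Y Z).hom =
    .single (.assocHom (obj X) (obj Y) (obj Z) : Gph.Hom (obj ((X ⊗ Y) ⊗ Z)) (obj (X ⊗ Y ⊗ Z))) :=
  rfl

theorem den_associator_inv (X Y Z : Ob 𝒩) : den (α_ X Y Z).inv =
    .single (.assocInv (obj X) (obj Y) (obj Z) : Gph.Hom (obj (X ⊗ Y ⊗ Z)) (obj ((X ⊗ Y) ⊗ Z))) :=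
  rfl

theorem den_braiding_hom (X Y : Ob 𝒩) : den (β_ X Y).hom =
    .single (.braid (obj X) (obj Y) : Gph.Hom (obj (X ⊗ Y)) (obj (Y ⊗ X))) := rfl

theorem den_leftUnitor_hom (X : Ob 𝒩) : den (λ_ X).hom =
    .single (.lunitHom (obj X) : Gph.Hom (obj (𝟙_ (Ob 𝒩) ⊗ X)) (obj X)) := rfl

theorem den_leftUnitor_inv (X : Ob 𝒩) : den (λ_ X).inv =
    .single (.lunitInv (obj X) : Gph.Hom (obj X) (obj (𝟙_ (Ob 𝒩) ⊗ X))) := rfl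

theorem den_rightUnitor_hom (X : Ob 𝒩) : den (ρ_ X).hom =
    .single (.runitHom (obj X) : Gph.Hom (obj (X ⊗ 𝟙_ (Ob 𝒩))) (obj X)) := rfl

theorem den_rightUnitor_inv (X : Ob 𝒩) : den (ρ_ X).inv =
    .single (.runitInv (obj X) : Gph.Hom (obj X) (obj (X ⊗ 𝟙_ (Ob 𝒩)))) := rfl

theorem den_dup : den (dup (𝒩 := 𝒩)) =
    .single (.ofFun fun a => (a, a) : Gph.Hom (obj .N) (obj (.N ⊗ .N))) := rfl

theorem den_del : den (del (𝒩 := 𝒩)) =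
    .single (.ofFun fun _ => PUnit.unit : Gph.Hom (obj .N) (obj (𝟙_ (Ob 𝒩)))) := rfl

theorem den_bar : den (bar (𝒩 := 𝒩)) =
    .single (.add 𝒩 : Gph.Hom (obj (.P ⊗ .P)) (obj .P)) := rfl

theorem den_zero : den (zero (𝒩 := 𝒩)) =
    .single (.ofFun fun _ => (0 : Beh (Nm 𝒩)) : Gph.Hom (obj (𝟙_ (Ob 𝒩))) (obj .P)) := rfl

theorem den_COMM : den (COMM (𝒩 := 𝒩)) =
    .single (.ofFun fun _ => (Beh.tok : Beh (Nm 𝒩)) : Gph.Hom (obj (𝟙_ (Ob 𝒩))) (obj .P)) := rfl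

theorem den_name (x : 𝒩) : den (name x) =
    .single (.ofFun fun _ => (.inl x : Nm 𝒩) : Gph.Hom (obj (𝟙_ (Ob 𝒩))) (obj .N)) := rfl

theorem den_send (n : ℕ) : den (send (𝒩 := 𝒩) n) =
    .single (.send 𝒩 n : Gph.Hom (obj (.N ⊗ pow 𝒩 n)) (obj .P)) := rfl

theorem den_recv (n : ℕ) : den (recv (𝒩 := 𝒩) n) =
    .single (.recv 𝒩 n : Gph.Hom (obj (.N ⊗ .hom (pow 𝒩 n) .P)) (obj .P)) := rfl

theorem den_ev (A X : Ob 𝒩) : den (PiTheory.ev A X) =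
    .single (.ev (obj A) (obj X) : Gph.Hom (obj (A ⊗ .hom A X)) (obj X)) := rfl

/-- The function underlying the interpretation of the middle-four interchange. -/
theorem den_tensorμ (W X Y Z : Ob 𝒩) : ∃ F, den (tensorμ W X Y Z) = .single F ∧
    ∀ w x y z, F ((w, x), (y, z)) = ((w, y), (x, z)) :=
  ⟨_, den_comp_single (den_associator_hom _ _ _) <|
    den_comp_single (den_tensor_single (den_id _) (den_associator_inv _ _ _)) <|
    den_comp_single (den_tensor_single (den_id _)
      (den_tensor_single (den_braiding_hom _ _) (den_id _))) <|
    den_comp_single (den_tensor_single (den_id _) (den_associator_hom _ _ _))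
      (den_associator_inv _ _ _), fun _ _ _ _ => rfl⟩

theorem den_withComm {X : Ob 𝒩} {f : X ⟶ Ob.P} {F} (hf : den f = .single F) :
    ∃ G, den (withComm f) = .single G ∧
      ∀ x, G x = (fun p : Beh (Nm 𝒩) => p + Beh.tok) (F x) :=
  ⟨_, den_comp_single hf <| den_comp_single (den_rightUnitor_inv _) <|
    den_comp_single (den_tensor_single (den_id _) den_COMM) den_bar, fun _ => rfl⟩

theorem den_commSrc (n : ℕ) : ∃ F, den (commSrc n : (Ob.N : Ob 𝒩) ⊗ _ ⟶ _) = .single F ∧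
    ∀ x zs k, F (x, (zs, k)) =
      (Beh.send x (toList n zs) + Beh.recv n x (fun v => k.toFun (ofTup n v)) + Beh.tok :
        Beh (Nm 𝒩)) := by
  obtain ⟨M, hM, hM'⟩ := den_tensorμ (Ob.N : Ob 𝒩) Ob.N (pow 𝒩 n) (Ob.hom (pow 𝒩 n) Ob.P)
  obtain ⟨F, hF, hF'⟩ := den_withComm <| den_comp_single
    (den_tensor_single den_dup (den_id (pow 𝒩 n ⊗ Ob.hom (pow 𝒩 n) Ob.P))) <|
    den_comp_single hM <|
    den_comp_single (den_tensor_single (den_send n) (den_recv n)) den_bar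
  refine ⟨F, hF, fun x zs k => (hF' _).trans ?_⟩
  have e := hM' x x zs k
  exact congrArg (fun m => (fun p q : Beh (Nm 𝒩) => p + q + Beh.tok)
    ((Gph.Hom.send 𝒩 n).toFun m.1) ((Gph.Hom.recv 𝒩 n).toFun m.2)) e

theorem den_commTgt (n : ℕ) : ∃ F, den (commTgt n : (Ob.N : Ob 𝒩) ⊗ _ ⟶ _) = .single F ∧
    ∀ x zs k, F (x, (zs, k)) = (fun p : Beh (Nm 𝒩) => p + Beh.tok) (k.toFun zs) :=
  let ⟨F, hF, hF'⟩ := den_withComm <| den_comp_single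
    (den_tensor_single den_del (den_ev (pow 𝒩 n) Ob.P)) (den_leftUnitor_hom _)
  ⟨F, hF, fun _ _ _ => hF' _⟩

/-- A 2-morphism generated by one top-level occurrence of `commₙ` is interpreted by edges. -/
theorem rel_of_commOnce {X Y : Ob 𝒩} {f g : X ⟶ Y} {a : f ⟶ g} (h : CommOnce a) :
    ∀ b ∈ den f, ∃ c ∈ den g, c.1 = b.1 ∧ ∀ x, (obj Y).R (b.2 x) (c.2 x) := by
  induction h with
  | comm n =>
    obtain ⟨F, hF, hF'⟩ := den_commSrc (𝒩 := 𝒩) n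
    obtain ⟨G, hG, hG'⟩ := den_commTgt (𝒩 := 𝒩) n
    rw [hF, hG]
    rintro _ rfl
    refine ⟨_, rfl, rfl, ?_⟩
    rintro ⟨x, zs, k⟩
    rw [hF', hG']
    have h := Beh.Step.comm n x ⟨toList n zs, length_toList n zs⟩ fun v => k.toFun (ofTup n v)
    exact (congrArg (fun v => Beh.Step _ ((fun p : Beh (Nm 𝒩) => p + Beh.tok) (k.toFun v)))
      (ofTup_toList n zs)).mp h
  | vert h h' _ ih => subst h h'; exact ih
  | horiz_left h _ ih =>
    rw [den_comp, den_comp]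
    rintro _ ⟨b, hb, c, hc, rfl⟩
    obtain ⟨c', hc', e, h⟩ := ih c hc
    exact ⟨_, ⟨b, hb, c', hc', rfl⟩, congrArg (b.1 + ·) e, fun x => h _⟩
  | horiz_right h _ ih =>
    rw [den_comp, den_comp]
    rintro _ ⟨b, hb, c, hc, rfl⟩
    obtain ⟨b', hb', e, h⟩ := ih b hb
    exact ⟨_, ⟨b', hb', c, hc, rfl⟩, congrArg (· + c.1) e, fun x => c.2.map_rel (h x)⟩
  | tensor_left h _ ih =>
    rw [den_tensor, den_tensor]
    rintro _ ⟨b, hb, c, hc, rfl⟩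
    obtain ⟨c', hc', e, h⟩ := ih c hc
    exact ⟨_, ⟨b, hb, c', hc', rfl⟩, congrArg (b.1 + ·) e, fun x => .inr ⟨rfl, h _⟩⟩
  | tensor_right h _ ih =>
    rw [den_tensor, den_tensor]
    rintro _ ⟨b, hb, c, hc, rfl⟩
    obtain ⟨b', hb', e, h⟩ := ih b hb
    exact ⟨_, ⟨b', hb', c, hc, rfl⟩, congrArg (· + c.1) e, fun x => .inl ⟨h _, rfl⟩⟩

/-- Maps out of a tensor power of `N`, which has no edges. -/
def ofPow {n : ℕ} {Y : Gph.{u}} (f : (obj (Ob.pow 𝒩 n)).V → Y.V) :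
    Gph.Hom (obj (Ob.pow 𝒩 n)) Y :=
  ⟨f, fun h => (not_rel_pow n _ _ h).elim⟩

theorem den_dupPow (n : ℕ) :
    den (dupPow n) = .single (ofPow (𝒩 := 𝒩) (Y := .prod _ _) fun v => (v, v)) := by
  induction n with
  | zero => rfl
  | succ n ih =>
    obtain ⟨M, hM, hM'⟩ := den_tensorμ (Ob.N : Ob 𝒩) Ob.N (pow 𝒩 n) (pow 𝒩 n)
    refine (den_comp_single (den_tensor_single den_dup ih)
      hM).trans (congrArg LHom.single (Gph.Hom.ext (funext fun v => hM' v.1 v.1 v.2 v.2)))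

theorem den_delPow (n : ℕ) :
    den (delPow n) = .single (ofPow (𝒩 := 𝒩) (Y := .discrete PUnit) fun _ => PUnit.unit) := by
  induction n with
  | zero => rfl
  | succ n ih =>
    exact den_comp_single (den_tensor_single den_del ih)
      (den_leftUnitor_hom _)

variable [DecidableEq 𝒩]

/-- The environment sending `ys` to `zs` pointwise and agreeing with `ρ` elsewhere. -/
def bind {M : Type u} : List 𝒩 → List M → (𝒩 → M) → 𝒩 → M
  | y :: ys, z :: zs, ρ => Function.update (bind ys zs ρ) y z
  | _, _, ρ => ρ

/-- The environment given by a tuple of names for the names in scope. -/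
def env : (Γ : List 𝒩) → (obj (Ob.pow 𝒩 Γ.length)).V → 𝒩 → Nm 𝒩
  | [], _ => .inl
  | y :: Γ, v => Function.update (env Γ v.2) y v.1

theorem den_wire (Γ : List 𝒩) (x : 𝒩) :
    den (wire Γ x) = .single (ofPow (Y := .discrete (Nm 𝒩)) fun γ => env Γ γ x) := by
  induction Γ with
  | nil => rfl
  | cons y Γ ih =>
    by_cases h : x = y
    · subst h
      simp only [wire, if_true]
      refine (den_comp_single (den_tensor_single (den_id Ob.N)
        (den_delPow Γ.length)) (den_rightUnitor_hom _)).trans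
        (congrArg LHom.single (Gph.Hom.ext (funext fun v => ?_)))
      exact (Function.update_self (β := fun _ => Nm 𝒩) ..).symm
    · simp only [wire, if_neg h]
      refine (den_comp_single (den_tensor_single den_del ih) (den_leftUnitor_hom _)).trans
        (congrArg LHom.single (Gph.Hom.ext (funext fun v => ?_)))
      exact (Function.update_of_ne (β := fun _ => Nm 𝒩) h _ _).symm

theorem den_wires (Γ zs : List 𝒩) : ∃ F, den (wires Γ zs) = .single F ∧
    ∀ γ, toList _ (F γ) = zs.map (env Γ γ) := by
  induction zs with
  | nil => exact ⟨_, den_delPow _, fun _ => rfl⟩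
  | cons z zs ih =>
    obtain ⟨F, hF, hF'⟩ := ih
    exact ⟨_, den_comp_single (den_dupPow _) (den_tensor_single (den_wire Γ z) hF),
      fun γ => congrArg (env Γ γ z :: ·) (hF' γ)⟩

theorem den_join (ys Γ : List 𝒩) : ∃ F, den (join ys Γ) = .single F ∧
    ∀ v γ, env (ys ++ Γ) (F (v, γ)) = bind ys (toList _ v) (env Γ γ) := by
  induction ys with
  | nil => exact ⟨_, den_leftUnitor_hom _, fun _ _ => rfl⟩
  | cons y ys ih =>
    obtain ⟨F, hF, hF'⟩ := ih
    refine ⟨_, den_comp_single (den_associator_hom _ _ _)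
      (den_tensor_single (den_id Ob.N) hF), fun v γ => ?_⟩
    exact congrArg (fun ρ => Function.update ρ y v.1) (hF' v.2 γ)

theorem den_names (Γ : List 𝒩) : ∃ F, den (names Γ) = .single F ∧
    ∀ x, env Γ (F x) = .inl := by
  induction Γ with
  | nil => exact ⟨_, den_id _, fun _ => rfl⟩
  | cons y Γ ih =>
    obtain ⟨F, hF, hF'⟩ := ih
    refine ⟨_, den_comp_single (den_leftUnitor_inv _)
      (den_tensor_single (den_name y) hF),
      fun v => ?_⟩
    refine (congrArg (fun ρ => Function.update ρ y (.inl y)) (hF' v)).trans ?_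
    exact Function.update_eq_self (β := fun _ => Nm 𝒩) y .inl

/-- The behaviours of a process, as functions of the environment. Every restriction chooses a
label, once and for all; the multiset of labels is recorded. -/
inductive Sem : PiCalc.Proc 𝒩 → Multiset ℕ → ((𝒩 → Nm 𝒩) → Beh (Nm 𝒩)) → Prop
  | nil : Sem .nil 0 fun _ => 0
  | inp (x ys hys) {Q L h} : Sem Q L h →
      Sem (.inp x ys hys Q) L fun ρ => Beh.recv ys.length (ρ x) fun v => h (bind ys v.1 ρ)
  | out (x zs) : Sem (.out x zs) 0 fun ρ => Beh.send (ρ x) (zs.map ρ)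
  | new (x a) {Q L h} : Sem Q L h →
      Sem (.new x Q) ({a} + L) fun ρ => h (Function.update ρ x (.inr a))
  | par {P Q L M h k} : Sem P L h → Sem Q M k → Sem (.par P Q) (L + M) fun ρ => h ρ + k ρ

/-- The interpretation of a process in the model consists of its behaviours `Sem`. The context
matters only through the environment that it defines. -/
theorem mem_den_interp (P : PiCalc.Proc 𝒩) (Γ : List 𝒩) (a) :
    a ∈ den (interp P Γ) ↔ ∃ h, Sem P a.1 h ∧ ∀ γ, a.2 γ = h (env Γ γ) := by
  induction P generalizing Γ a with
  | nil =>
    have e := den_comp_single (den_delPow (𝒩 := 𝒩) Γ.length) den_zero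
    rw [interp, e]
    constructor
    · rintro rfl; exact ⟨_, .nil, fun _ => rfl⟩
    · obtain ⟨L, f⟩ := a
      rintro ⟨_, ⟨⟩, h⟩
      exact Prod.ext rfl (Gph.Hom.ext (funext h))
  | out x zs =>
    obtain ⟨F, hF, hF'⟩ := den_wires Γ zs
    have e := den_comp_single (den_dupPow Γ.length) <| den_comp_single
      (den_tensor_single (den_wire Γ x) hF) (den_send zs.length)
    rw [interp, e]
    have key : ∀ γ, Beh.send (env Γ γ x) (toList _ (F γ)) =
        Beh.send (env Γ γ x) (zs.map (env Γ γ)) := fun γ => by rw [hF']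
    constructor
    · rintro rfl; exact ⟨_, .out x zs, key⟩
    · obtain ⟨L, f⟩ := a
      rintro ⟨_, ⟨⟩, h⟩
      exact Prod.ext rfl (Gph.Hom.ext (funext fun γ => (h γ).trans (key γ).symm))
  | par P Q ihP ihQ =>
    rw [interp, den_comp, den_comp, den_tensor, den_dupPow, den_bar]
    constructor
    · rintro ⟨_, rfl, _, ⟨_, ⟨b, hb, c, hc, rfl⟩, _, rfl, rfl⟩, rfl⟩
      obtain ⟨h, hh, eh⟩ := (ihP Γ b).1 hb
      obtain ⟨k, hk, ek⟩ := (ihQ Γ c).1 hc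
      refine ⟨fun ρ => h ρ + k ρ, ?_, fun γ => congrArg₂ (fun p q : Beh (Nm 𝒩) => p + q) (eh γ) (ek γ)⟩
      simpa using Sem.par hh hk
    · obtain ⟨L, f⟩ := a
      rintro ⟨_, hS, e⟩
      cases hS with
      | @par _ _ L M h k hP hQ =>
      refine ⟨_, rfl, _, ⟨_, ⟨(L, ofPow (Y := behGph 𝒩) fun γ => h (env Γ γ)),
        (ihP Γ _).2 ⟨h, hP, fun _ => rfl⟩, (M, ofPow (Y := behGph 𝒩) fun γ => k (env Γ γ)),
        (ihQ Γ _).2 ⟨k, hQ, fun _ => rfl⟩, rfl⟩, _, rfl, rfl⟩, ?_⟩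
      exact Prod.ext (by change _ = L + M; simp) (Gph.Hom.ext (funext fun γ => (e γ).symm))
  | new x Q ih =>
    have e : den (interp (.new x Q) Γ) = (den (λ_ (pow 𝒩 Γ.length)).inv).comp
        (LHom.comp (Y := obj (Ob.N ⊗ pow 𝒩 Γ.length)) ((den fresh).tensor (den (𝟙 _)))
          (den (interp Q (x :: Γ)))) :=
      (den_comp _ _).trans (congrArg _ ((den_comp (Y := Ob.N ⊗ pow 𝒩 Γ.length) (Z := Ob.P)
        (fresh ⊗ₘ 𝟙 _) (interp Q (x :: Γ))).trans (congrArg (LHom.comp · _) (den_tensor _ _))))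
    rw [e]
    constructor
    · rintro ⟨_, rfl, _, ⟨_, ⟨_, ⟨n, rfl⟩, _, rfl, rfl⟩, b, hb, rfl⟩, rfl⟩
      obtain ⟨h, hh, eh⟩ := (ih (x :: Γ) b).1 hb
      refine ⟨fun ρ => h (Function.update ρ x (.inr n)), ?_, fun γ => eh (.inr n, γ)⟩
      simpa using Sem.new x n hh
    · obtain ⟨L, f⟩ := a
      rintro ⟨_, hS, e⟩
      cases hS with
      | @new _ n _ L h hQ =>
      refine ⟨_, rfl, _, ⟨_, ⟨_, ⟨n, rfl⟩, _, rfl, rfl⟩, (L, ofPow (Y := behGph 𝒩)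
        (n := Γ.length + 1) fun γ => h (env (x :: Γ) γ)),
        (ih (x :: Γ) _).2 ⟨h, hQ, fun _ => rfl⟩, rfl⟩, ?_⟩
      exact Prod.ext (by change _ = {n} + L; simp) (Gph.Hom.ext (funext fun γ => (e γ).symm))
  | inp x ys hys Q ih =>
    obtain ⟨J, hJ, hJ'⟩ := den_join ys Γ
    rw [interp, den_comp, den_comp, den_tensor, den_dupPow, den_wire, den_curry, den_comp, hJ,
      den_recv]
    have key : ∀ (b : Gph.Hom (obj (pow 𝒩 (ys ++ Γ).length)) (obj Ob.P))
        (h : (𝒩 → Nm 𝒩) → Beh (Nm 𝒩)) γ, (∀ γ, b γ = h (env (ys ++ Γ) γ)) →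
        (Beh.recv ys.length (env Γ γ x) fun v => b (J (ofTup _ v, γ))) =
        Beh.recv ys.length (env Γ γ x) fun v => h (bind ys v.1 (env Γ γ)) := by
      intro b h γ e
      refine congrArg _ (funext fun v => ?_)
      rw [e, hJ', toList_ofTup]
    constructor
    · rintro ⟨_, rfl, _, ⟨_, ⟨_, rfl, _, ⟨_, ⟨_, rfl, b, hb, rfl⟩, rfl⟩, rfl⟩, _, rfl, rfl⟩, rfl⟩
      obtain ⟨h, hh, eh⟩ := (ih (ys ++ Γ) b).1 hb
      refine ⟨fun ρ => Beh.recv ys.length (ρ x) fun v => h (bind ys v.1 ρ), ?_,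
        fun γ => key b.2 h γ eh⟩
      simpa using Sem.inp x ys hys hh
    · obtain ⟨L, f⟩ := a
      rintro ⟨_, hS, e⟩
      cases hS with
      | @inp _ _ _ _ L h hQ =>
      refine ⟨_, rfl, _, ⟨_, ⟨_, rfl, _, ⟨_, ⟨_, rfl, (L, ofPow (Y := behGph 𝒩)
        (n := (ys ++ Γ).length) fun γ => h (env (ys ++ Γ) γ)),
        (ih (ys ++ Γ) _).2 ⟨h, hQ, fun _ => rfl⟩, rfl⟩, rfl⟩, rfl⟩, _, rfl, rfl⟩, ?_⟩
      refine Prod.ext (by simp) (Gph.Hom.ext (funext fun γ => ?_))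
      exact (key (ofPow (Y := behGph 𝒩) _) h γ fun _ => rfl).trans (e γ).symm

/-- The case of `mem_den_interp` in which every name in scope denotes itself. -/
theorem mem_den_den (P : PiCalc.Proc 𝒩) (a) :
    a ∈ den (PiTheory.den P) ↔ ∃ h, Sem P a.1 h ∧ a.2 PUnit.unit = h .inl := by
  obtain ⟨F, hF, hF'⟩ := den_names P.fn.toList
  rw [PiTheory.den, den_comp, hF]
  constructor
  · rintro ⟨_, rfl, b, hb, rfl⟩
    obtain ⟨h, hh, eh⟩ := (mem_den_interp P _ b).1 hb
    refine ⟨h, by simpa using hh, ?_⟩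
    rw [← hF' PUnit.unit]
    exact eh _
  · rintro ⟨h, hh, eh⟩
    refine ⟨_, rfl, (a.1, ofPow fun γ => h (env _ γ)), (mem_den_interp P _ _).2
      ⟨h, hh, fun _ => rfl⟩, Prod.ext (by simp) (Gph.Hom.ext (funext fun x => ?_))⟩
    refine Eq.trans ?_ eh.symm
    exact congrArg h (hF' _)

end PiModel

/-! ### Reductions of behaviours come from reductions of processes -/

namespace PiCalc

variable {𝒩 : Type u} [DecidableEq 𝒩]

theorem assign_of_notMem {ys zs : List 𝒩} (σ : 𝒩 → 𝒩) {v : 𝒩} (h : v ∉ ys) :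
    assign ys zs σ v = σ v := by
  induction ys generalizing zs with
  | nil => rw [assign]; simp
  | cons y ys ih =>
    simp only [List.mem_cons, not_or] at h
    obtain _ | ⟨z, zs⟩ := zs
    · rw [assign]; simp
    · rw [assign, Function.update_of_ne h.1, ih h.2]

theorem assign_mem {ys zs : List 𝒩} (hl : ys.length = zs.length) (σ : 𝒩 → 𝒩) {v : 𝒩}
    (h : v ∈ ys) : assign ys zs σ v ∈ zs := by
  induction ys generalizing zs with
  | nil => simp at h
  | cons y ys ih =>
    obtain _ | ⟨z, zs⟩ := zs
    · simp at hl
    by_cases hvy : v = y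
    · subst hvy
      simp [assign]
    · rw [assign, Function.update_of_ne hvy]
      exact List.mem_cons_of_mem _ (ih (by simpa using hl) (by simpa [hvy] using h))

end PiCalc

namespace PiModel

open PiCalc

variable {𝒩 : Type u} [DecidableEq 𝒩]

theorem bind_congr {M : Type u} (ys : List 𝒩) (zs : List M) {ρ ρ' : 𝒩 → M} {v : 𝒩}
    (hl : ys.length = zs.length) (h : v ∉ ys → ρ v = ρ' v) : bind ys zs ρ v = bind ys zs ρ' v := by
  induction ys generalizing zs with
  | nil => exact h (by simp)
  | cons y ys ih =>
    cases zs with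
    | nil => simp at hl
    | cons z zs =>
      by_cases e : v = y
      · simp [bind, e]
      · simp only [bind, Function.update_of_ne e]
        exact ih zs (by simpa using hl) fun hv => h (by simp [e, hv])

theorem comp_assign {M : Type u} (ys zs : List 𝒩) (σ : 𝒩 → 𝒩) (ρ : 𝒩 → M) :
    ρ ∘ assign ys zs σ = bind ys (zs.map ρ) (ρ ∘ σ) := by
  induction ys generalizing zs with
  | nil => rfl
  | cons y ys ih =>
    cases zs with
    | nil => rfl
    | cons z zs => simp [bind, assign, Function.comp_update, ih]

/-- Two successive replacements of lists of names, the first by pairwise distinct names. -/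
theorem bind_assign {M : Type u} {ys ws : List 𝒩} (zs : List M) (σ : 𝒩 → 𝒩) (ρ : 𝒩 → M) {v : 𝒩}
    (h1 : ys.length = ws.length) (h2 : ys.length = zs.length) (hw : ws.Nodup)
    (hv : v ∉ ys → σ v ∉ ws) :
    bind ws zs ρ (assign ys ws σ v) = bind ys zs (ρ ∘ σ) v := by
  induction ys generalizing ws zs with
  | nil =>
    obtain rfl : ws = [] := by simpa using h1.symm
    rfl
  | cons y ys ih =>
    obtain _ | ⟨w, ws⟩ := ws
    · simp at h1
    obtain _ | ⟨z, zs⟩ := zs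
    · simp at h2
    by_cases e : v = y
    · subst e; simp [bind, assign]
    · simp only [bind, assign, Function.update_of_ne e]
      have hw' := List.nodup_cons.1 hw
      rw [Function.update_of_ne]
      · exact ih zs (by simpa using h1) (by simpa using h2) hw'.2 fun h =>
          fun h' => hv (by simp [e, h]) (by simp [h'])
      · intro e'
        by_cases hy : v ∈ ys
        · refine hw'.1 (e' ▸ ?_)
          exact assign_mem (by simpa using h1) σ hy
        · exact hv (by simp [e, hy])
            (by rw [← assign_of_notMem (zs := ws) σ hy, e']; simp)

/-- A behaviour depends only on the values of the free names. -/
theorem Sem.congr {P : Proc 𝒩} {L h} (hS : Sem P L h) {ρ ρ' : 𝒩 → Nm 𝒩}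
    (e : ∀ v ∈ P.fn, ρ v = ρ' v) : h ρ = h ρ' := by
  induction hS generalizing ρ ρ' with
  | nil => rfl
  | inp x ys hys _ ih =>
    simp only [Proc.fn, Finset.mem_insert, Finset.mem_sdiff, List.mem_toFinset] at e
    dsimp only
    rw [e x (.inl rfl)]
    congr 1; ext v
    exact ih fun w hw => bind_congr _ _ v.2.symm fun hy => e w (.inr ⟨hw, hy⟩)
  | out x zs =>
    simp only [Proc.fn, Finset.mem_insert, List.mem_toFinset] at e
    dsimp only
    rw [e x (.inl rfl), List.map_congr_left fun z hz => e z (.inr hz)]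
  | new x a _ ih =>
    simp only [Proc.fn, Finset.mem_sdiff, Finset.mem_singleton] at e
    refine ih fun w hw => ?_
    by_cases hx : w = x
    · simp [hx]
    · simp [hx, e w ⟨hw, hx⟩]
  | par _ _ ih ih' =>
    simp only [Proc.fn, Finset.mem_union] at e
    dsimp only
    rw [ih fun v hv => e v (.inl hv), ih' fun v hv => e v (.inr hv)]

/-- The interpretation of a process does not mention `COMM`, not even below an input, so the only
token of `⟦P⟧ | COMM` is the one at top level. -/
theorem Sem.not_hasTok {P : Proc 𝒩} {L h} (hS : Sem P L h) (ρ : 𝒩 → Nm 𝒩) :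
    ¬ (h ρ).HasTok := by
  induction hS generalizing ρ with
  | nil => simp
  | inp x ys hys _ ih => simp [ih]
  | out x zs => simp
  | new x a _ ih => exact ih _
  | par _ _ ih ih' => simp [ih, ih']

/-- The outputs on given names among the components of a behaviour are the barbs: a restricted
name denotes a label, which is not a given name. -/
theorem Sem.barb_iff {P : Proc 𝒩} {L h} (hS : Sem P L h) (ρ : 𝒩 → Nm 𝒩) (c : 𝒩) :
    (∃ zs, Thread.send (.inl c) zs ∈ (h ρ).threads) ↔ ∃ x, Barb P x ∧ ρ x = .inl c := by
  induction hS generalizing ρ with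
  | nil => simp only [Beh.threads_zero]; constructor
           · rintro ⟨_, h⟩; simp at h
           · rintro ⟨_, ⟨⟩, _⟩
  | inp x ys hys _ ih =>
    constructor
    · rintro ⟨_, h⟩; simp at h
    · rintro ⟨_, ⟨⟩, _⟩
  | out x zs =>
    constructor
    · rintro ⟨_, h⟩
      simp only [Beh.threads_send, Multiset.mem_singleton, Thread.send.injEq] at h
      exact ⟨x, .out x zs, h.1.symm⟩
    · rintro ⟨_, ⟨⟩, h⟩
      exact ⟨zs.map ρ, by simp [h]⟩
  | new x a _ ih =>
    rw [ih]
    constructor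
    · rintro ⟨y, hy, e⟩
      have hne : y ≠ x := by rintro rfl; simp at e
      exact ⟨y, .new x hy hne, by simpa [hne] using e⟩
    · rintro ⟨y, ⟨⟩, e⟩
      exact ⟨y, ‹_›, by simpa [‹y ≠ x›] using e⟩
  | par _ _ ih ih' =>
    simp only [Beh.threads_add, Multiset.mem_add, exists_or, ih, ih']
    constructor
    · rintro (⟨y, hy, e⟩ | ⟨y, hy, e⟩)
      exacts [⟨y, .par_left _ hy, e⟩, ⟨y, .par_right _ hy, e⟩]
    · rintro ⟨y, hy, e⟩
      cases hy with
      | par_left _ hy => exact .inl ⟨y, hy, e⟩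
      | par_right _ hy => exact .inr ⟨y, hy, e⟩

/-- The number of constructors of a process. -/
def size : Proc 𝒩 → ℕ
  | .nil => 1
  | .inp _ _ _ P => size P + 1
  | .out _ _ => 1
  | .new _ P => size P + 1
  | .par P Q => size P + size Q + 1

/-- Restriction of a list of names, each paired with a label. -/
def news (l : List (𝒩 × ℕ)) (P : Proc 𝒩) : Proc 𝒩 := l.foldr (fun a P => .new a.1 P) P

/-- The environment in which restricted names denote their labels. -/
def label (l : List (𝒩 × ℕ)) (ρ : 𝒩 → Nm 𝒩) : 𝒩 → Nm 𝒩 :=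
  l.foldl (fun ρ a => Function.update ρ a.1 (.inr a.2)) ρ

theorem label_of_notMem {l : List (𝒩 × ℕ)} {v : 𝒩} (h : ∀ a ∈ l, a.1 ≠ v) (ρ : 𝒩 → Nm 𝒩) :
    label l ρ v = ρ v := by
  induction l generalizing ρ with
  | nil => rfl
  | cons a l ih =>
    rw [label, List.foldl_cons]
    refine (ih (fun b hb => h b (by simp [hb])) _).trans ?_
    exact Function.update_of_ne (h a (by simp)).symm _ _

/-- Restricting the names of `l` with their labels amounts to evaluating at `label l`. -/
theorem Sem.news {P : Proc 𝒩} {L h} (hS : Sem P L h) (l : List (𝒩 × ℕ)) :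
    Sem (news l P) (l.map Prod.snd + L : Multiset ℕ) fun ρ => h (label l ρ) := by
  induction l with
  | nil => simpa [PiModel.news, label] using hS
  | cons a l ih =>
    have := Sem.new a.1 a.2 ih
    rwa [← add_assoc, Multiset.singleton_add, Multiset.cons_coe] at this

/-- With pairwise distinct labels, distinct names denote distinct values, so that two components
communicate in the behaviour only if they use the same channel name. -/
theorem injective_label {l : List (𝒩 × ℕ)} (hl : (l.map Prod.snd).Nodup) {ρ : 𝒩 → Nm 𝒩}
    (hρ : Function.Injective ρ) (h : ∀ a ∈ l, ∀ v, ρ v ≠ .inr a.2) :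
    Function.Injective (label l ρ) := by
  induction l generalizing ρ with
  | nil => exact hρ
  | cons a l ih =>
    simp only [List.map_cons, List.nodup_cons, List.mem_map, not_exists, not_and] at hl
    refine ih hl.2 ?_ ?_
    · intro v w e
      by_cases hv : v = a.1 <;> by_cases hw : w = a.1
      · rw [hv, hw]
      · simp only [hv, Function.update_self, Function.update_of_ne hw] at e
        exact (h a (by simp) w e.symm).elim
      · simp only [hw, Function.update_self, Function.update_of_ne hv] at e
        exact (h a (by simp) v e).elim
      · simp only [Function.update_of_ne hv, Function.update_of_ne hw] at e
        exact hρ e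
    · intro b hb v
      by_cases hv : v = a.1
      · simp only [hv, Function.update_self]
        intro e
        exact hl.1 b hb (Sum.inr.inj e).symm
      · simp only [Function.update_of_ne hv]
        exact h b (by simp [hb]) v

variable [Infinite 𝒩]

theorem size_rename (P : Proc 𝒩) (σ : 𝒩 → 𝒩) : size (P.rename σ) = size P := by
  induction P generalizing σ with
  | nil | out => rfl
  | inp x ys hys P ih | new x P ih => exact congrArg (· + 1) (ih _)
  | par P Q ih ih' => simp [Proc.rename, size, ih, ih']

theorem length_freshNames (n : ℕ) (S : Finset 𝒩) : (freshNames n S).length = n :=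
  (exists_freshNames n S).choose_spec.1

theorem freshNames_notMem {n : ℕ} {S : Finset 𝒩} {v : 𝒩} (h : v ∈ freshNames n S) : v ∉ S :=
  (exists_freshNames n S).choose_spec.2.2 v h

theorem freshName_notMem {α : Type u} [Infinite α] (S : Finset α) : freshName S ∉ S :=
  (Infinite.exists_notMem_finset S).choose_spec

/-- Renaming a process amounts to precomposing its behaviour with the renaming. -/
theorem Sem.rename {P : Proc 𝒩} {L h} (hS : Sem P L h) (σ : 𝒩 → 𝒩) :
    ∃ k, Sem (P.rename σ) L k ∧ ∀ ρ, k ρ = h (ρ ∘ σ) := by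
  induction hS generalizing σ with
  | nil => exact ⟨_, .nil, fun _ => rfl⟩
  | @inp x ys hys Q L h hQ ih =>
    set ws := freshNames ys.length ((Q.fn \ ys.toFinset).image σ) with hws
    have hl : ws.length = ys.length := length_freshNames _ _
    obtain ⟨k, hk, e⟩ := ih (assign ys ws σ)
    refine ⟨_, .inp (σ x) ws (freshNames_nodup _ _) hk, fun ρ => ?_⟩
    -- the two inputs have propositionally equal arities
    have key : ∀ n (hn : n = ys.length), (Beh.recv n (ρ (σ x)) fun v => k (bind ws v.1 ρ)) =
        Beh.recv ys.length (ρ (σ x)) fun v => h (bind ys v.1 (ρ ∘ σ)) := by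
      rintro _ rfl
      congr 1; ext v
      rw [e]
      refine hQ.congr fun w hw => bind_assign _ _ _ hl.symm v.2.symm (freshNames_nodup _ _) ?_
      intro hy hmem
      refine freshNames_notMem hmem (Finset.mem_image_of_mem _ ?_)
      simp [hw, hy]
    exact key _ hl
  | out x zs => exact ⟨_, .out (σ x) (zs.map σ), fun ρ => by simp⟩
  | @new x a Q L h hQ ih =>
    obtain ⟨k, hk, e⟩ := ih (Function.update σ x (freshName ((Q.fn \ {x}).image σ)))
    refine ⟨_, .new _ a hk, fun ρ => ?_⟩
    rw [e]
    refine hQ.congr fun w hw => ?_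
    by_cases hx : w = x
    · subst hx; simp
    · have : σ w ≠ freshName ((Q.fn \ {x}).image σ) := fun e' =>
        freshName_notMem ((Q.fn \ {x}).image σ)
          (e' ▸ Finset.mem_image_of_mem σ (by simp [hw, hx]))
      simp [hx, this]
  | par _ _ ih ih' =>
    obtain ⟨k, hk, e⟩ := ih σ
    obtain ⟨k', hk', e'⟩ := ih' σ
    exact ⟨_, .par hk hk', fun ρ => by rw [e, e']⟩

/-- Processes without restrictions at top level. -/
inductive Flat : Proc 𝒩 → Prop
  | nil : Flat .nil
  | inp (x ys hys P) : Flat (.inp x ys hys P)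
  | out (x zs) : Flat (.out x zs)
  | par {P Q} : Flat P → Flat Q → Flat (.par P Q)

theorem structCong_news {P Q : Proc 𝒩} (l : List (𝒩 × ℕ)) (h : StructCong P Q) :
    StructCong (news l P) (news l Q) := by
  induction l with
  | nil => exact h
  | cons a l ih => exact .new _ ih

theorem red_news {P Q : Proc 𝒩} (l : List (𝒩 × ℕ)) (h : Red P Q) :
    Red (news l P) (news l Q) := by
  induction l with
  | nil => exact h
  | cons a l ih => exact .new _ ih

/-- Scope extrusion of a list of restrictions. -/
theorem structCong_news_par {P Q : Proc 𝒩} {l : List (𝒩 × ℕ)} (h : ∀ a ∈ l, a.1 ∉ Q.fn) :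
    StructCong (.par (news l P) Q) (news l (.par P Q)) := by
  induction l with
  | nil => exact .refl _
  | cons a l ih =>
    exact .trans (.scope _ _ _ (h a (by simp))) (.new _ (ih fun b hb => h b (by simp [hb])))

/-- Restrictions can be extruded to the top, keeping the behaviour and avoiding any given names. -/
theorem Sem.exists_flat {P : Proc 𝒩} {L h} (hS : Sem P L h) (S : Finset 𝒩) :
    ∃ l Q M k, Flat Q ∧ StructCong P (PiModel.news l Q) ∧ Sem Q M k ∧
      L = (l.map Prod.snd + M : Multiset ℕ) ∧ (∀ ρ, h ρ = k (label l ρ)) ∧ ∀ a ∈ l, a.1 ∉ S := by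
  -- induction on the size, which renaming a bound name preserves
  induction hn : size P using Nat.strong_induction_on generalizing P L h S with
  | _ n ih =>
  subst hn
  cases hS with
  | nil => exact ⟨[], _, _, _, .nil, .refl _, .nil, by simp, fun _ => rfl, by simp⟩
  | inp x ys hys hQ =>
    exact ⟨[], _, _, _, .inp _ _ _ _, .refl _, .inp x ys hys hQ, by simp, fun _ => rfl, by simp⟩
  | out x zs =>
    exact ⟨[], _, _, _, .out _ _, .refl _, .out x zs, by simp, fun _ => rfl, by simp⟩
  | @new x a Q L h hQ =>
    -- the bound name is replaced by `w`, which keeps the label `a`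
    obtain ⟨w, hw⟩ := Infinite.exists_notMem_finset (S ∪ (Q.fn \ {x}))
    simp only [Finset.mem_union, not_or] at hw
    obtain ⟨k, hk, ek⟩ := hQ.rename (assign [x] [w] id)
    obtain ⟨l, R, M, m, hR, hc, hM, eL, em, hl⟩ :=
      ih _ (by rw [size_rename]; exact Nat.lt_succ_self _) hk S rfl
    refine ⟨(w, a) :: l, R, M, m, hR, .trans (.alpha_new x w Q hw.2) (.new w hc), hM, ?_,
      fun ρ => ?_, by simpa [hw.1] using hl⟩
    · rw [eL, ← add_assoc]; rfl
    · refine Eq.trans ?_ (em (Function.update ρ w (.inr a)))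
      rw [ek]
      refine hQ.congr fun v hv => ?_
      by_cases hx : v = x
      · subst hx; simp [assign]
      · have : v ≠ w := fun e => hw.2 (by rw [← e]; simp [hv, hx])
        simp [assign, hx, this]
  | @par P Q L M h k hP hQ =>
    -- the restrictions of `P` are extruded first, so those of `Q` have to avoid the free names of `P'`
    obtain ⟨l, P', L', h', hP', cP, sP, eP, e, hl⟩ :=
      ih _ (by simp only [size]; omega) hP (S ∪ Q.fn) rfl
    obtain ⟨l', Q', M', k', hQ', cQ, sQ, eQ, e', hl'⟩ :=
      ih _ (by simp only [size]; omega) hQ (S ∪ P'.fn) rfl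
    simp only [Finset.mem_union, not_or] at hl hl'
    refine ⟨l ++ l', .par P' Q', _, _, .par hP' hQ', ?_, .par sP sQ, ?_, fun ρ => ?_, ?_⟩
    · have h1 : StructCong (.par P Q) (PiModel.news l (.par P' Q)) :=
        .trans (.par cP (.refl _)) (structCong_news_par fun a ha => (hl a ha).2)
      have h2 : StructCong (.par P' Q) (PiModel.news l' (.par P' Q')) :=
        .trans (.par (.refl _) cQ) <| .trans (.par_comm _ _) <|
          .trans (structCong_news_par fun a ha => (hl' a ha).2)
            (structCong_news _ (.par_comm _ _))
      rw [show PiModel.news (l ++ l') (.par P' Q') = PiModel.news l (PiModel.news l' (.par P' Q'))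
        from List.foldr_append ..]
      exact .trans h1 (structCong_news _ h2)
    · rw [eP, eQ, List.map_append, ← Multiset.coe_add]
      exact add_add_add_comm _ _ _ _
    · rw [show label (l ++ l') ρ = label l' (label l ρ) from List.foldl_append ..]
      dsimp only
      rw [e, ← e' (label l ρ), sP.congr (ρ' := label l' (label l ρ)) fun v hv =>
          (label_of_notMem (fun a ha ea => (hl' a ha).2 (ea ▸ hv)) _).symm,
        hQ.congr (ρ' := label l ρ) fun v hv =>
          (label_of_notMem (fun a ha ea => (hl a ha).2 (ea ▸ hv)) _).symm]
    · intro a ha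
      rcases List.mem_append.1 ha with ha | ha
      exacts [(hl a ha).1, (hl' a ha).1]

/-- A parallel component of the behaviour of a flat process comes from a component of the
process. -/
theorem Sem.exists_component {P : Proc 𝒩} {L h} (hS : Sem P L h) (hP : Flat P)
    {ρ : 𝒩 → Nm 𝒩} {t : Thread (Nm 𝒩)} (ht : t ∈ (h ρ).threads) :
    ∃ A R M N a r, Flat A ∧ Flat R ∧ StructCong P (.par A R) ∧ Sem A M a ∧ Sem R N r ∧ L = M + N ∧
      (∀ ρ, h ρ = a ρ + r ρ) ∧ (a ρ).threads = {t} ∧ ∀ B C, A ≠ .par B C := by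
  induction hS with
  | nil => simp at ht
  | inp x ys hys hQ =>
    refine ⟨_, .nil, _, 0, _, _, .inp _ _ _ _, .nil, .symm (.par_nil _), .inp x ys hys hQ, .nil,
      by simp, fun _ => (add_zero _).symm, ?_, by simp⟩
    simp only [Beh.threads_recv, Multiset.mem_singleton] at ht
    simp [ht]
  | out x zs =>
    refine ⟨_, .nil, _, 0, _, _, .out _ _, .nil, .symm (.par_nil _), .out x zs, .nil,
      by simp, fun _ => (add_zero _).symm, ?_, by simp⟩
    simp only [Beh.threads_send, Multiset.mem_singleton] at ht
    simp [ht]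
  | new => cases hP
  | @par P Q L' M' h k sP sQ ih ih' =>
    cases hP with | par hP hQ =>
    simp only [Beh.threads_add, Multiset.mem_add] at ht
    rcases ht with ht | ht
    · obtain ⟨A, R, M, N, a, r, hA, hR, c, sA, sR, eL, e, et, hne⟩ := ih hP ht
      refine ⟨A, .par R Q, M, _, a, _, hA, .par hR hQ, ?_, sA, .par sR sQ, by rw [eL, add_assoc],
        fun ρ => ?_, et, hne⟩
      · exact .trans (.par c (.refl _)) (.par_assoc _ _ _)
      · dsimp only; rw [e, add_assoc]
    · obtain ⟨A, R, M, N, a, r, hA, hR, c, sA, sR, eL, e, et, hne⟩ := ih' hQ ht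
      refine ⟨A, .par R P, M, _, a, _, hA, .par hR hP, ?_, sA, .par sR sP, ?_, fun ρ => ?_, et, hne⟩
      · exact .trans (.par_comm _ _) (.trans (.par c (.refl _)) (.par_assoc _ _ _))
      · rw [eL, add_left_comm, add_comm L']
      · dsimp only; rw [e, add_left_comm, add_comm (h ρ)]

/-- A communication of the behaviour of a process is a reduction of the process. -/
theorem Sem.reflect {P : Proc 𝒩} {L h} (hS : Sem P L h) (hL : L.Nodup) {q : Beh (Nm 𝒩)}
    (hq : Beh.Comm (h .inl) q) : ∃ P' k, Red P P' ∧ Sem P' L k ∧ k .inl = q := by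
  obtain ⟨l, Q, M, k, hQ, cQ, sQ, eL, e, -⟩ := hS.exists_flat ∅
  have hinj : Function.Injective (label l (.inl : 𝒩 → Nm 𝒩)) := by
    refine injective_label ?_ Sum.inl_injective (by simp)
    rw [eL, Multiset.nodup_add] at hL
    exact Multiset.coe_nodup.1 hL.1
  rw [e] at hq
  set ρ := label l (.inl : 𝒩 → Nm 𝒩)
  generalize hp : k ρ = p at hq
  obtain ⟨n, x, zs, f, r⟩ := hq
  -- the sender and the receiver are separate components of the flat process
  have hp' := congrArg Beh.threads hp
  simp only [Beh.threads_add, Beh.threads_send, Beh.threads_recv] at hp'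
  obtain ⟨A, R, MA, MR, a, b, hA, hR, c, sA, sR, eM, ek, et, hne⟩ :=
    sQ.exists_component hQ (ρ := ρ) (t := .send x zs) (by rw [hp']; simp)
  rw [ek, Beh.threads_add, et, add_assoc] at hp'
  have hp' := add_left_cancel hp'
  obtain ⟨A', R', MA', MR', a', b', hA', hR', c', sA', sR', eM', ek', et', hne'⟩ :=
    sR.exists_component hR (ρ := ρ) (t := .recv n x f) (by rw [hp']; simp)
  rw [ek', Beh.threads_add, et'] at hp'
  have hr : b' ρ = r := Beh.threads_injective (add_left_cancel hp')
  -- a component that is neither a parallel composition nor a restriction is an output or an input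
  cases sA with
  | nil => simp at et
  | inp => simp at et
  | new => cases hA
  | par => exact (hne _ _ rfl).elim
  | out x₁ zs₁ =>
  cases sA' with
  | nil => simp at et'
  | out => simp at et'
  | new => cases hA'
  | par => exact (hne' _ _ rfl).elim
  | @inp x₂ ys hys B _ g sB =>
  simp only [Beh.threads_send, Multiset.singleton_inj, Thread.send.injEq] at et
  simp only [Beh.threads_recv, Multiset.singleton_inj, Thread.recv.injEq] at et'
  obtain ⟨ex, ezs⟩ := et
  obtain ⟨rfl, ex', ef⟩ := et'
  -- equal values of the channels come from equal names, by the choice of distinct labels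
  obtain rfl : x₁ = x₂ := hinj (ex.trans ex'.symm)
  have hlen : ys.length = zs₁.length := by rw [← zs.2, ← ezs, List.length_map]
  obtain ⟨g', sg, eg⟩ := sB.rename (assign ys zs₁ id)
  refine ⟨PiModel.news l (.par (B.subst zs₁ ys) R'),
    fun σ => g' (label l σ) + b' (label l σ), ?_, ?_, ?_⟩
  rotate_left 1
  · have := (Sem.par sg sR').news l
    rw [eL, eM, eM', zero_add]
    exact this
  · refine congrArg₂ (· + ·) ?_ hr
    rw [eg, comp_assign, ezs, ← eq_of_heq ef]
    rfl
  · refine .equiv cQ (red_news l (.equiv (P' := .par (.par (.inp x₁ ys hys B) (.out x₁ zs₁)) R') ?_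
      (.par R' (.comm x₁ ys hys B zs₁ hlen)) (.refl _))) (.refl _)
    refine .trans c (.trans (.par (.refl _) c') (.trans (.symm (.par_assoc _ _ _)) ?_))
    exact .par (.par_comm _ _) (.refl _)

end PiModel

/-! ### Cocommutative comonoids in a symmetric monoidal category -/

namespace CocommComon

open ComonObj Opposite

universe v w

section Monoidal

variable {C : Type w} [Category.{v} C] [MonoidalCategory C]

/-- The projection of a tensor product that discards the second factor. -/
def fst (A B : C) [ComonObj B] : A ⊗ B ⟶ A := (𝟙 A ⊗ₘ ε[B]) ≫ (ρ_ A).hom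

/-- The projection of a tensor product that discards the first factor. -/
def snd (A B : C) [ComonObj A] : A ⊗ B ⟶ B := (ε[A] ⊗ₘ 𝟙 B) ≫ (λ_ B).hom

/-- Tensoring a morphism with a point `a` of another object. -/
def pt {A X Y : C} (a : 𝟙_ C ⟶ A) (h : X ⟶ Y) : X ⟶ A ⊗ Y := (λ_ X).inv ≫ (a ⊗ₘ h)

/-- The action of a scalar on a morphism. -/
def sc {X Y : C} (s : 𝟙_ C ⟶ 𝟙_ C) (f : X ⟶ Y) : X ⟶ Y := pt s f ≫ (λ_ Y).hom

theorem comp_pt {A X Y Z : C} (a : 𝟙_ C ⟶ A) (h : X ⟶ Y) (k : Y ⟶ Z) :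
    h ≫ pt a k = pt a (h ≫ k) := by
  simp only [pt]
  rw [leftUnitor_inv_naturality_assoc, ← id_tensorHom, tensorHom_comp_tensorHom,
    Category.id_comp]

theorem pt_comp {A B X Y Z : C} (a : 𝟙_ C ⟶ A) (f : A ⟶ B) (h : X ⟶ Y) (k : Y ⟶ Z) :
    pt a h ≫ (f ⊗ₘ k) = pt (a ≫ f) (h ≫ k) := by
  simp only [pt]
  rw [Category.assoc, tensorHom_comp_tensorHom]

theorem sc_comp {X Y Z : C} (s : 𝟙_ C ⟶ 𝟙_ C) (f : X ⟶ Y) (g : Y ⟶ Z) :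
    sc s f ≫ g = sc s (f ≫ g) := by
  simp only [sc]
  rw [Category.assoc, ← leftUnitor_naturality, ← id_tensorHom, ← Category.assoc, pt_comp,
    Category.comp_id]

theorem comp_sc {X Y Z : C} (s : 𝟙_ C ⟶ 𝟙_ C) (f : X ⟶ Y) (g : Y ⟶ Z) :
    f ≫ sc s g = sc s (f ≫ g) := by
  simp only [sc]
  rw [← Category.assoc, comp_pt]

/-- Scalars can be moved out of the first factor of a tensor product. -/
theorem sc_tensor {X Y X' Y' : C} (s : 𝟙_ C ⟶ 𝟙_ C) (f : X ⟶ Y) (g : X' ⟶ Y') :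
    sc s f ⊗ₘ g = sc s (f ⊗ₘ g) := by
  have e : sc s (f ⊗ₘ g) = sc s (𝟙 _) ≫ (f ⊗ₘ g) := by rw [sc_comp, Category.id_comp]
  have e' : sc s f = sc s (𝟙 _) ≫ f := by rw [sc_comp, Category.id_comp]
  rw [e, e', ← Category.id_comp g, ← tensorHom_comp_tensorHom, Category.id_comp]
  congr 1
  simp only [sc, pt, tensorHom_id, comp_whiskerRight]
  monoidal

theorem sc_id {X Y : C} (f : X ⟶ Y) : sc (𝟙 _) f = f := by
  simp [sc, pt]

theorem sc_comm {X Y : C} (s t : 𝟙_ C ⟶ 𝟙_ C) (f : X ⟶ Y) : sc s (sc t f) = sc t (sc s f) := by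
  rw [← Category.id_comp (sc t f), ← sc_comp, ← Category.id_comp (sc s f), comp_sc,
    Category.id_comp, sc_comp, Category.id_comp]

theorem sc_sc {X Y : C} (s t : 𝟙_ C ⟶ 𝟙_ C) (f : X ⟶ Y) : sc s (sc t f) = sc (s ≫ t) f := by
  have h : sc s (sc t f) = sc s (𝟙 X) ≫ sc t f := by rw [sc_comp, Category.id_comp]
  rw [h]
  simp only [sc]
  rw [Category.assoc]
  nth_rw 2 [pt]
  rw [Category.assoc, Iso.hom_inv_id_assoc, ← Category.assoc, pt_comp, Category.id_comp]

variable {A B A' B' : C} [ComonObj A] [ComonObj B] [ComonObj A'] [ComonObj B']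

theorem tensor_fst {X Y : C} (f : X ⟶ Y) (g : B ⟶ B') (hg : g ≫ ε[B'] = ε[B]) :
    (f ⊗ₘ g) ≫ fst Y B' = fst X B ≫ f := by
  simp only [fst, Category.assoc]
  rw [← rightUnitor_naturality, tensorHom_comp_tensorHom_assoc, hg, ← tensorHom_id,
    tensorHom_comp_tensorHom_assoc, Category.comp_id, Category.comp_id, Category.id_comp]

theorem tensor_snd {X Y : C} (f : A ⟶ A') (g : X ⟶ Y) (hf : f ≫ ε[A'] = ε[A]) :
    (f ⊗ₘ g) ≫ snd A' Y = snd A X ≫ g := by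
  simp only [snd, Category.assoc]
  rw [← leftUnitor_naturality, tensorHom_comp_tensorHom_assoc, hf, ← id_tensorHom,
    tensorHom_comp_tensorHom_assoc, Category.comp_id, Category.comp_id, Category.id_comp]

variable (A) in
attribute [local instance] ComonObj.instTensorUnit in
theorem isComonHom_counit : IsComonHom ε[A] where
  hom_comul := by simp [unitors_inv_equal]

theorem lift_fst {X : C} (f : A ⟶ X) (g : A ⟶ B) (hg : g ≫ ε[B] = ε[A]) :
    Δ[A] ≫ (f ⊗ₘ g) ≫ fst X B = f := by
  rw [tensor_fst f g hg, fst]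
  simp

theorem lift_snd {X : C} (f : A ⟶ B) (g : A ⟶ X) (hf : f ≫ ε[B] = ε[A]) :
    Δ[A] ≫ (f ⊗ₘ g) ≫ snd B X = g := by
  rw [tensor_snd f g hf, snd]
  simp

theorem assoc_snd_tensor (X Y : C) : (α_ A X Y).hom ≫ snd A (X ⊗ Y) = snd A X ⊗ₘ 𝟙 Y := by
  simp only [snd]
  monoidal

/-- Coassociativity, for the pairing `Δ ≫ (f ⊗ₘ g)`. -/
theorem comul_assoc_tensor {X Y Z : C} (f : A ⟶ X) (g : A ⟶ Y) (h : A ⟶ Z) :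
    Δ[A] ≫ ((Δ[A] ≫ (f ⊗ₘ g)) ⊗ₘ h) ≫ (α_ X Y Z).hom = Δ[A] ≫ (f ⊗ₘ (Δ[A] ≫ (g ⊗ₘ h))) := by
  have e1 : (Δ[A] ≫ (f ⊗ₘ g)) ⊗ₘ h = (Δ[A] ▷ A) ≫ ((f ⊗ₘ g) ⊗ₘ h) := by
    rw [← tensorHom_id, tensorHom_comp_tensorHom, Category.id_comp]
  have e2 : f ⊗ₘ (Δ[A] ≫ (g ⊗ₘ h)) = (A ◁ Δ[A]) ≫ (f ⊗ₘ (g ⊗ₘ h)) := by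
    rw [← id_tensorHom, tensorHom_comp_tensorHom, Category.id_comp]
  rw [e1, e2, Category.assoc, associator_naturality, ComonObj.comul_assoc_assoc]

theorem lift_tensor_fst {D X : C} [ComonObj D] (f : D ⟶ X) (g : D ⟶ A) (c : A ⟶ B)
    [IsComonHom g] [IsComonHom c] :
    (Δ[D] ≫ (f ⊗ₘ g)) ≫ (𝟙 X ⊗ₘ c) ≫ fst X B = f := by
  rw [tensor_fst _ _ (IsComonHom.hom_counit _), Category.assoc, Category.comp_id,
    lift_fst _ _ (IsComonHom.hom_counit _)]

theorem lift_tensor_snd {D X Y V : C} [ComonObj D] (f : D ⟶ A) (g : D ⟶ X) (c : X ⟶ Y)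
    (r : Y ⟶ V) [IsComonHom f] :
    (Δ[D] ≫ (f ⊗ₘ g)) ≫ (𝟙 A ⊗ₘ c) ≫ snd A Y ≫ r = g ≫ c ≫ r := by
  have e := tensor_snd (𝟙 A) c (Category.id_comp _)
  rw [reassoc_of% e, ← Category.assoc, Category.assoc Δ[D], lift_snd _ _ (IsComonHom.hom_counit _)]

theorem assoc_tensor_snd_of_fst {X Z V : C} {j : X ⊗ A ⟶ Z} {r : Z ⟶ V} {q : X ⟶ V}
    (h : j ≫ r = fst X A ≫ q) :
    ((α_ B X A).hom ≫ (𝟙 B ⊗ₘ j)) ≫ snd B Z ≫ r = fst (B ⊗ X) A ≫ snd B X ≫ q := by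
  have e := tensor_snd (𝟙 B) j (Category.id_comp _)
  rw [Category.assoc, reassoc_of% e, h, ← Category.assoc, assoc_snd_tensor, ← Category.assoc,
    tensor_fst _ _ (Category.id_comp _), Category.assoc]

theorem comp_comul_tensor {D E X Y Z : C} [ComonObj D] [ComonObj E] (w : D ⟶ E) [IsComonHom w]
    (f : E ⟶ X) (g : E ⟶ Y) (k : X ⊗ Y ⟶ Z) :
    w ≫ Δ ≫ (f ⊗ₘ g) ≫ k = Δ ≫ (w ≫ f ⊗ₘ w ≫ g) ≫ k := by
  rw [IsComonHom.hom_comul_assoc, tensorHom_comp_tensorHom_assoc]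

theorem comp_comul_tensor_of_eq {D E X Y Z : C} [ComonObj D] [ComonObj E] (w : D ⟶ E)
    [IsComonHom w] {f : E ⟶ X} {g : E ⟶ Y} {f' : D ⟶ X} {g' : D ⟶ Z} {c : Z ⟶ Y}
    (hf : w ≫ f = f') (hg : w ≫ g = g' ≫ c) :
    w ≫ Δ ≫ (f ⊗ₘ g) = (Δ ≫ (f' ⊗ₘ g')) ≫ (𝟙 X ⊗ₘ c) := by
  rw [IsComonHom.hom_comul_assoc, tensorHom_comp_tensorHom, hf, hg, Category.assoc,
    tensorHom_comp_tensorHom, Category.comp_id]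

theorem comp_pt_id {D X Y Z : C} (w : X ⟶ Y) (a : 𝟙_ C ⟶ D) (k : D ⊗ Y ⟶ Z) :
    w ≫ pt a (𝟙 Y) ≫ k = pt a (𝟙 X) ≫ (𝟙 D ⊗ₘ w) ≫ k := by
  rw [← Category.assoc, comp_pt, ← Category.assoc, pt_comp, Category.comp_id, Category.comp_id,
    Category.id_comp]

theorem pt_snd {X Y : C} (a : 𝟙_ C ⟶ A) (h : X ⟶ Y) : pt a h ≫ snd A Y = sc (a ≫ ε[A]) h := by
  rw [snd, ← Category.assoc, pt_comp, Category.comp_id, sc]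

theorem isComonHom_comp {D : C} [ComonObj D] (f : D ⟶ A) (g : A ⟶ B) [IsComonHom f]
    [IsComonHom g] : IsComonHom (f ≫ g) := inferInstance

end Monoidal

section Symmetric

variable {C : Type w} [Category.{v} C] [MonoidalCategory C] [SymmetricCategory C]

/-- The exchange of the first two factors of a triple tensor product. -/
def swap (A B D : C) : A ⊗ (B ⊗ D) ⟶ B ⊗ (A ⊗ D) :=
  (α_ A B D).inv ≫ ((β_ A B).hom ⊗ₘ 𝟙 D) ≫ (α_ B A D).hom

theorem pt_swap {A B X Y : C} (a : 𝟙_ C ⟶ A) (b : 𝟙_ C ⟶ B) (h : X ⟶ Y) :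
    pt a (pt b h) ≫ swap A B Y = pt b (pt a h) := by
  have e : ∀ {A B : C} (a : 𝟙_ C ⟶ A) (b : 𝟙_ C ⟶ B), pt a (pt b h) =
      (λ_ X).inv ≫ ((λ_ (𝟙_ C)).inv ⊗ₘ 𝟙 X) ≫ ((a ⊗ₘ b) ⊗ₘ h) ≫ (α_ A B Y).hom := by
    intro A B a b
    simp only [pt]
    rw [associator_naturality]
    have : (a ⊗ₘ (λ_ X).inv ≫ (b ⊗ₘ h)) = (𝟙 _ ⊗ₘ (λ_ X).inv) ≫ (a ⊗ₘ (b ⊗ₘ h)) := by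
      rw [tensorHom_comp_tensorHom, Category.id_comp]
    rw [this, ← Category.assoc, ← Category.assoc, ← Category.assoc]
    congr 1
    monoidal
  rw [e, e, swap]
  simp only [Category.assoc, Iso.hom_inv_id_assoc]
  congr 2
  rw [tensorHom_comp_tensorHom_assoc, BraidedCategory.braiding_naturality,
    braiding_tensorUnit_left, unitors_equal, Iso.hom_inv_id, Category.id_comp, Category.comp_id]

/-- Scalars can be moved out of the second factor of a tensor product. -/
theorem tensor_sc {X Y X' Y' : C} (s : 𝟙_ C ⟶ 𝟙_ C) (f : X ⟶ Y) (g : X' ⟶ Y') :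
    f ⊗ₘ sc s g = sc s (f ⊗ₘ g) := by
  have e : ∀ h : X' ⟶ Y', f ⊗ₘ h = (β_ _ _).hom ≫ (h ⊗ₘ f) ≫ (β_ _ _).hom := by
    intro h
    rw [BraidedCategory.braiding_naturality, SymmetricCategory.symmetry_assoc]
  rw [e, e, sc_tensor, sc_comp, comp_sc]

theorem pt_sc {A X Y : C} (s : 𝟙_ C ⟶ 𝟙_ C) (a : 𝟙_ C ⟶ A) (h : X ⟶ Y) :
    pt a (sc s h) = sc s (pt a h) := by
  simp only [pt]
  rw [tensor_sc, comp_sc]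

theorem braiding_fst (A B : C) [ComonObj A] : (β_ A B).hom ≫ fst B A = snd A B := by
  simp only [fst, snd]
  rw [← BraidedCategory.braiding_naturality_assoc, braiding_rightUnitor]

theorem braiding_snd (A B : C) [ComonObj B] : (β_ A B).hom ≫ snd B A = fst A B := by
  simp only [fst, snd]
  rw [← BraidedCategory.braiding_naturality_assoc, braiding_leftUnitor]

theorem swap_snd (A B D : C) [ComonObj B] :
    swap A B D ≫ snd B (A ⊗ D) = (α_ A B D).inv ≫ (fst A B ⊗ₘ 𝟙 D) := by
  simp only [swap, Category.assoc]
  rw [assoc_snd_tensor, tensorHom_comp_tensorHom, braiding_snd, Category.comp_id]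

variable {A B A' B' D : C} [ComonObj A] [ComonObj B] [ComonObj A'] [ComonObj B'] [ComonObj D]

theorem isComonHom_tensorHom (f : A ⟶ A') (g : B ⟶ B') [IsComonHom f] [IsComonHom g] :
    IsComonHom (f ⊗ₘ g) where
  hom_counit := by simp [Comon.tensorObj_counit, tensorHom_comp_tensorHom_assoc]
  hom_comul := by
    simp only [Comon.tensorObj_comul, tensorHom_comp_tensorHom_assoc, Category.assoc,
      IsComonHom.hom_comul]
    rw [← tensorHom_comp_tensorHom_assoc, tensorμ_natural]

variable (A B D) in
theorem isComonHom_associator : IsComonHom (α_ A B D).hom where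
  hom_counit := by
    simp only [Comon.tensorObj_counit]
    monoidal
  hom_comul := by
    have e1 : Δ[(A ⊗ B) ⊗ D] = ((Δ[A] ⊗ₘ Δ[B]) ⊗ₘ Δ[D]) ≫ (tensorμ A A B B ▷ (D ⊗ D)) ≫
        tensorμ (A ⊗ B) (A ⊗ B) D D := by
      rw [Comon.tensorObj_comul, Comon.tensorObj_comul, ← Category.assoc, ← tensorHom_id,
        tensorHom_comp_tensorHom, Category.comp_id]
    have e2 : Δ[A ⊗ (B ⊗ D)] = (Δ[A] ⊗ₘ (Δ[B] ⊗ₘ Δ[D])) ≫ ((A ⊗ A) ◁ tensorμ B B D D) ≫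
        tensorμ A A (B ⊗ D) (B ⊗ D) := by
      rw [Comon.tensorObj_comul, Comon.tensorObj_comul, ← Category.assoc, ← id_tensorHom,
        tensorHom_comp_tensorHom, Category.comp_id]
    rw [e1, e2, Category.assoc, Category.assoc, tensor_associativity, associator_naturality_assoc]

variable (A) in
attribute [local instance] ComonObj.instTensorUnit in
theorem isComonHom_leftUnitor : IsComonHom (λ_ A).hom where
  hom_counit := by simp
  hom_comul := by
    rw [Comon.tensorObj_comul, instTensorUnit_comul, tensorHom_def', Category.assoc,
      Category.assoc, ← tensor_left_unitality, leftUnitor_naturality]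

variable (A) in
attribute [local instance] ComonObj.instTensorUnit in
theorem isComonHom_rightUnitor : IsComonHom (ρ_ A).hom where
  hom_counit := by simp [unitors_equal]
  hom_comul := by
    rw [Comon.tensorObj_comul, instTensorUnit_comul, tensorHom_def Δ[A], Category.assoc,
      Category.assoc, ← tensor_right_unitality, rightUnitor_naturality]

variable (C) in
/-- The opposite of a symmetric monoidal category is symmetric. -/
abbrev symmetricCategoryOp : SymmetricCategory Cᵒᵖ where
  symmetry X Y := Quiver.Hom.unop_inj (SymmetricCategory.symmetry X.unop Y.unop)

variable (A B) in
/-- The statement is dual to the corresponding one about monoids in the opposite category. -/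
theorem isComonHom_braiding : IsComonHom (β_ A B).hom where
  hom_counit := by
    simp only [Comon.tensorObj_counit]
    rw [← Category.assoc, ← BraidedCategory.braiding_naturality, Category.assoc,
      braiding_leftUnitor, unitors_equal]
  hom_comul := by
    let _ : MonObj (op A) := Comon.ComonToMonOpOpObjMon (.mk A)
    let _ : MonObj (op B) := Comon.ComonToMonOpOpObjMon (.mk B)
    let _ : SymmetricCategory Cᵒᵖ := symmetricCategoryOp C
    exact congrArg Quiver.Hom.unop (MonObj.mul_braiding (op B) (op A))

variable (A) in
/-- Duplication is a morphism of comonoids because `A` is cocommutative. The statement is dual to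
the corresponding one about monoids in the opposite category. -/
theorem isComonHom_comul [IsCommComonObj A] : IsComonHom Δ[A] where
  hom_counit := by simp [unitors_equal]
  hom_comul := by
    let _ : MonObj (op A) := Comon.ComonToMonOpOpObjMon (.mk A)
    have : IsCommMonObj (op A) := ⟨Quiver.Hom.unop_inj (IsCommComonObj.comul_comm A)⟩
    have h := congrArg Quiver.Hom.unop (MonObj.mul_mul_mul_comm (op A))
    simp only [unop_comp, BraidedCategory.unop_tensorμ, Category.assoc] at h
    rw [Comon.tensorObj_comul]
    exact h

attribute [local instance] ComonObj.instTensorUnit in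
variable (A B) in
theorem isComonHom_fst : IsComonHom (fst A B) := by
  have := isComonHom_counit B
  have := isComonHom_tensorHom (𝟙 A) ε[B]
  have := isComonHom_rightUnitor A
  rw [fst]
  infer_instance

attribute [local instance] ComonObj.instTensorUnit in
variable (A B) in
theorem isComonHom_snd : IsComonHom (snd A B) := by
  have := isComonHom_counit A
  have := isComonHom_tensorHom ε[A] (𝟙 B)
  have := isComonHom_leftUnitor B
  rw [snd]
  infer_instance

variable (A B D) in
theorem isComonHom_swap : IsComonHom (swap A B D) := by
  have := isComonHom_associator A B D
  have := isComonHom_associator B A D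
  have := isComonHom_braiding A B
  have := isComonHom_tensorHom (β_ A B).hom (𝟙 D)
  rw [swap]
  infer_instance

/-- The pairing of two comonoid morphisms out of a cocommutative comonoid is one. -/
theorem isComonHom_lift [IsCommComonObj D] (f : D ⟶ A) (g : D ⟶ B) [IsComonHom f]
    [IsComonHom g] : IsComonHom (Δ[D] ≫ (f ⊗ₘ g)) := by
  have := isComonHom_comul D
  have := isComonHom_tensorHom f g
  infer_instance

theorem assoc_fst (X : C) : (α_ X A B).hom ≫ fst X (A ⊗ B) = fst (X ⊗ A) B ≫ fst X A := by
  simp only [fst, Comon.tensorObj_counit, MonoidalCategory.tensorHom_def']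
  monoidal

theorem assoc_snd (X : C) : (α_ A B X).hom ≫ snd A (B ⊗ X) ≫ snd B X = snd (A ⊗ B) X := by
  simp only [snd, Comon.tensorObj_counit, MonoidalCategory.tensorHom_def]
  monoidal

theorem assoc_tensor_fst (B : C) {X Z : C} (j : X ⊗ A ⟶ Z) [ComonObj X] [ComonObj Z] [IsComonHom j] :
    ((α_ B X A).hom ≫ (𝟙 B ⊗ₘ j)) ≫ fst B Z = fst (B ⊗ X) A ≫ fst B X := by
  rw [Category.assoc, tensor_fst _ _ (IsComonHom.hom_counit _), Category.comp_id, assoc_fst]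

theorem assoc_tensor_snd_of_snd {X Y Z V : C} [ComonObj X] {j : X ⊗ Y ⟶ Z} {r : Z ⟶ V}
    {q : Y ⟶ V} (h : j ≫ r = snd X Y ≫ q) :
    ((α_ B X Y).hom ≫ (𝟙 B ⊗ₘ j)) ≫ snd B Z ≫ r = snd (B ⊗ X) Y ≫ q := by
  have e := tensor_snd (𝟙 B) j (Category.id_comp _)
  rw [Category.assoc, reassoc_of% e, h, ← assoc_snd, Category.assoc, Category.assoc]

/-- Duplicating `A ⊗ B` and discarding the second copy of `A` duplicates `B` only. -/
theorem comul_tensor_snd :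
    Δ[A ⊗ B] ≫ (𝟙 (A ⊗ B) ⊗ₘ snd A B) = (𝟙 A ⊗ₘ Δ[B]) ≫ (α_ A B B).inv := by
  have e : (𝟙 (A ⊗ B) ⊗ₘ snd A B) =
      ((𝟙 A ⊗ₘ 𝟙 B) ⊗ₘ (ε[A] ⊗ₘ 𝟙 B)) ≫ (𝟙 (A ⊗ B) ⊗ₘ (λ_ B).hom) := by
    rw [tensorHom_comp_tensorHom, id_tensorHom_id, Category.id_comp, snd]
  rw [e, Comon.tensorObj_comul, Category.assoc, ← tensorμ_natural_assoc,
    tensorHom_comp_tensorHom_assoc, id_tensorHom A ε, ComonObj.comul_counit, id_tensorHom_id,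
    Category.comp_id, ← Category.id_comp (ρ_ A).inv, ← Category.comp_id Δ[B],
    ← tensorHom_comp_tensorHom, Category.assoc]
  congr 1
  · rw [Category.comp_id]
  · simp only [tensorμ, braiding_tensorUnit_left]
    monoidal

theorem swap_fst (A B D : C) [ComonObj A] [ComonObj D] :
    swap A B D ≫ fst B (A ⊗ D) = snd A (B ⊗ D) ≫ fst B D := by
  simp only [swap, Category.assoc]
  rw [assoc_fst, ← Category.assoc ((β_ A B).hom ⊗ₘ 𝟙 D), tensor_fst _ _ (Category.id_comp _),
    Category.assoc, braiding_fst, Iso.inv_comp_eq, ← Category.assoc (α_ A B D).hom,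
    assoc_snd_tensor, tensor_fst _ _ (Category.id_comp _)]

theorem swap_snd_fst (A B D : C) [ComonObj B] [ComonObj D] :
    swap A B D ≫ snd B (A ⊗ D) ≫ fst A D = fst A (B ⊗ D) := by
  rw [← Category.assoc, swap_snd, Category.assoc, tensor_fst _ _ (Category.id_comp _),
    Iso.inv_comp_eq, assoc_fst]

theorem swap_snd_snd (A B D : C) [ComonObj A] [ComonObj B] :
    swap A B D ≫ snd B (A ⊗ D) ≫ snd A D = snd A (B ⊗ D) ≫ snd B D := by
  have := isComonHom_fst A B
  rw [← Category.assoc, swap_snd, Category.assoc, tensor_snd _ _ (IsComonHom.hom_counit _),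
    Category.comp_id, Iso.inv_comp_eq, assoc_snd]

theorem comul_swap {X Y : C} [IsCommComonObj A] (f : A ⟶ X) (g : A ⟶ Y) :
    Δ[A] ≫ (f ⊗ₘ g) ≫ (β_ X Y).hom = Δ[A] ≫ (g ⊗ₘ f) := by
  rw [BraidedCategory.braiding_naturality, IsCommComonObj.comul_comm_assoc]

/-- A morphism of comonoids followed by duplication can be computed twice instead; here the two
copies of `f` are paired with `g` and with `h`. -/
theorem comul_distrib {X Y : C} [IsCommComonObj A] (f : A ⟶ B) [IsComonHom f]
    (g : A ⟶ X) (h : A ⟶ Y) :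
    Δ[A] ≫ (f ⊗ₘ (Δ[A] ≫ (g ⊗ₘ h))) ≫ (Δ[B] ⊗ₘ 𝟙 (X ⊗ Y)) ≫ tensorμ B B X Y =
      Δ[A] ≫ ((Δ[A] ≫ (f ⊗ₘ g)) ⊗ₘ (Δ[A] ≫ (f ⊗ₘ h))) := by
  have h1 := (isComonHom_comul A).hom_comul
  rw [Comon.tensorObj_comul] at h1
  rw [tensorHom_comp_tensorHom_assoc, IsComonHom.hom_comul, Category.comp_id,
    ← tensorHom_comp_tensorHom_assoc, tensorμ_natural, ← tensorHom_comp_tensorHom,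
    ← Category.assoc, ← Category.assoc, ← Category.assoc]
  congr 1
  exact (Category.assoc _ _ _).trans h1

/-- Of two points supplied in succession, one is discarded: it becomes a scalar. -/
theorem pt_pt_snd {X Y : C} (a : 𝟙_ C ⟶ A) (k : A ⊗ X ⟶ Y) :
    pt a (𝟙 X) ≫ pt a (𝟙 (A ⊗ X)) ≫ (𝟙 A ⊗ₘ snd A X) ≫ k = sc (a ≫ ε[A]) (pt a (𝟙 X) ≫ k) := by
  rw [← Category.assoc, comp_pt, Category.comp_id, ← Category.assoc, pt_comp, Category.comp_id,
    pt_snd, pt_sc, sc_comp]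

/-- Two points can be supplied in either order. -/
theorem pt_pt_swap {D E X Y : C} (a : 𝟙_ C ⟶ D) (b : 𝟙_ C ⟶ E) (k : D ⊗ (E ⊗ X) ⟶ Y) :
    pt a (𝟙 X) ≫ pt b (𝟙 (D ⊗ X)) ≫ swap E D X ≫ k =
      pt b (𝟙 X) ≫ pt a (𝟙 (E ⊗ X)) ≫ k := by
  rw [← Category.assoc, comp_pt, Category.comp_id, ← Category.assoc, pt_swap,
    ← Category.assoc (pt b (𝟙 X)), comp_pt, Category.comp_id]

/-- A point supplied before duplication may be supplied to one copy only if the other copy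
discards it. -/
theorem comul_pt {X Y Z : C} (a : 𝟙_ C ⟶ A) (p : A ⊗ B ⟶ X) (q : B ⟶ Y) (r : X ⊗ Y ⟶ Z) :
    Δ[B] ≫ ((pt a (𝟙 B) ≫ p) ⊗ₘ q) ≫ r =
      pt a (𝟙 B) ≫ Δ[A ⊗ B] ≫ (p ⊗ₘ (snd A B ≫ q)) ≫ r := by
  have e1 : (p ⊗ₘ (snd A B ≫ q)) = (𝟙 _ ⊗ₘ snd A B) ≫ (p ⊗ₘ q) := by
    rw [tensorHom_comp_tensorHom, Category.id_comp]
  have e2 : ((pt a (𝟙 B) ≫ p) ⊗ₘ q) = (pt a (𝟙 B) ⊗ₘ 𝟙 B) ≫ (p ⊗ₘ q) := by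
    rw [tensorHom_comp_tensorHom, Category.id_comp]
  have e3 : pt a (𝟙 B) ⊗ₘ 𝟙 B = pt a (𝟙 (B ⊗ B)) ≫ (α_ A B B).inv := by
    simp only [pt]
    monoidal
  rw [e1, e2, e3]
  simp only [← Category.assoc]
  rw [comp_pt, Category.assoc (pt a (𝟙 B)), comul_tensor_snd, ← Category.assoc (pt a (𝟙 B)),
    pt_comp, Category.comp_id, Category.comp_id, Category.id_comp]

end Symmetric

end CocommComon

/-! ### Wires as morphisms of comonoids -/

namespace PiTheory

open ComonObj CocommComon PiCalc

variable {𝒩 : Type u}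

instance : ComonObj (Ob.N : Ob 𝒩) where
  counit := del
  comul := dup
  counit_comul := mk_eq .del_dup
  comul_counit := mk_eq .dup_del
  comul_assoc := (mk_eq .dup_assoc).symm

instance : IsCommComonObj (Ob.N : Ob 𝒩) where
  comul_comm := mk_eq .dup_comm

/-- The tensor powers of `N` as comonoids, with the componentwise structure. -/
instance powComonObj : (k : ℕ) → ComonObj (pow 𝒩 k)
  | 0 => ComonObj.instTensorUnit (Ob 𝒩)
  | k + 1 =>
    have := powComonObj k
    inferInstanceAs (ComonObj ((Ob.N : Ob 𝒩) ⊗ pow 𝒩 k))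

theorem delPow_eq (k : ℕ) : delPow (𝒩 := 𝒩) k = ε[pow 𝒩 k] := by
  induction k with
  | zero => rfl
  | succ k ih => rw [delPow, ih]; rfl

theorem dupPow_eq (k : ℕ) : dupPow (𝒩 := 𝒩) k = Δ[pow 𝒩 k] := by
  induction k with
  | zero => rfl
  | succ k ih =>
    rw [dupPow, ih]
    exact (Comon.tensorObj_comul Ob.N (pow 𝒩 k)).symm

instance powIsComm (k : ℕ) : IsCommComonObj (pow 𝒩 k) := by
  induction k with
  | zero => exact CommComon.instCommComonObjUnit
  | succ k ih => exact inferInstanceAs (IsCommComonObj ((Ob.N : Ob 𝒩) ⊗ pow 𝒩 k))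

/-- The identification of two tensor powers of equal exponents. -/
def castPow {m n : ℕ} (h : m = n) : pow 𝒩 m ⟶ pow 𝒩 n := eqToHom (by rw [h])

instance {m n : ℕ} (h : m = n) : IsComonHom (castPow (𝒩 := 𝒩) h) := by
  subst h
  exact inferInstanceAs (IsComonHom (𝟙 _))

theorem castPow_succ {m n : ℕ} (h : m = n) (h' : m + 1 = n + 1) :
    castPow (𝒩 := 𝒩) h' = (𝟙 Ob.N ⊗ₘ castPow h : Ob.N ⊗ pow 𝒩 m ⟶ Ob.N ⊗ pow 𝒩 n) := by
  subst h
  exact (id_tensorHom_id (C := Ob 𝒩) _ _).symm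

theorem castPow_send {m n : ℕ} (h : m = n) :
    (𝟙 Ob.N ⊗ₘ castPow (𝒩 := 𝒩) h) ≫ send n = send m := by
  subst h
  rw [castPow, eqToHom_refl, id_tensorHom_id, Category.id_comp]

theorem comp_curry {A X Y Z : Ob 𝒩} (w : X ⟶ Y) (g : A ⊗ Y ⟶ Z) :
    w ≫ curry g = curry ((𝟙 A ⊗ₘ w) ≫ g) := by
  rw [← curry_eta (w ≫ curry g), ← Category.id_comp (𝟙 A), ← tensorHom_comp_tensorHom,
    Category.assoc, curry_beta, Category.id_comp]

/-- Inputs are compatible with the identification of arities that are only propositionally equal. -/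
theorem castPow_recv {m n : ℕ} (h : m = n) {X : Ob 𝒩} (f : X ⟶ Ob.N)
    (A : Ob 𝒩) (g : pow 𝒩 n ⊗ A ⟶ Ob.P) :
    (f ⊗ₘ curry g) ≫ recv n = (f ⊗ₘ curry ((castPow h ⊗ₘ 𝟙 _) ≫ g)) ≫ recv m := by
  subst h
  rw [castPow, eqToHom_refl, id_tensorHom_id, Category.id_comp]

theorem isComonHom_join (ys Γ : List 𝒩) : IsComonHom (join ys Γ) := by
  induction ys with
  | nil => exact isComonHom_leftUnitor _
  | cons y ys ih =>
    have h1 := isComonHom_associator Ob.N (pow 𝒩 ys.length) (pow 𝒩 Γ.length)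
    have h2 : IsComonHom (𝟙 (Ob.N : Ob 𝒩) ⊗ₘ join ys Γ) := isComonHom_tensorHom _ _
    exact inferInstanceAs (IsComonHom
      ((α_ Ob.N (pow 𝒩 ys.length) (pow 𝒩 Γ.length)).hom ≫ (𝟙 Ob.N ⊗ₘ join ys Γ)))

theorem isIso_join (ys Γ : List 𝒩) : IsIso (join ys Γ) := by
  induction ys with
  | nil => exact inferInstanceAs (IsIso (λ_ _).hom)
  | cons y ys ih =>
    exact inferInstanceAs (IsIso
      ((α_ Ob.N (pow 𝒩 ys.length) (pow 𝒩 Γ.length)).hom ≫ (𝟙 Ob.N ⊗ₘ join ys Γ)))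

/-- The action of `w` under a binder of the names `ys`, renamed to `ws`. -/
noncomputable def shift {ys ws Γ Γ' : List 𝒩} (hl : ys.length = ws.length)
    (w : pow 𝒩 Γ.length ⟶ pow 𝒩 Γ'.length) :
    pow 𝒩 (ws ++ Γ).length ⟶ pow 𝒩 (ys ++ Γ').length :=
  have := isIso_join ws Γ
  inv (join ws Γ) ≫ (castPow hl.symm ⊗ₘ w) ≫ join ys Γ'

theorem join_shift {ys ws Γ Γ' : List 𝒩} (hl : ys.length = ws.length)
    (w : pow 𝒩 Γ.length ⟶ pow 𝒩 Γ'.length) :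
    join ws Γ ≫ shift hl w = (castPow hl.symm ⊗ₘ w) ≫ join ys Γ' := by
  have := isIso_join ws Γ
  rw [shift, IsIso.hom_inv_id_assoc]

theorem isComonHom_shift {ys ws Γ Γ' : List 𝒩} (hl : ys.length = ws.length)
    (w : pow 𝒩 Γ.length ⟶ pow 𝒩 Γ'.length) [IsComonHom w] : IsComonHom (shift hl w) := by
  have := isIso_join ws Γ
  have := isComonHom_join ws Γ
  have := isComonHom_join ys Γ'
  have := isComonHom_tensorHom (castPow (𝒩 := 𝒩) hl.symm) w
  rw [shift]
  infer_instance

section Wires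

variable [DecidableEq 𝒩]

theorem wire_cons_self (Γ : List 𝒩) (x : 𝒩) :
    wire (x :: Γ) x = fst Ob.N (pow 𝒩 Γ.length) := by
  rw [wire, if_pos rfl, delPow_eq]; rfl

theorem wire_cons_ne {x y : 𝒩} (h : x ≠ y) (Γ : List 𝒩) :
    wire (y :: Γ) x = snd Ob.N (pow 𝒩 Γ.length) ≫ wire Γ x := by
  rw [wire, if_neg h, snd, Category.assoc, ← leftUnitor_naturality, ← id_tensorHom,
    tensorHom_comp_tensorHom_assoc, Category.comp_id, Category.id_comp]; rfl

theorem isComonHom_wire {Γ : List 𝒩} {x : 𝒩} (h : x ∈ Γ) : IsComonHom (wire Γ x) := by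
  induction Γ with
  | nil => simp at h
  | cons y Γ ih =>
    by_cases hxy : x = y
    · subst hxy
      rw [wire_cons_self]
      exact isComonHom_fst _ _
    · rw [wire_cons_ne hxy]
      have := ih (by simpa [hxy] using h)
      have := isComonHom_snd (Ob.N : Ob 𝒩) (pow 𝒩 Γ.length)
      exact inferInstanceAs (IsComonHom (snd Ob.N (pow 𝒩 Γ.length) ≫ wire Γ x))

theorem wires_cons (Γ : List 𝒩) (z : 𝒩) (zs : List 𝒩) :
    wires Γ (z :: zs) = (Δ ≫ (wire Γ z ⊗ₘ wires Γ zs) : pow 𝒩 Γ.length ⟶ Ob.N ⊗ pow 𝒩 zs.length) := by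
  rw [wires, dupPow_eq]; rfl

theorem isComonHom_wires {Γ zs : List 𝒩} (h : ∀ z ∈ zs, z ∈ Γ) : IsComonHom (wires Γ zs) := by
  induction zs with
  | nil =>
    rw [wires, delPow_eq]
    exact isComonHom_counit _
  | cons z zs ih =>
    rw [wires_cons]
    have := isComonHom_wire (h z (by simp))
    have := ih fun z hz => h z (by simp [hz])
    exact isComonHom_lift _ _

/-- A name bound by `ys` is projected out of the first tuple. -/
theorem join_wire_mem {ys : List 𝒩} (Γ : List 𝒩) {v : 𝒩} (h : v ∈ ys) :
    join ys Γ ≫ wire (ys ++ Γ) v = fst (pow 𝒩 ys.length) (pow 𝒩 Γ.length) ≫ wire ys v := by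
  induction ys with
  | nil => simp at h
  | cons y ys ih =>
    have := isComonHom_join ys Γ
    by_cases hv : v = y
    · subst hv
      have e2 : wire (v :: ys ++ Γ) v = fst Ob.N (pow 𝒩 (ys ++ Γ).length) := wire_cons_self _ _
      refine (congrArg (join (v :: ys) Γ ≫ ·) e2).trans ?_
      rw [wire_cons_self]
      exact assoc_tensor_fst Ob.N (join ys Γ)
    · have e2 : wire (y :: ys ++ Γ) v = snd Ob.N (pow 𝒩 (ys ++ Γ).length) ≫ wire (ys ++ Γ) v :=
        wire_cons_ne hv _
      refine (congrArg (join (y :: ys) Γ ≫ ·) e2).trans ?_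
      rw [wire_cons_ne hv]
      exact assoc_tensor_snd_of_fst (B := Ob.N) (ih (by simpa [hv] using h))

/-- A name not bound by `ys` is projected out of the second tuple. -/
theorem join_wire_notMem {ys : List 𝒩} (Γ : List 𝒩) {v : 𝒩} (h : v ∉ ys) :
    join ys Γ ≫ wire (ys ++ Γ) v = snd (pow 𝒩 ys.length) (pow 𝒩 Γ.length) ≫ wire Γ v := by
  induction ys with
  | nil =>
    let _ : ComonObj (𝟙_ (Ob 𝒩)) := ComonObj.instTensorUnit (Ob 𝒩)
    have e : snd (𝟙_ (Ob 𝒩)) (pow 𝒩 Γ.length) = (λ_ (pow 𝒩 Γ.length)).hom := by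
      rw [snd, ComonObj.instTensorUnit_counit, id_tensorHom_id, Category.id_comp]
    exact congrArg (· ≫ wire Γ v) e.symm
  | cons y ys ih =>
    simp only [List.mem_cons, not_or] at h
    have e2 : wire (y :: ys ++ Γ) v = snd Ob.N (pow 𝒩 (ys ++ Γ).length) ≫ wire (ys ++ Γ) v :=
      wire_cons_ne h.1 _
    refine (congrArg (join (y :: ys) Γ ≫ ·) e2).trans ?_
    exact assoc_tensor_snd_of_snd (B := Ob.N) (ih h.2)

/-- Composing the tuple `zs` with the projection to the position of `v` in `ys` gives the name
that replaces `v`. -/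
theorem wires_wire {ys zs : List 𝒩} (h : ys.length = zs.length) (Γ : List 𝒩)
    (hzs : ∀ z ∈ zs, z ∈ Γ) {v : 𝒩} (hv : v ∈ ys) (σ : 𝒩 → 𝒩) :
    wires Γ zs ≫ castPow h.symm ≫ wire ys v = wire Γ (assign ys zs σ v) := by
  induction ys generalizing zs with
  | nil => simp at hv
  | cons y ys ih =>
    obtain _ | ⟨z, zs⟩ := zs
    · simp at h
    have hl : ys.length = zs.length := by simpa using h
    have e := castPow_succ (𝒩 := 𝒩) hl.symm h.symm
    have hw := isComonHom_wires (Γ := Γ) (zs := zs) fun z hz => hzs z (by simp [hz])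
    have hz := isComonHom_wire (hzs z (by simp))
    refine (congrArg₂ (fun p q => p ≫ q ≫ wire (y :: ys) v) (wires_cons Γ z zs) e).trans ?_
    by_cases hvy : v = y
    · subst hvy
      rw [wire_cons_self, assign, Function.update_self]
      exact lift_tensor_fst (wire Γ z) (wires Γ zs) (castPow hl.symm)
    · rw [wire_cons_ne hvy, assign, Function.update_of_ne hvy,
        ← ih hl (fun z hz => hzs z (by simp [hz])) (by simpa [hvy] using hv)]
      exact lift_tensor_snd (wire Γ z) (wires Γ zs) (castPow hl.symm) (wire ys v)

/-- A name of `ys` and the name replacing it stand at the same position of their lists. -/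
theorem castPow_wire {ys ws : List 𝒩} (hl : ys.length = ws.length) (hws : ws.Nodup)
    {v : 𝒩} (hv : v ∈ ys) (σ : 𝒩 → 𝒩) :
    castPow hl.symm ≫ wire ys v = wire ws (assign ys ws σ v) := by
  induction ys generalizing ws with
  | nil => simp at hv
  | cons y ys ih =>
    obtain _ | ⟨w, ws⟩ := ws
    · simp at hl
    have hl' : ys.length = ws.length := by simpa using hl
    obtain ⟨hw, hws⟩ := List.nodup_cons.1 hws
    refine (congrArg (· ≫ wire (y :: ys) v) (castPow_succ (𝒩 := 𝒩) hl'.symm hl.symm)).trans ?_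
    by_cases hvy : v = y
    · subst hvy
      rw [wire_cons_self, assign, Function.update_self, wire_cons_self]
      refine (tensor_fst (𝟙 Ob.N) (castPow hl'.symm) (IsComonHom.hom_counit _)).trans ?_
      exact Category.comp_id _
    · have hv' : v ∈ ys := by simpa [hvy] using hv
      have hne : assign ys ws σ v ≠ w := fun e => hw (e ▸ assign_mem hl' σ hv')
      rw [wire_cons_ne hvy, assign, Function.update_of_ne hvy, wire_cons_ne hne,
        ← ih hl' hws hv']
      have e := congrArg (· ≫ wire ys v)
        (tensor_snd (𝟙 Ob.N) (castPow hl'.symm) (Category.id_comp _))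
      exact (Category.assoc _ _ _).symm.trans (e.trans (Category.assoc _ _ _))

/-- The hypothesis of `interp_rename` is inherited by the body of an input. -/
theorem shift_wire {ys ws Γ Γ' : List 𝒩} (hl : ys.length = ws.length) (hws : ws.Nodup)
    (w : pow 𝒩 Γ.length ⟶ pow 𝒩 Γ'.length) [IsComonHom w] (σ : 𝒩 → 𝒩) {v : 𝒩}
    (hv : v ∉ ys → σ v ∉ ws ∧ w ≫ wire Γ' v = wire Γ (σ v)) :
    shift hl w ≫ wire (ys ++ Γ') v = wire (ws ++ Γ) (assign ys ws σ v) := by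
  have := isIso_join ws Γ
  rw [← cancel_epi (join ws Γ), ← Category.assoc, join_shift, Category.assoc]
  by_cases h : v ∈ ys
  · rw [join_wire_mem Γ' h, join_wire_mem Γ (assign_mem hl σ h), ← castPow_wire hl hws h σ,
      ← Category.assoc, tensor_fst _ _ (IsComonHom.hom_counit w), Category.assoc]
  · obtain ⟨h1, h2⟩ := hv h
    rw [assign_of_notMem σ h, join_wire_notMem Γ' h, join_wire_notMem Γ h1, ← h2,
      ← Category.assoc, tensor_snd _ _ (IsComonHom.hom_counit _), Category.assoc]

end Wires

end PiTheory

/-! ### The interpretation under renaming of the context -/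

namespace PiTheory

open ComonObj CocommComon PiCalc

theorem isComonHom_cons {𝒩 : Type u} {Γ Γ' : List 𝒩} (w : pow 𝒩 Γ.length ⟶ pow 𝒩 Γ'.length) [IsComonHom w]
    (x y : 𝒩) : IsComonHom (M := pow 𝒩 (x :: Γ).length) (N := pow 𝒩 (y :: Γ').length)
      (𝟙 Ob.N ⊗ₘ w : Ob.N ⊗ pow 𝒩 Γ.length ⟶ Ob.N ⊗ pow 𝒩 Γ'.length) :=
  isComonHom_tensorHom _ _

section Interp

variable {𝒩 : Type u} [DecidableEq 𝒩]

theorem interp_nil (Γ : List 𝒩) : interp .nil Γ = ε ≫ zero := by rw [interp, delPow_eq]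

theorem interp_out (x : 𝒩) (zs Γ : List 𝒩) :
    interp (.out x zs) Γ = Δ ≫ (wire Γ x ⊗ₘ wires Γ zs) ≫ send zs.length := by
  rw [interp, dupPow_eq]

theorem interp_inp (x : 𝒩) (ys : List 𝒩) (hys) (P : Proc 𝒩) (Γ : List 𝒩) :
    interp (.inp x ys hys P) Γ =
      Δ ≫ (wire Γ x ⊗ₘ curry (join ys Γ ≫ interp P (ys ++ Γ))) ≫ recv ys.length := by
  rw [interp, dupPow_eq]

theorem interp_par (P Q : Proc 𝒩) (Γ : List 𝒩) :
    interp (.par P Q) Γ = Δ ≫ (interp P Γ ⊗ₘ interp Q Γ) ≫ bar := by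
  rw [interp, dupPow_eq]

theorem interp_new (x : 𝒩) (P : Proc 𝒩) (Γ : List 𝒩) :
    interp (.new x P) Γ = pt fresh (𝟙 (pow 𝒩 Γ.length)) ≫ interp P (x :: Γ) := by
  rw [interp]
  exact (Category.assoc _ _ _).symm

theorem comp_wires_map {Γ Γ' : List 𝒩} (w : pow 𝒩 Γ.length ⟶ pow 𝒩 Γ'.length) [IsComonHom w]
    (σ : 𝒩 → 𝒩) (zs : List 𝒩) (h : ∀ z ∈ zs, w ≫ wire Γ' z = wire Γ (σ z))
    (hl : (zs.map σ).length = zs.length) :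
    w ≫ wires Γ' zs = wires Γ (zs.map σ) ≫ castPow hl := by
  induction zs with
  | nil =>
    refine (congrArg (w ≫ ·) (delPow_eq _)).trans ((IsComonHom.hom_counit w).trans ?_)
    exact (delPow_eq _).symm.trans (Category.comp_id (wires Γ [])).symm
  | cons z zs ih =>
    have hl' : (zs.map σ).length = zs.length := by simp
    have ih := ih (fun z hz => h z (by simp [hz])) hl'
    have e := castPow_succ (𝒩 := 𝒩) hl' hl
    refine Eq.trans ?_ (congrArg₂ (fun p q => p ≫ q) (wires_cons Γ (σ z) (zs.map σ)) e).symm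
    exact (congrArg (w ≫ ·) (wires_cons Γ' z zs)).trans
      (comp_comul_tensor_of_eq w (h z (by simp)) ih)

/-- The step of `interp_rename` at an input, which also yields invariance under α-conversion. -/
theorem interp_inp_congr {Γ Γ' : List 𝒩} (w : pow 𝒩 Γ.length ⟶ pow 𝒩 Γ'.length) [IsComonHom w]
    {x x' : 𝒩} (hx : w ≫ wire Γ' x = wire Γ x') {ys ws : List 𝒩} (hys hws)
    (hl : ys.length = ws.length) {P P' : Proc 𝒩}
    (h : shift hl w ≫ interp P (ys ++ Γ') = interp P' (ws ++ Γ)) :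
    w ≫ interp (.inp x ys hys P) Γ' = interp (.inp x' ws hws P') Γ := by
  rw [interp_inp, interp_inp, comp_comul_tensor, hx, comp_curry, castPow_recv hl.symm, ← h,
    ← Category.assoc (join ws Γ), join_shift, Category.assoc, tensorHom_comp_tensorHom_assoc,
    Category.comp_id, Category.id_comp]

/-- The step of `interp_rename` at a restriction, which also yields invariance under α-conversion. -/
theorem interp_new_congr {Γ Γ' : List 𝒩} (w : pow 𝒩 Γ.length ⟶ pow 𝒩 Γ'.length)
    {u v : 𝒩} {P P' : Proc 𝒩}
    (h : (𝟙 Ob.N ⊗ₘ w) ≫ interp P (u :: Γ') = interp P' (v :: Γ)) :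
    w ≫ interp (.new u P) Γ' = interp (.new v P') Γ := by
  rw [interp_new, interp_new, ← h]
  exact comp_pt_id w fresh (interp P (u :: Γ'))

/-- The hypothesis of `interp_rename` is inherited by the body of a restriction. -/
theorem cons_wire {Γ Γ' : List 𝒩} (w : pow 𝒩 Γ.length ⟶ pow 𝒩 Γ'.length) [IsComonHom w]
    (σ : 𝒩 → 𝒩) {x y v : 𝒩} (hv : v ≠ x → σ v ≠ y ∧ w ≫ wire Γ' v = wire Γ (σ v)) :
    (𝟙 Ob.N ⊗ₘ w) ≫ wire (x :: Γ') v = wire (y :: Γ) (Function.update σ x y v) := by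
  by_cases h : v = x
  · subst h
    rw [Function.update_self, wire_cons_self, wire_cons_self]
    exact (tensor_fst _ _ (IsComonHom.hom_counit w)).trans (Category.comp_id _)
  · obtain ⟨h1, h2⟩ := hv h
    rw [Function.update_of_ne h, wire_cons_ne h, wire_cons_ne h1, ← h2]
    have e := congrArg (· ≫ wire Γ' v)
      (tensor_snd (𝟙 Ob.N) w (Category.id_comp _))
    exact (Category.assoc _ _ _).symm.trans (e.trans (Category.assoc _ _ _))

variable [Infinite 𝒩]

/-- A morphism of comonoids `w` between contexts that acts on the wires of the free names like a
renaming `σ` interprets that renaming. It has to be a morphism of comonoids because the context is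
duplicated and deleted throughout the interpretation. Weakening, exchange, α-conversion and
substitution are all instances. -/
theorem interp_rename (P : Proc 𝒩) {Γ Γ' : List 𝒩} (w : pow 𝒩 Γ.length ⟶ pow 𝒩 Γ'.length)
    [IsComonHom w] (σ : 𝒩 → 𝒩) (h : ∀ v ∈ P.fn, w ≫ wire Γ' v = wire Γ (σ v)) :
    w ≫ interp P Γ' = interp (P.rename σ) Γ := by
  induction P generalizing Γ Γ' σ with
  | nil => rw [Proc.rename, interp_nil, interp_nil, IsComonHom.hom_counit_assoc]
  | out x zs =>
    rw [Proc.rename, interp_out, interp_out, comp_comul_tensor, h x (by simp [Proc.fn]),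
      comp_wires_map w σ zs (fun z hz => h z (by simp [Proc.fn, hz])) (by simp),
      ← castPow_send (n := zs.length) (m := (zs.map σ).length) (by simp), tensorHom_comp_tensorHom_assoc,
      Category.comp_id]
  | par P Q ihP ihQ =>
    rw [Proc.rename, interp_par, interp_par, comp_comul_tensor,
      ihP w σ (fun v hv => h v (by simp [Proc.fn, hv])),
      ihQ w σ (fun v hv => h v (by simp [Proc.fn, hv]))]
  | new x P ih =>
    rw [Proc.rename]
    apply interp_new_congr
    have := isComonHom_cons w x (freshName ((P.fn \ {x}).image σ))
    refine ih (Γ := freshName ((P.fn \ {x}).image σ) :: Γ) (Γ' := x :: Γ') (𝟙 Ob.N ⊗ₘ w) _ fun v hv => ?_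
    refine cons_wire w σ fun hvx => ?_
    have hv' : v ∈ P.fn \ {x} := by simp [hv, hvx]
    refine ⟨fun e => PiModel.freshName_notMem ((P.fn \ {x}).image σ) ?_, h v (by simpa [Proc.fn] using ⟨hv, hvx⟩)⟩
    rw [← e]
    exact Finset.mem_image_of_mem _ hv'
  | inp x ys hys P ih =>
    rw [Proc.rename]
    have hl := (PiModel.length_freshNames ys.length ((P.fn \ ys.toFinset).image σ)).symm
    refine interp_inp_congr w (h x (by simp [Proc.fn])) _ _ hl ?_
    have := isComonHom_shift hl w
    refine ih _ _ fun v hv => ?_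
    refine shift_wire hl (freshNames_nodup _ _) w σ fun hvy => ?_
    have hv' : v ∈ P.fn \ ys.toFinset := by simp [hv, hvy]
    refine ⟨fun e => PiModel.freshNames_notMem e ?_, h v (by simp [Proc.fn, hv, hvy])⟩
    exact Finset.mem_image_of_mem _ hv'

/-- The interpretation depends only on the wires of the free names. -/
theorem interp_congr (P : Proc 𝒩) {Γ Γ' : List 𝒩} (w : pow 𝒩 Γ.length ⟶ pow 𝒩 Γ'.length)
    [IsComonHom w] (h : ∀ v ∈ P.fn, w ≫ wire Γ' v = wire Γ v) :
    w ≫ interp P Γ' = interp P Γ := by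
  rw [interp_rename P w id h, ← interp_rename P (𝟙 _) id fun v _ => Category.id_comp _,
    Category.id_comp]

end Interp

end PiTheory

/-! ### Structural congruence and reduction in the 2-category -/

namespace PiTheory

open ComonObj CocommComon PiCalc

variable {𝒩 : Type u}

/-- Equality of 1-morphisms up to the action of scalars. -/
def ScEq {X Y : Ob 𝒩} (f g : X ⟶ Y) : Prop := ∃ s t, sc s f = sc t g

namespace ScEq

variable {X Y Z X' Y' : Ob 𝒩}

theorem of_eq {f g : X ⟶ Y} (h : f = g) : ScEq f g := ⟨𝟙 _, 𝟙 _, by rw [h]⟩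

theorem symm {f g : X ⟶ Y} : ScEq f g → ScEq g f := fun ⟨s, t, h⟩ => ⟨t, s, h.symm⟩

theorem trans {f g h : X ⟶ Y} : ScEq f g → ScEq g h → ScEq f h := by
  rintro ⟨s, t, e⟩ ⟨s', t', e'⟩
  refine ⟨s' ≫ s, t ≫ t', ?_⟩
  rw [← sc_sc, ← sc_sc, e, ← e', sc_comm]

theorem sc_left (s : 𝟙_ (Ob 𝒩) ⟶ 𝟙_ (Ob 𝒩)) (f : X ⟶ Y) : ScEq (sc s f) f :=
  ⟨𝟙 _, s, sc_id _⟩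

theorem comp {f f' : X ⟶ Y} {g g' : Y ⟶ Z} : ScEq f f' → ScEq g g' → ScEq (f ≫ g) (f' ≫ g') := by
  rintro ⟨s, t, e⟩ ⟨s', t', e'⟩
  refine ⟨s ≫ s', t ≫ t', ?_⟩
  rw [← sc_sc, ← sc_sc, ← comp_sc, ← sc_comp, ← comp_sc, ← sc_comp, e, e']

theorem tensor {f f' : X ⟶ Y} {g g' : X' ⟶ Y'} :
    ScEq f f' → ScEq g g' → ScEq (f ⊗ₘ g) (f' ⊗ₘ g') := by
  rintro ⟨s, t, e⟩ ⟨s', t', e'⟩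
  refine ⟨s ≫ s', t ≫ t', ?_⟩
  rw [← sc_sc, ← sc_sc, ← tensor_sc, ← sc_tensor, ← tensor_sc, ← sc_tensor, e, e']

theorem curry_sc {A : Ob 𝒩} (s : 𝟙_ (Ob 𝒩) ⟶ 𝟙_ (Ob 𝒩)) (f : A ⊗ X ⟶ Y) :
    curry (sc s f) = sc s (curry f) := by
  rw [← curry_eta (sc s (curry f)), tensor_sc, sc_comp, curry_beta]

theorem curry {A : Ob 𝒩} {f g : A ⊗ X ⟶ Y} : ScEq f g → ScEq (curry f) (PiTheory.curry g) := by
  rintro ⟨s, t, e⟩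
  exact ⟨s, t, by rw [← curry_sc, ← curry_sc, e]⟩

theorem refl (f : X ⟶ Y) : ScEq f f := of_eq rfl

end ScEq

theorem lift_bar_comm {A : Ob 𝒩} [ComonObj A] [IsCommComonObj A] (f g : A ⟶ Ob.P) :
    Δ[A] ≫ (f ⊗ₘ g) ≫ bar = Δ[A] ≫ (g ⊗ₘ f) ≫ bar := by
  have h : (β_ (Ob.P : Ob 𝒩) Ob.P).hom ≫ bar = bar := mk_eq .bar_comm
  rw [← h, ← Category.assoc (f ⊗ₘ g), ← Category.assoc, comul_swap, Category.assoc, h]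

theorem lift_bar_assoc {A : Ob 𝒩} [ComonObj A] (f g h : A ⟶ Ob.P) :
    Δ[A] ≫ ((Δ[A] ≫ (f ⊗ₘ g) ≫ bar) ⊗ₘ h) ≫ bar =
      Δ[A] ≫ (f ⊗ₘ (Δ[A] ≫ (g ⊗ₘ h) ≫ bar)) ≫ bar := by
  have e : (bar ⊗ₘ 𝟙 (Ob.P : Ob 𝒩)) ≫ bar = (α_ _ _ _).hom ≫ (𝟙 _ ⊗ₘ bar) ≫ bar :=
    mk_eq .bar_assoc
  have e1 : ((Δ[A] ≫ (f ⊗ₘ g) ≫ bar) ⊗ₘ h) = ((Δ[A] ≫ (f ⊗ₘ g)) ⊗ₘ h) ≫ (bar ⊗ₘ 𝟙 _) := by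
    rw [tensorHom_comp_tensorHom, Category.assoc, Category.comp_id]
  have e2 : (f ⊗ₘ (Δ[A] ≫ (g ⊗ₘ h) ≫ bar)) = (f ⊗ₘ (Δ[A] ≫ (g ⊗ₘ h))) ≫ (𝟙 _ ⊗ₘ bar) := by
    rw [tensorHom_comp_tensorHom, Category.assoc, Category.comp_id]
  rw [e1, e2, Category.assoc, Category.assoc, e, ← Category.assoc, ← Category.assoc,
    Category.assoc Δ[A], comul_assoc_tensor, Category.assoc]

theorem lift_bar_zero {A : Ob 𝒩} [ComonObj A] (f : A ⟶ Ob.P) :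
    Δ[A] ≫ (f ⊗ₘ (ε[A] ≫ zero)) ≫ bar = f := by
  have e : (𝟙 (Ob.P : Ob 𝒩) ⊗ₘ zero) ≫ bar = (ρ_ _).hom := mk_eq .bar_zero
  have e1 : (f ⊗ₘ (ε[A] ≫ zero)) = (f ⊗ₘ ε[A]) ≫ (𝟙 _ ⊗ₘ zero) := by
    rw [tensorHom_comp_tensorHom, Category.comp_id]
  rw [e1, Category.assoc, e, comul_counit_hom_assoc, Iso.inv_hom_id, Category.comp_id]

theorem isComonHom_snd_cons (x : 𝒩) (Γ : List 𝒩) :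
    IsComonHom (M := pow 𝒩 (x :: Γ).length) (N := pow 𝒩 Γ.length)
      (snd (Ob.N : Ob 𝒩) (pow 𝒩 Γ.length)) :=
  isComonHom_snd _ _

theorem isComonHom_swap_cons (x y : 𝒩) (Γ : List 𝒩) :
    IsComonHom (M := pow 𝒩 (y :: x :: Γ).length) (N := pow 𝒩 (x :: y :: Γ).length)
      (swap (Ob.N : Ob 𝒩) Ob.N (pow 𝒩 Γ.length)) :=
  isComonHom_swap _ _ _

section StructCong

variable [DecidableEq 𝒩]

theorem swap_wire (x y : 𝒩) (hxy : x ≠ y) (Γ : List 𝒩) (v : 𝒩) :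
    swap Ob.N Ob.N (pow 𝒩 Γ.length) ≫ wire (x :: y :: Γ) v = wire (y :: x :: Γ) v := by
  by_cases hvx : v = x
  · subst hvx
    rw [wire_cons_self, wire_cons_ne hxy, wire_cons_self]
    exact swap_fst _ _ _
  rw [wire_cons_ne hvx]
  by_cases hvy : v = y
  · subst hvy
    rw [wire_cons_self, wire_cons_self]
    exact swap_snd_fst _ _ _
  rw [wire_cons_ne hvy, wire_cons_ne hvy, wire_cons_ne hvx]
  have e := congrArg (· ≫ wire Γ v) (swap_snd_snd (Ob.N : Ob 𝒩) Ob.N (pow 𝒩 Γ.length))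
  simp only [Category.assoc] at e
  exact e

variable [Infinite 𝒩]

/-- Discarding a name that is not free. -/
theorem interp_cons (P : Proc 𝒩) {x : 𝒩} (h : x ∉ P.fn) (Γ : List 𝒩) :
    interp P (x :: Γ) = snd Ob.N (pow 𝒩 Γ.length) ≫ interp P Γ := by
  have := isComonHom_snd_cons x Γ
  refine (interp_congr P (Γ := x :: Γ) (Γ' := Γ) (snd Ob.N (pow 𝒩 Γ.length)) fun v hv => ?_).symm
  exact (wire_cons_ne (fun e : v = x => h (e ▸ hv)) Γ).symm

theorem interp_alpha_inp (x : 𝒩) (ys hys) (ys' : List 𝒩) (hys') (P : Proc 𝒩)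
    (hl : ys.length = ys'.length) (h : ∀ v ∈ ys', v ∉ P.fn \ ys.toFinset) (Γ : List 𝒩) :
    interp (.inp x ys hys P) Γ = interp (.inp x ys' hys' (P.subst ys' ys)) Γ := by
  rw [← Category.id_comp (interp (.inp x ys hys P) Γ)]
  refine interp_inp_congr (𝟙 _) (Category.id_comp _) _ _ hl ?_
  have := isComonHom_shift hl (𝟙 (pow 𝒩 Γ.length))
  refine interp_rename P _ _ fun v hv => ?_
  refine shift_wire hl hys' (𝟙 _) id fun hvy => ⟨fun e => h v e ?_, Category.id_comp _⟩
  simp [hv, hvy]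

theorem interp_alpha_new (u v : 𝒩) (P : Proc 𝒩) (h : v ∉ P.fn \ {u}) (Γ : List 𝒩) :
    interp (.new u P) Γ = interp (.new v (P.subst [v] [u])) Γ := by
  rw [← Category.id_comp (interp (.new u P) Γ)]
  refine interp_new_congr (𝟙 _) ?_
  have := isComonHom_cons (𝟙 (pow 𝒩 Γ.length)) v u
  refine interp_rename P (Γ := v :: Γ) (Γ' := u :: Γ) (𝟙 Ob.N ⊗ₘ 𝟙 (pow 𝒩 Γ.length)) _
    fun x hx => ?_
  have e : assign [u] [v] id = Function.update id u v := by simp [assign]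
  rw [e]
  refine cons_wire (𝟙 _) id fun hxu => ⟨fun (e : x = v) => h ?_, Category.id_comp _⟩
  simp [← e, hx, hxu]

/-- The second of two restrictions of the same name is shadowed, and leaves the scalar
`fresh ≫ del`. -/
theorem interp_new_idem (x : 𝒩) (P : Proc 𝒩) (Γ : List 𝒩) :
    interp (.new x (.new x P)) Γ = sc (fresh ≫ del) (interp (.new x P) Γ) := by
  have := isComonHom_snd_cons x Γ
  have := isComonHom_cons (Γ := x :: Γ) (Γ' := Γ) (snd Ob.N (pow 𝒩 Γ.length)) x x
  have e : (𝟙 Ob.N ⊗ₘ snd Ob.N (pow 𝒩 Γ.length)) ≫ interp P (x :: Γ) = interp P (x :: x :: Γ) := by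
    refine interp_congr P (Γ := x :: x :: Γ) (Γ' := x :: Γ) (𝟙 Ob.N ⊗ₘ snd Ob.N (pow 𝒩 Γ.length))
      fun v _ => ?_
    have := cons_wire (Γ := x :: Γ) (Γ' := Γ) (snd Ob.N (pow 𝒩 Γ.length)) id (x := x) (y := x) (v := v)
      fun hv => ⟨hv, (wire_cons_ne hv Γ).symm⟩
    rwa [Function.update_eq_self_iff.2 (rfl : id x = x)] at this
  rw [interp_new, interp_new, interp_new, ← e]
  exact pt_pt_snd (A := Ob.N) fresh (interp P (x :: Γ))

theorem interp_new_swap (x y : 𝒩) (P : Proc 𝒩) (Γ : List 𝒩) :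
    interp (.new x (.new y P)) Γ = interp (.new y (.new x P)) Γ := by
  by_cases hxy : x = y
  · rw [hxy]
  have := isComonHom_swap_cons x y Γ
  have e : swap Ob.N Ob.N (pow 𝒩 Γ.length) ≫ interp P (x :: y :: Γ) = interp P (y :: x :: Γ) :=
    interp_congr P (Γ := y :: x :: Γ) (Γ' := x :: y :: Γ) (swap Ob.N Ob.N (pow 𝒩 Γ.length))
      fun v _ => swap_wire x y hxy Γ v
  rw [interp_new, interp_new, interp_new, interp_new, ← e]
  exact pt_pt_swap fresh fresh (interp P (x :: y :: Γ))

/-- Scope extrusion: the copy of the restricted name that reaches `Q` is discarded. -/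
theorem interp_scope (x : 𝒩) (P Q : Proc 𝒩) (h : x ∉ Q.fn) (Γ : List 𝒩) :
    interp (.par (.new x P) Q) Γ = interp (.new x (.par P Q)) Γ := by
  rw [interp_par, interp_new, interp_new, interp_par, interp_cons Q h]
  exact comul_pt (A := Ob.N) fresh (interp P (x :: Γ)) (interp Q Γ) bar

/-- Structurally congruent processes have the same interpretation up to scalars. Scalars arise
only from `interp_new_idem`. -/
theorem interp_structCong {P Q : Proc 𝒩} (h : StructCong P Q) (Γ : List 𝒩) :
    ScEq (interp P Γ) (interp Q Γ) := by
  induction h generalizing Γ with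
  | refl P => exact .refl _
  | symm _ ih => exact (ih Γ).symm
  | trans _ _ ih ih' => exact (ih Γ).trans (ih' Γ)
  | inp x ys hys _ ih =>
    rw [interp_inp, interp_inp]
    exact (ScEq.refl _).comp (((ScEq.refl _).tensor ((ScEq.refl _).comp (ih _)).curry).comp (.refl _))
  | new x _ ih =>
    rw [interp_new, interp_new]
    exact (ScEq.refl _).comp (ih _)
  | par _ _ ih ih' =>
    rw [interp_par, interp_par]
    exact (ScEq.refl _).comp (((ih Γ).tensor (ih' Γ)).comp (.refl _))
  | alpha_inp x ys hys ys' hys' P hl h => exact .of_eq (interp_alpha_inp x ys hys ys' hys' P hl h Γ)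
  | alpha_new u v P h => exact .of_eq (interp_alpha_new u v P h Γ)
  | par_nil P =>
    rw [interp_par, interp_nil, lift_bar_zero]
    exact .refl _
  | par_comm P Q =>
    rw [interp_par, interp_par, lift_bar_comm]
    exact .refl _
  | par_assoc P Q R =>
    rw [interp_par, interp_par, interp_par, interp_par, lift_bar_assoc]
    exact .refl _
  | new_idem x P =>
    rw [interp_new_idem]
    exact .sc_left _ _
  | new_swap x y P => exact .of_eq (interp_new_swap x y P Γ)
  | scope x P Q h => exact .of_eq (interp_scope x P Q h Γ)

end StructCong

end PiTheory

/-! ### Reductions are realized by 2-morphisms -/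

namespace PiTheory

open ComonObj CocommComon PiCalc

variable {𝒩 : Type u}

/-- There is a 2-morphism generated by exactly one top-level occurrence of some `commₙ`. -/
def Fires {X Y : Ob 𝒩} (f g : X ⟶ Y) : Prop := ∃ a : f ⟶ g, CommOnce a

namespace Fires

variable {X Y Z X' Y' : Ob 𝒩}

theorem comp_left (h : X ⟶ Y) {f g : Y ⟶ Z} : Fires f g → Fires (h ≫ f) (h ≫ g) :=
  fun ⟨_, ha⟩ => ⟨_, .horiz_left h ha⟩

theorem comp_right {f g : X ⟶ Y} (h : Y ⟶ Z) : Fires f g → Fires (f ≫ h) (g ≫ h) :=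
  fun ⟨_, ha⟩ => ⟨_, .horiz_right h ha⟩

theorem tensor_left (h : X' ⟶ Y') {f g : X ⟶ Y} : Fires f g → Fires (h ⊗ₘ f) (h ⊗ₘ g) :=
  fun ⟨_, ha⟩ => ⟨_, .tensor_left h ha⟩

theorem tensor_right {f g : X ⟶ Y} (h : X' ⟶ Y') : Fires f g → Fires (f ⊗ₘ h) (g ⊗ₘ h) :=
  fun ⟨_, ha⟩ => ⟨_, .tensor_right h ha⟩

theorem sc (s : 𝟙_ (Ob 𝒩) ⟶ 𝟙_ (Ob 𝒩)) {f g : X ⟶ Y} (h : Fires f g) :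
    Fires (sc s f) (CocommComon.sc s g) :=
  ((h.tensor_left s).comp_left _).comp_right _

end Fires

theorem comp_withComm {X Y : Ob 𝒩} (w : X ⟶ Y) (f : Y ⟶ Ob.P) :
    w ≫ withComm f = withComm (w ≫ f) := by
  simp only [withComm, Category.assoc]

theorem withComm_sc {X : Ob 𝒩} (s) (f : X ⟶ Ob.P) : withComm (sc s f) = sc s (withComm f) := by
  rw [withComm, sc_comp, withComm]

theorem withComm_eq {A : Ob 𝒩} [ComonObj A] (f : A ⟶ Ob.P) :
    withComm f = Δ[A] ≫ (f ⊗ₘ (ε[A] ≫ COMM)) ≫ bar := by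
  have e1 : (f ⊗ₘ (ε[A] ≫ COMM)) = (f ⊗ₘ ε[A]) ≫ (𝟙 _ ⊗ₘ COMM) := by
    rw [tensorHom_comp_tensorHom, Category.comp_id]
  rw [e1, Category.assoc, comul_counit_hom_assoc, withComm]

/-- `COMM` can be moved next to either parallel component. -/
theorem withComm_lift_bar {A : Ob 𝒩} [ComonObj A] [IsCommComonObj A] (f g : A ⟶ Ob.P) :
    withComm (Δ[A] ≫ (f ⊗ₘ g) ≫ bar) = Δ[A] ≫ (withComm f ⊗ₘ g) ≫ bar := by
  rw [withComm_eq, withComm_eq, lift_bar_assoc, lift_bar_assoc, lift_bar_comm g]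

/-- The relation underlying semantic reduction, for 1-morphisms with arbitrary source. -/
def Step {X : Ob 𝒩} (f g : X ⟶ Ob.P) : Prop :=
  ∃ s t, Fires (sc s (withComm f)) (sc t (withComm g))

namespace Step

theorem of_fires {X : Ob 𝒩} {f g : X ⟶ Ob.P} (h : Fires (withComm f) (withComm g)) : Step f g :=
  ⟨𝟙 _, 𝟙 _, h.sc _⟩

theorem comp {X Y : Ob 𝒩} (w : X ⟶ Y) {f g : Y ⟶ Ob.P} : Step f g → Step (w ≫ f) (w ≫ g) := by
  rintro ⟨s, t, h⟩
  refine ⟨s, t, ?_⟩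
  rw [← comp_withComm, ← comp_withComm, ← comp_sc, ← comp_sc]
  exact h.comp_left w

theorem lift_bar {A : Ob 𝒩} [ComonObj A] [IsCommComonObj A] {f g : A ⟶ Ob.P} (r : A ⟶ Ob.P) :
    Step f g → Step (Δ[A] ≫ (f ⊗ₘ r) ≫ bar) (Δ[A] ≫ (g ⊗ₘ r) ≫ bar) := by
  rintro ⟨s, t, h⟩
  refine ⟨s, t, ?_⟩
  have e : ∀ s (f : A ⟶ Ob.P), CocommComon.sc s (Δ[A] ≫ (f ⊗ₘ r) ≫ bar) =
      Δ[A] ≫ (CocommComon.sc s f ⊗ₘ r) ≫ bar := fun s f => by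
    rw [sc_tensor, sc_comp, comp_sc]
  rw [withComm_lift_bar, withComm_lift_bar, e, e]
  exact ((h.tensor_right r).comp_right bar).comp_left _

theorem congr {X : Ob 𝒩} {f f' g g' : X ⟶ Ob.P} (hf : ScEq f f') (h : Step f' g')
    (hg : ScEq g' g) : Step f g := by
  obtain ⟨s, t, e⟩ := hf
  obtain ⟨s', t', e'⟩ := hg
  obtain ⟨p, q, h⟩ := h
  refine ⟨p ≫ s' ≫ s, q ≫ t ≫ t', ?_⟩
  have h1 : CocommComon.sc (p ≫ s' ≫ s) (withComm f) =
      CocommComon.sc t (CocommComon.sc s' (CocommComon.sc p (withComm f'))) := by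
    rw [← sc_sc, ← sc_sc, ← withComm_sc s, e, withComm_sc, sc_comm p, sc_comm p, sc_comm s']
  have h2 : CocommComon.sc (q ≫ t ≫ t') (withComm g) =
      CocommComon.sc t (CocommComon.sc s' (CocommComon.sc q (withComm g'))) := by
    rw [← sc_sc, ← sc_sc, ← withComm_sc t', ← e', withComm_sc, sc_comm q, sc_comm q]
  rw [h1, h2]
  exact (h.sc s').sc t

end Step

/-- A component that is computed and then discarded can be omitted. -/
theorem lift_counit_tensor {A B X Y : Ob 𝒩} [ComonObj A] [ComonObj B] (f : A ⟶ B) [IsComonHom f]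
    (h : A ⟶ X) (k : X ⟶ Y) :
    Δ[A] ≫ (f ⊗ₘ h) ≫ (ε[B] ⊗ₘ k) ≫ (λ_ Y).hom = h ≫ k := by
  rw [tensorHom_comp_tensorHom_assoc, IsComonHom.hom_counit, counit_comul_hom_assoc,
    Iso.inv_hom_id, Category.comp_id]

theorem lift_curry_ev {A B Y : Ob 𝒩} [ComonObj A] (w : A ⟶ B) (c : B ⊗ A ⟶ Y) :
    Δ[A] ≫ (w ⊗ₘ curry c) ≫ ev B Y = Δ[A] ≫ (w ⊗ₘ 𝟙 A) ≫ c := by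
  have e : (w ⊗ₘ curry c) = (w ⊗ₘ 𝟙 A) ≫ (𝟙 B ⊗ₘ curry c) := by
    rw [tensorHom_comp_tensorHom, Category.comp_id, Category.id_comp]
  rw [e, Category.assoc, curry_beta]

/-- A permutation of the names in scope is realized by a morphism of comonoids. -/
theorem exists_perm [DecidableEq 𝒩] {Γ Γ' : List 𝒩} (h : Γ.Perm Γ') :
    ∃ w : pow 𝒩 Γ.length ⟶ pow 𝒩 Γ'.length, IsComonHom w ∧ names Γ ≫ w = names Γ' ∧
      ∀ x, w ≫ wire Γ' x = wire Γ x := by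
  induction h with
  | nil => exact ⟨𝟙 _, inferInstance, Category.comp_id _, fun _ => Category.id_comp _⟩
  | @cons x Γ Γ' _ ih =>
    obtain ⟨w, hw, hn, hx⟩ := ih
    refine ⟨(𝟙 Ob.N ⊗ₘ w : Ob.N ⊗ pow 𝒩 Γ.length ⟶ Ob.N ⊗ pow 𝒩 Γ'.length),
      isComonHom_cons w x x, ?_, fun v => ?_⟩
    · refine (pt_comp (name x) (𝟙 _) (names Γ) w).trans ?_
      rw [hn, Category.comp_id]
      rfl
    · have := cons_wire w id (x := x) (y := x) (v := v) fun hv => ⟨hv, hx v⟩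
      rwa [Function.update_eq_self_iff.2 (rfl : id x = x)] at this
  | swap x y Γ =>
    by_cases hxy : x = y
    · subst hxy
      exact ⟨𝟙 _, inferInstance, Category.comp_id _, fun _ => Category.id_comp _⟩
    exact ⟨swap Ob.N Ob.N (pow 𝒩 Γ.length), isComonHom_swap_cons x y Γ,
      pt_swap (name y) (name x) (names Γ), swap_wire x y hxy Γ⟩
  | trans _ _ ih ih' =>
    obtain ⟨w, hw, hn, hx⟩ := ih
    obtain ⟨w', hw', hn', hx'⟩ := ih'
    refine ⟨w ≫ w', inferInstance, ?_, fun x => ?_⟩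
    · rw [← Category.assoc, hn, hn']
    · rw [Category.assoc, hx', hx]

/-- Names that are not used can be dropped from the context, at the cost of the scalars
`name x ≫ del`. -/
theorem exists_drop [DecidableEq 𝒩] (Θ Γ : List 𝒩) :
    ∃ (w : pow 𝒩 (Θ ++ Γ).length ⟶ pow 𝒩 Γ.length) (s : _), IsComonHom w ∧
      names (Θ ++ Γ) ≫ w = sc s (names Γ) ∧ ∀ x ∉ Θ, w ≫ wire Γ x = wire (Θ ++ Γ) x := by
  induction Θ with
  | nil =>
    refine ⟨𝟙 _, 𝟙 _, inferInstance, ?_, fun _ _ => Category.id_comp _⟩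
    rw [sc_id]
    exact Category.comp_id _
  | cons y Θ ih =>
    obtain ⟨w, s, hw, hn, hx⟩ := ih
    have := isComonHom_snd (Ob.N : Ob 𝒩) (pow 𝒩 (Θ ++ Γ).length)
    refine ⟨snd Ob.N (pow 𝒩 (Θ ++ Γ).length) ≫ w, (name y ≫ ε) ≫ s,
      isComonHom_comp (snd Ob.N (pow 𝒩 (Θ ++ Γ).length)) w, ?_, fun x h => ?_⟩
    · have e := congrArg (· ≫ w) (pt_snd (name y) (names (Θ ++ Γ)))
      refine (Category.assoc _ _ _).symm.trans (e.trans ?_)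
      rw [← sc_sc, ← hn, sc_comp]
    · simp only [List.mem_cons, not_or] at h
      refine (Category.assoc _ _ _).trans ?_
      rw [hx x h.2]
      exact (wire_cons_ne h.1 _).symm

section Reduction

variable [DecidableEq 𝒩] [Infinite 𝒩]

/-- Supplying the names `zs` for the names `ys` bound by an input interprets substitution. -/
theorem interp_subst (P : Proc 𝒩) {ys zs Γ : List 𝒩} (hl : ys.length = zs.length)
    (hzs : ∀ z ∈ zs, z ∈ Γ) :
    Δ ≫ ((wires Γ zs ≫ castPow hl.symm) ⊗ₘ 𝟙 _) ≫ join ys Γ ≫ interp P (ys ++ Γ) =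
      interp (P.subst zs ys) Γ := by
  have h1 := isComonHom_wires hzs
  have h2 := isComonHom_lift (wires Γ zs ≫ castPow hl.symm) (𝟙 (pow 𝒩 Γ.length))
  have h3 := isComonHom_join ys Γ
  have h := interp_rename P (Γ := Γ) (Γ' := ys ++ Γ)
    ((Δ ≫ ((wires Γ zs ≫ castPow hl.symm) ⊗ₘ 𝟙 _)) ≫ join ys Γ) (assign ys zs id) ?_
  · rw [Proc.subst, ← h]
    simp only [Category.assoc]
  intro v _
  by_cases hv : v ∈ ys
  · rw [Category.assoc, join_wire_mem Γ hv, Category.assoc, ← Category.assoc (_ ⊗ₘ _),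
      ← Category.assoc, lift_fst _ _ (IsComonHom.hom_counit _), Category.assoc,
      wires_wire hl Γ hzs hv]
  · rw [Category.assoc, join_wire_notMem Γ hv, Category.assoc, ← Category.assoc (_ ⊗ₘ _),
      ← Category.assoc, lift_snd _ _ (IsComonHom.hom_counit _), Category.id_comp,
      assign_of_notMem _ hv]
    rfl

/-- A communication is `commₙ` precomposed with the morphism that supplies the channel, the tuple
sent and the continuation; in the source, `Δ` on the channel is shared by the two components, and
in the target evaluation performs the substitution. -/
theorem step_comm {x : 𝒩} {ys : List 𝒩} (hys) (P : Proc 𝒩) {zs Γ : List 𝒩}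
    (hl : ys.length = zs.length) (hx : x ∈ Γ) (hzs : ∀ z ∈ zs, z ∈ Γ) :
    Step (interp (.par (.inp x ys hys P) (.out x zs)) Γ) (interp (P.subst zs ys) Γ) := by
  have h1 := isComonHom_wire hx
  set c := curry (join ys Γ ≫ interp P (ys ++ Γ)) with hc
  set w := wires Γ zs ≫ castPow hl.symm with hw
  have hu : Fires ((Δ ≫ (wire Γ x ⊗ₘ (Δ ≫ (w ⊗ₘ c)))) ≫ commSrc ys.length)
    ((Δ ≫ (wire Γ x ⊗ₘ (Δ ≫ (w ⊗ₘ c)))) ≫ commTgt ys.length) :=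
    Fires.comp_left _ ⟨_, .comm ys.length⟩
  have hs : (Δ ≫ (wire Γ x ⊗ₘ (Δ ≫ (w ⊗ₘ c)))) ≫ commSrc ys.length =
      withComm (interp (.par (.inp x ys hys P) (.out x zs)) Γ) := by
    have hd := comul_distrib (wire Γ x) w c
    rw [commSrc, comp_withComm, interp_par, lift_bar_comm, interp_inp, interp_out, ← hc,
      ← castPow_send hl.symm, tensorHom_comp_tensorHom_assoc, Category.comp_id, ← hw]
    congr 1
    have e := congrArg (· ≫ (send ys.length ⊗ₘ recv ys.length) ≫ bar) hd
    simp only [Category.assoc] at e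
    rw [Category.assoc]
    refine e.trans ?_
    rw [tensorHom_comp_tensorHom_assoc]
    simp only [Category.assoc]
  have ht : (Δ ≫ (wire Γ x ⊗ₘ (Δ ≫ (w ⊗ₘ c)))) ≫ commTgt ys.length =
      withComm (interp (P.subst zs ys) Γ) := by
    rw [commTgt, comp_withComm, ← interp_subst P hl hzs, ← lift_curry_ev, Category.assoc]
    congr 1
    exact (lift_counit_tensor (wire Γ x) (Δ ≫ (w ⊗ₘ c)) (ev _ _)).trans (Category.assoc _ _ _)
  rw [hs, ht] at hu
  exact .of_fires hu

/-- Reductions are interpreted by steps in every context that contains some finite set `S`. The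
free names are not enough, because the processes on the way need not have the same free names, and
the wire of a name that is not in scope is a generator, which need not be a morphism of comonoids. -/
theorem exists_step {P P' : Proc 𝒩} (h : Red P P') :
    ∃ S : Finset 𝒩, ∀ Γ : List 𝒩, (∀ x ∈ S, x ∈ Γ) → Step (interp P Γ) (interp P' Γ) := by
  induction h with
  | comm x ys hys P zs hl =>
    exact ⟨insert x zs.toFinset, fun Γ h =>
      step_comm hys P hl (h x (by simp)) fun z hz => h z (by simp [hz])⟩
  | par Q _ ih =>
    obtain ⟨S, h⟩ := ih
    refine ⟨S, fun Γ hΓ => ?_⟩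
    rw [interp_par, interp_par]
    exact (h Γ hΓ).lift_bar _
  | new x _ ih =>
    obtain ⟨S, h⟩ := ih
    refine ⟨S, fun Γ hΓ => ?_⟩
    rw [interp_new, interp_new]
    exact (h (x :: Γ) fun y hy => List.mem_cons_of_mem _ (hΓ y hy)).comp
      (pt fresh (𝟙 (pow 𝒩 Γ.length)))
  | equiv h1 _ h2 ih =>
    obtain ⟨S, h⟩ := ih
    exact ⟨S, fun Γ hΓ => (h Γ hΓ).congr (interp_structCong h1 Γ) (interp_structCong h2 Γ)⟩

/-- `⟦P⟧` can be computed, up to scalars, from any duplicate-free context that contains the free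
names. -/
theorem names_interp (P : Proc 𝒩) {Γ : List 𝒩} (hΓ : Γ.Nodup) (h : ∀ x ∈ P.fn, x ∈ Γ) :
    ScEq (names Γ ≫ interp P Γ) (den P) := by
  have hp : Γ.Perm (Γ.filter (· ∉ P.fn) ++ P.fn.toList) := by
    rw [List.perm_ext_iff_of_nodup hΓ]
    · intro a
      by_cases ha : a ∈ P.fn <;> simp [ha, h]
    · refine List.nodup_append.2 ⟨hΓ.filter _, P.fn.nodup_toList, ?_⟩
      rintro a ha b hb rfl
      simp at ha hb
      exact ha.2 hb
  obtain ⟨w, hw, hn, hx⟩ := exists_perm hp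
  obtain ⟨w', s, hw', hn', hx'⟩ := exists_drop (Γ.filter (· ∉ P.fn)) P.fn.toList
  have e : (w ≫ w') ≫ interp P P.fn.toList = interp P Γ := by
    refine interp_congr P _ fun v hv => ?_
    rw [Category.assoc, hx' v (by simp [hv]), hx]
  refine (ScEq.of_eq ?_).trans (ScEq.sc_left s _)
  rw [← e, ← Category.assoc, ← Category.assoc, hn, hn', sc_comp, den]

/-- Reductions are semantic reductions. -/
theorem commRed_of_red {P P' : Proc 𝒩} (h : Red P P') : CommRed (den P) (den P') := by
  obtain ⟨S, hS⟩ := exists_step h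
  -- a common context for the reduction and for both of its ends
  set Γ := (S ∪ (P.fn ∪ P'.fn)).toList with hΓ
  have h1 := names_interp P (Γ := Γ) (Finset.nodup_toList _) fun x hx => by simp [hΓ, hx]
  have h2 := names_interp P' (Γ := Γ) (Finset.nodup_toList _) fun x hx => by simp [hΓ, hx]
  obtain ⟨s, t, hst⟩ := ((hS Γ fun x hx => by simp [hΓ, hx]).comp (names Γ)).congr h1.symm h2
  refine ⟨s, t, ?_⟩
  have e : ∀ (s : 𝟙_ (Ob 𝒩) ⟶ 𝟙_ (Ob 𝒩)) (f : 𝟙_ (Ob 𝒩) ⟶ Ob.P), scale s f = sc s f :=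
    fun s f => (Category.assoc _ _ _).symm
  rw [e, e]
  exact hst

end Reduction

end PiTheory

/-! ### Full abstraction -/

namespace PiModel

open PiTheory PiCalc

variable {𝒩 : Type u}

/-- Composition with `withComm` adds the token to a behaviour and chooses no labels. -/
theorem den_withComm_eq {X : Ob 𝒩} (f : X ⟶ Ob.P) :
    ∃ G : Gph.Hom (obj .P) (obj .P), den (withComm f) = (den f).comp (.single G) ∧
      ∀ p, G p = (fun p : Beh (Nm 𝒩) => p + Beh.tok) p := by
  refine ⟨_, (den_comp _ _).trans (congrArg (LHom.comp (den f))
    (den_comp_single (den_rightUnitor_inv _) <|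
      den_comp_single (den_tensor_single (den_id _) den_COMM) den_bar)), fun _ => rfl⟩

theorem den_scale {X : Ob 𝒩} (s) (f : 𝟙_ (Ob 𝒩) ⟶ X) :
    den (scale s f) = (LHom.single (.lunitInv (obj (𝟙_ (Ob 𝒩))))).comp
      (((den s).tensor (den f)).comp (.single (.lunitHom (obj X)))) := by
  rw [scale, den_comp, den_comp, den_tensor]
  rfl

/-- A scalar contributes labels, and leaves the behaviour unchanged. -/
theorem mem_den_scale_withComm {s : 𝟙_ (Ob 𝒩) ⟶ 𝟙_ (Ob 𝒩)} {f : 𝟙_ (Ob 𝒩) ⟶ Ob.P} {c} :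
    c ∈ den (scale s (withComm f)) ↔ ∃ a ∈ den s, ∃ b ∈ den f, c.1 = a.1 + b.1 ∧
      c.2 PUnit.unit = (fun p : Beh (Nm 𝒩) => p + Beh.tok) (b.2 PUnit.unit) := by
  obtain ⟨G, hG, hG'⟩ := den_withComm_eq f
  rw [den_scale]
  constructor
  · rintro ⟨_, rfl, _, ⟨_, ⟨a, ha, w, hw, rfl⟩, _, rfl, rfl⟩, rfl⟩
    rw [hG, LHom.comp_single] at hw
    obtain ⟨b, hb, rfl⟩ := hw
    refine ⟨a, ha, b, hb, ?_, hG' _⟩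
    change 0 + (a.1 + b.1 + 0) = _
    rw [zero_add, add_zero]
  · rintro ⟨a, ha, b, hb, e1, e2⟩
    have hw : (b.1, b.2.comp G) ∈ den (withComm f) := by
      rw [hG, LHom.comp_single]
      exact ⟨b, hb, rfl⟩
    refine ⟨_, rfl, _, ⟨_, ⟨a, ha, _, hw, rfl⟩, _, rfl, rfl⟩, Prod.ext ?_ (Gph.Hom.ext ?_)⟩
    · change 0 + (a.1 + b.1 + 0) = _
      rw [zero_add, add_zero, e1]
    · funext x
      exact (hG' _).trans e2.symm

end PiModel

namespace PiCalc

open PiModel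

/-- Distinct names have distinct interpretations, as the model tells them apart. -/
theorem name_injective {𝒩 : Type u} : Function.Injective (PiTheory.name (𝒩 := 𝒩)) := by
  intro x y e
  have h := congrArg PiModel.den e
  rw [den_name, den_name] at h
  have h' := LHom.mem_single.1 (h ▸ LHom.mem_single.2 rfl)
  exact Sum.inl_injective (congrFun (congrArg (fun F => F.2.toFun) h') PUnit.unit)

section

variable {𝒩 : Type u} [DecidableEq 𝒩]

/-- The two processes have a common behaviour, in each case for some choice of pairwise distinct
labels for the restrictions. The labels used may differ, as some may not occur in the behaviour. -/
def SameBeh (P Q : Proc 𝒩) : Prop :=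
  ∃ L L' h k, L.Nodup ∧ L'.Nodup ∧ Sem P L h ∧ Sem Q L' k ∧ h .inl = k .inl

/-- Every process has a behaviour with pairwise distinct labels. -/
theorem exists_sem (P : Proc 𝒩) : ∃ L h, L.Nodup ∧ Sem P L h := by
  obtain ⟨a, ha, hn, -⟩ := exists_den (PiTheory.den P) ∅
  obtain ⟨h, hS, -⟩ := (mem_den_den P a).1 ha
  exact ⟨_, h, hn, hS⟩

theorem SameBeh.symm {P Q : Proc 𝒩} : SameBeh P Q → SameBeh Q P :=
  fun ⟨L, L', h, k, hL, hL', hP, hQ, e⟩ => ⟨L', L, k, h, hL', hL, hQ, hP, e.symm⟩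

theorem SameBeh.barb {P Q : Proc 𝒩} (h : SameBeh P Q) {x : 𝒩} (hx : Barb P x) : Barb Q x := by
  obtain ⟨L, L', h, k, -, -, hP, hQ, e⟩ := h
  obtain ⟨zs, hz⟩ := (hP.barb_iff .inl x).2 ⟨x, hx, rfl⟩
  rw [e] at hz
  obtain ⟨y, hy, exy⟩ := (hQ.barb_iff .inl x).1 ⟨zs, hz⟩
  exact Sum.inl_injective exy ▸ hy

/-- Every 2-morphism witnessing a semantic reduction is a communication between the behaviours. -/
theorem exists_comm_of_commRed {P P' : Proc 𝒩} (h : PiTheory.CommRed (PiTheory.den P) (PiTheory.den P'))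
    {L k} (hS : Sem P L k) (hL : L.Nodup) :
    ∃ L' k', L'.Nodup ∧ Sem P' L' k' ∧ Beh.Comm (k .inl) (k' .inl) := by
  obtain ⟨s, t, a, ha⟩ := h
  -- the labels of the scalar avoid those of `P`; a 2-morphism preserves the multiset of all labels,
  -- so the labels of `P'` are again distinct
  obtain ⟨b, hb, hbn, hbL⟩ := exists_den s L.toFinset
  have hk : (L, Gph.Hom.ofFun fun _ => k .inl) ∈ PiModel.den (PiTheory.den P) :=
    (mem_den_den P _).2 ⟨k, hS, rfl⟩
  obtain ⟨c, hc, e⟩ : ∃ c ∈ PiModel.den (PiTheory.scale s (PiTheory.withComm (PiTheory.den P))),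
      c.1 = b.1 + L ∧ c.2 PUnit.unit = (fun p : Beh (Nm 𝒩) => p + Beh.tok) (k .inl) :=
    ⟨(b.1 + L, Gph.Hom.ofFun fun _ => k .inl + Beh.tok),
      mem_den_scale_withComm.2 ⟨b, hb, _, hk, rfl, rfl⟩, rfl, rfl⟩
  obtain ⟨d, hd, e', hR⟩ := rel_of_commOnce ha c hc
  obtain ⟨b', -, g, hg, e1, e2⟩ := mem_den_scale_withComm.1 hd
  obtain ⟨k', hk', e3⟩ := (mem_den_den P' g).1 hg
  have hn : (b.1 + L).Nodup := Multiset.nodup_add.2 ⟨hbn, hL,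
    Multiset.disjoint_left.2 fun {n} hnb hnL => hbL n hnb (Multiset.mem_toFinset.2 hnL)⟩
  rw [← e.1, ← e', e1] at hn
  refine ⟨g.1, k', (Multiset.nodup_add.1 hn).2.1, hk', ?_⟩
  -- both sides carry exactly the one top-level token, and `k .inl` has none
  have hR := hR PUnit.unit
  rw [e.2, e2, e3] at hR
  exact Beh.Step.comm_of_add_tok (hS.not_hasTok _) hR

/-- Processes with equal interpretations have a common behaviour; they need not be structurally
congruent a priori. -/
theorem sameBeh_of_den_eq {P Q : Proc 𝒩} (e : PiTheory.den P = PiTheory.den Q) : SameBeh P Q := by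
  obtain ⟨L, h, hL, hS⟩ := exists_sem P
  have hk : (L, Gph.Hom.ofFun fun _ => h .inl) ∈ PiModel.den (PiTheory.den P) :=
    (mem_den_den P _).2 ⟨h, hS, rfl⟩
  rw [e] at hk
  obtain ⟨k, hQ, ek⟩ := (mem_den_den Q _).1 hk
  exact ⟨L, L, h, k, hL, hL, hS, hQ, ek⟩

/-- Semantic observations are barbs. Although `Obs` is generated by the equal 1-morphisms of
possibly different processes, these have a common behaviour, and so the same barbs. -/
theorem obs_iff (P : Proc 𝒩) (x : 𝒩) :
    PiTheory.Obs (PiTheory.den P) (PiTheory.name x) ↔ Barb P x := by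
  constructor
  · intro h
    -- `P` is one of possibly several processes with the interpretation at hand
    generalize ef : PiTheory.den P = f at h
    generalize ea : PiTheory.name x = a at h
    induction h generalizing P x with
    | out y ys =>
      rw [name_injective ea]
      exact (sameBeh_of_den_eq ef).symm.barb (.out y ys)
    | par_left p q y _ ih =>
      exact (sameBeh_of_den_eq ef).symm.barb (.par_left q (ih p x rfl ea))
    | par_right p q y _ ih =>
      exact (sameBeh_of_den_eq ef).symm.barb (.par_right p (ih q x rfl ea))
    | new u p y _ hne ih =>
      refine (sameBeh_of_den_eq ef).symm.barb (.new u (ih p x rfl ea) ?_)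
      rwa [name_injective ea]
  · intro h
    induction h with
    | out x ys => exact .out x ys
    | par_left Q _ ih => exact .par_left _ _ _ ih
    | par_right P _ ih => exact .par_right _ _ _ ih
    | new u _ hne ih => exact .new _ _ _ ih hne

variable [Infinite 𝒩]

/-- A semantic reduction of `P` is matched by a reduction of every process with a common
behaviour. -/
theorem SameBeh.exists_red {P Q P' : Proc 𝒩} (h : SameBeh P Q)
    (hr : PiTheory.CommRed (PiTheory.den P) (PiTheory.den P')) :
    ∃ Q', Red Q Q' ∧ SameBeh P' Q' := by
  obtain ⟨L, L', h, k, hL, hL', hP, hQ, e⟩ := h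
  obtain ⟨M, l, hM, hP', hc⟩ := exists_comm_of_commRed hr hP hL
  rw [e] at hc
  obtain ⟨Q', m, hr', hQ', em⟩ := hQ.reflect hL' hc
  exact ⟨Q', hr', M, L', l, m, hM, hL', hP', hQ', em.symm⟩

/-- Having a common behaviour is a barbed bisimulation: a reduction of one process gives a
2-morphism, hence a communication of the behaviour, hence a reduction of the other process. -/
theorem SameBeh.barbedBisimilar {P Q : Proc 𝒩} (h : SameBeh P Q) : BarbedBisimilar P Q :=
  ⟨SameBeh, ⟨fun _ _ => .symm, fun _ _ h =>
    ⟨fun _ hr => h.exists_red (PiTheory.commRed_of_red hr), fun _ => h.barb⟩⟩, h⟩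

theorem BarbedBisimilar.symm {P Q : Proc 𝒩} : BarbedBisimilar P Q → BarbedBisimilar Q P :=
  fun ⟨S, hS, h⟩ => ⟨S, hS, hS.1 _ _ h⟩

theorem BarbedBisimilar.trans {P Q R : Proc 𝒩} :
    BarbedBisimilar P Q → BarbedBisimilar Q R → BarbedBisimilar P R := by
  rintro ⟨S, hS, h⟩ ⟨T, hT, h'⟩
  -- the composite of two symmetric relations is symmetric only together with its converse
  refine ⟨fun A C => (∃ B, S A B ∧ T B C) ∨ ∃ B, T A B ∧ S B C, ⟨?_, ?_⟩, .inl ⟨Q, h, h'⟩⟩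
  · rintro A C (⟨B, h, h'⟩ | ⟨B, h, h'⟩)
    · exact .inr ⟨B, hT.1 _ _ h', hS.1 _ _ h⟩
    · exact .inl ⟨B, hS.1 _ _ h', hT.1 _ _ h⟩
  · rintro A C (⟨B, h, h'⟩ | ⟨B, h, h'⟩)
    · refine ⟨fun A' hA => ?_, fun x hx => (hT.2 _ _ h').2 x ((hS.2 _ _ h).2 x hx)⟩
      obtain ⟨B', hB, e⟩ := (hS.2 _ _ h).1 A' hA
      obtain ⟨C', hC, e'⟩ := (hT.2 _ _ h').1 B' hB
      exact ⟨C', hC, .inl ⟨B', e, e'⟩⟩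
    · refine ⟨fun A' hA => ?_, fun x hx => (hS.2 _ _ h').2 x ((hT.2 _ _ h).2 x hx)⟩
      obtain ⟨B', hB, e⟩ := (hT.2 _ _ h).1 A' hA
      obtain ⟨C', hC, e'⟩ := (hS.2 _ _ h').1 B' hB
      exact ⟨C', hC, .inr ⟨B', e, e'⟩⟩

theorem BarbedBisimilar.exists_red {P Q P' : Proc 𝒩} (h : BarbedBisimilar P Q) (hr : Red P P') :
    ∃ Q', Red Q Q' ∧ BarbedBisimilar P' Q' := by
  obtain ⟨S, hS, h⟩ := h
  obtain ⟨Q', hQ, e⟩ := (hS.2 _ _ h).1 P' hr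
  exact ⟨Q', hQ, S, hS, e⟩

theorem BarbedBisimilar.barb {P Q : Proc 𝒩} (h : BarbedBisimilar P Q) {x : 𝒩} (hx : Barb P x) :
    Barb Q x := by
  obtain ⟨S, hS, h⟩ := h
  exact (hS.2 _ _ h).2 x hx

/-- The images of barbed bisimilar processes form a semantic bisimulation. A process is determined
by its interpretation, and by a semantic reduction, only up to `SameBeh`, which is contained in
barbed bisimilarity. -/
theorem semBisimilar_of_barbedBisimilar {P Q : Proc 𝒩} (h : BarbedBisimilar P Q) :
    PiTheory.SemBisimilar (PiTheory.den P) (PiTheory.den Q) := by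
  refine ⟨fun f g => ∃ P Q : Proc 𝒩, f = PiTheory.den P ∧ g = PiTheory.den Q ∧ BarbedBisimilar P Q,
    ⟨?_, ?_⟩, P, Q, rfl, rfl, h⟩
  · rintro _ _ ⟨P, Q, rfl, rfl, h⟩
    exact ⟨Q, P, rfl, rfl, h.symm⟩
  · rintro p q ⟨P, Q, eP, eQ, h⟩
    have h : BarbedBisimilar p q := (sameBeh_of_den_eq eP).barbedBisimilar.trans
      (h.trans (sameBeh_of_den_eq eQ.symm).barbedBisimilar)
    refine ⟨fun p' hr => ?_, fun x hx => (obs_iff q x).2 (h.barb ((obs_iff p x).1 hx))⟩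
    obtain ⟨p'', hr', e⟩ := (sameBeh_of_den_eq (rfl : PiTheory.den p = _)).exists_red hr
    obtain ⟨q', hq, e'⟩ := h.exists_red hr'
    exact ⟨q', PiTheory.commRed_of_red hq, p', q', rfl, rfl, e.barbedBisimilar.trans e'⟩

/-- The relation obtained from a semantic bisimulation by composing with `SameBeh` on both sides
is a barbed bisimulation. The composition is needed because a semantic reduction `⟦Q⟧ ⇒ ⟦Q'⟧`
gives a reduction of `Q` to a process with a behaviour of `Q'` only. -/
theorem barbedBisimilar_of_semBisimilar {P Q : Proc 𝒩}
    (h : PiTheory.SemBisimilar (PiTheory.den P) (PiTheory.den Q)) : BarbedBisimilar P Q := by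
  obtain ⟨S, hS, h⟩ := h
  refine ⟨fun P Q => ∃ P₁ Q₁, SameBeh P P₁ ∧ S (PiTheory.den P₁) (PiTheory.den Q₁) ∧ SameBeh Q₁ Q,
    ⟨?_, ?_⟩, P, Q, sameBeh_of_den_eq rfl, h, sameBeh_of_den_eq rfl⟩
  · rintro P Q ⟨P₁, Q₁, hP, h, hQ⟩
    exact ⟨Q₁, P₁, hQ.symm, hS.1 _ _ h, hP.symm⟩
  · rintro P Q ⟨P₁, Q₁, hP, h, hQ⟩
    refine ⟨fun P' hr => ?_, fun x hx => ?_⟩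
    · obtain ⟨P₁', hr₁, hP'⟩ := hP.exists_red (PiTheory.commRed_of_red hr)
      obtain ⟨Q₁', hr', h'⟩ := (hS.2 _ _ h).1 P₁' (PiTheory.commRed_of_red hr₁)
      obtain ⟨Q', hr₂, hQ'⟩ := hQ.exists_red hr'
      exact ⟨Q', hr₂, P₁', Q₁', hP', h', hQ'⟩
    · exact hQ.barb ((obs_iff Q₁ x).1 ((hS.2 _ _ h).2 x ((obs_iff P₁ x).2 (hP.barb hx))))

end

end PiCalc

theorem mainTheorem1 {𝒩 : Type u} [DecidableEq 𝒩] [Infinite 𝒩] (P Q : PiCalc.Proc 𝒩) :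
    PiCalc.BarbedBisimilar P Q ↔ PiTheory.SemBisimilar (PiTheory.den P) (PiTheory.den Q) := by
  exact ⟨PiCalc.semBisimilar_of_barbedBisimilar, PiCalc.barbedBisimilar_of_semBisimilar⟩
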